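/- Let $r,p,n\ge 1$ be integers with $p\mid r$. Let $G(r,p,n)\le \mathrm{GL}_n(\mathbb C)$ be the group of all $n\times n$ monomial matrices whose nonzero entries are $r$-th roots of unity with product an $(r/p)$-th root of unity. Assume that $G(r,p,n)$ is not conjugate in $\mathrm{GL}_n(\mathbb C)$ to the complexification of a finite Coxeter group (a finite group generated by reflections of $\mathbb R^n$). Let $\Lambda\subset\mathbb C^n$ be a $G(r,p,n)$-invariant lattice (discrete subgroup) of full rank $2n$, and let $W=G(r,p,n)\ltimes\Lambda$ be the group of affine transformations $v\mapsto Av+b$, $A\in G(r,p,n)$, $b\in\Lambda$. Assume that $W$ is a reflection group, i.e. generated by affine reflections, where an affine reflection is a non-identity affine isometry of $\mathbb C^n$ (with its standard Hermitian inner product) fixing an affine hyperplane, its reflecting hyperplane, pointwise. (So $W$ is a genuine crystallographic complex reflection group.) Say that $W$ has the Steinberg property if the set of points of $\mathbb C^n$ with nontrivial stabilizer in $W$ is exactly the union of the reflecting hyperplanes of the reflections in $W$. Let $e_1,\dots,e_n$ be the standard basis of $\mathbb C^n$. Certain groups $[G(r,p,n)]_k=G(r,p,n)\ltimes\Lambda$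 are defined by the following lattices $\Lambda$, where in each case $\xi=e^{2\pi i/r}$ for the number $r$ in the name of the group, and $D=\sum_{j=2}^n\mathbb Z[\xi](e_{j-1}-e_j)$: * $[G(r,1,n)]_1$ ($r=3,4,6$; $n\ge1$): $\ \mathbb Z[\xi]e_1+D$; * $[G(r,1,n)]_2$ ($r=3,4$; $n\ge 2$): $\ \mathbb Z[\xi]e_1+\frac1{1-\xi}D$; * $[G(4,2,n)]_1$, $[G(6,2,n)]_1$, $[G(6,3,n)]_1$ ($n\ge2$): $\ \mathbb Z[\xi](\xi e_1-e_2)+D$; * $[G(4,2,n)]_2$ ($n\ge2$): $\ \mathbb Z[\xi](\xi e_1-e_2)+D+\mathbb Z[\xi]e_n$; * $[G(4,2,2)]_3$ and $[G(6,2,2)]_2$: $\ \mathbb Z[\xi](\xi e_1-e_2)+\mathbb Z[\xi](1+\xi)(e_1-e_2)$; * $[G(6,3,2)]_2$: $\ \mathbb Z[2\xi](\xi e_1-e_2)+\mathbb Z[2\xi](1-\xi)(e_1-e_2)$. Below, $W=[G(r',p',n)]_k$ means that the two groups are conjugate in the group of invertible affine transformations of $\mathbb C^n$. Then the following are equivalent: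 1. $W$ has the Steinberg property; 2. $r\neq p$, $W\neq[G(3,1,n)]_2$ (if $n\ge 2$), and $W\ne[G(6,3,2)]_2$ (if $n=2$); 3. $W$ is one of $[G(3,1,1)]_1$, $[G(4,1,1)]_1$, $[G(6,1,1)]_1$ (if $n=1$); $[G(3,1,n)]_1$, $[G(4,1,n)]_1$, $[G(4,1,n)]_2$, $[G(6,1,n)]_1$, $[G(4,2,n)]_1$, $[G(4,2,n)]_2$, $[G(6,2,n)]_1$, $[G(6,3,n)]_1$ (if $n\ge2$); $[G(4,2,2)]_3$, $[G(6,2,2)]_2$ (if $n=2$). -/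

import Mathlib

noncomputable section

namespace CrystRefl

/-- The Hermitian space `ℂⁿ` with its standard inner product. -/
abbrev Cn (n : ℕ) : Type := EuclideanSpace ℂ (Fin n)

/-- The group `A(V)` of invertible affine transformations of `V = ℂⁿ`. -/
abbrev Aff (n : ℕ) : Type := Cn n ≃ᵃ[ℂ] Cn n

/-- The group `GL(V)` of invertible linear transformations of `V = ℂⁿ`. -/
abbrev Lin (n : ℕ) : Type := Cn n ≃ₗ[ℂ] Cn n

/-! ### Affine reflections and the Steinberg property -/

/-- An affine hyperplane of `ℂⁿ`. -/
def IsAffineHyperplane {n : ℕ} (H : AffineSubspace ℂ (Cn n)) : Prop :=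
  (H : Set (Cn n)).Nonempty ∧ Module.finrank ℂ H.direction + 1 = n

/-- `s` is an affine reflection with reflecting hyperplane `H`: a non-identity affine isometry
fixing the affine hyperplane `H` pointwise. -/
def IsReflectionAbout {n : ℕ} (s : Aff n) (H : AffineSubspace ℂ (Cn n)) : Prop :=
  s ≠ 1 ∧ Isometry (fun v : Cn n => s v) ∧ IsAffineHyperplane H ∧ ∀ v ∈ H, s v = v

/-- `s` is an affine reflection. -/
def IsReflection {n : ℕ} (s : Aff n) : Prop :=
  ∃ H : AffineSubspace ℂ (Cn n), IsReflectionAbout s H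

/-- `W` is generated by affine reflections. -/
def IsGeneratedByReflections {n : ℕ} (W : Subgroup (Aff n)) : Prop :=
  Subgroup.closure {s : Aff n | s ∈ W ∧ IsReflection s} = W

/-- The reflecting hyperplanes of `W`. -/
def reflectingHyperplanes {n : ℕ} (W : Subgroup (Aff n)) : Set (AffineSubspace ℂ (Cn n)) :=
  {H | ∃ s ∈ W, IsReflectionAbout s H}

/-- A point is regular when its stabilizer in `W` is trivial. -/
def IsRegularPoint {n : ℕ} (W : Subgroup (Aff n)) (v : Cn n) : Prop :=
  ∀ g ∈ W, g v = v → g = 1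

/-- The nonregular points form exactly the union of the reflecting hyperplanes. -/
def SteinbergProperty {n : ℕ} (W : Subgroup (Aff n)) : Prop :=
  {v : Cn n | ¬ IsRegularPoint W v} = ⋃ H ∈ reflectingHyperplanes W, (H : Set (Cn n))

/-- Equivalence of groups of affine transformations: conjugacy in the full affine group. -/
def Equivalent {n : ℕ} (W W' : Subgroup (Aff n)) : Prop :=
  ∃ a : Aff n, W.map (MulAut.conj a).toMonoidHom = W'

/-! ### The finite groups `G(r,p,n)` -/

/-- `G(r,p,n)` (for `p ∣ r`): the monomial transformations whose nonzero matrix entries are `r`-th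
roots of unity with product an `(r/p)`-th root of unity. Here the nonzero entry of
row `i` is `d i`, and it stands in column `σ i`. -/
def G (r p n : ℕ) : Subgroup (Lin n) where
  carrier := {A | ∃ (σ : Equiv.Perm (Fin n)) (d : Fin n → ℂ),
    (∀ i, d i ^ r = 1) ∧ (∏ i, d i) ^ (r / p) = 1 ∧ ∀ (v : Cn n) (i : Fin n), A v i = d i * v (σ i)}
  mul_mem' := by
    rintro A B ⟨σ, d, hd, hp, hA⟩ ⟨τ, c, hc, hq, hB⟩
    refine ⟨σ.trans τ, fun i => d i * c (σ i), ?_, ?_, ?_⟩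
    · intro i
      rw [mul_pow, hd, hc, one_mul]
    · rw [Finset.prod_mul_distrib, Equiv.prod_comp σ c, mul_pow, hp, hq, one_mul]
    · intro v i
      rw [LinearEquiv.mul_apply, hA, hB, mul_assoc]
      rfl
  one_mem' := ⟨1, fun _ => 1, by simp, by simp, by simp⟩
  inv_mem' := by
    rintro A ⟨σ, d, hd, hp, hA⟩
    by_cases h : ∀ i, d i ≠ 0
    · refine ⟨σ.symm, fun i => (d (σ.symm i))⁻¹, ?_, ?_, ?_⟩
      · intro i
        rw [inv_pow, hd, inv_one]
      · rw [Equiv.prod_comp σ.symm (fun i => (d i)⁻¹), Finset.prod_inv_distrib, inv_pow, hp, inv_one]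
      · intro v i
        have key : A (A⁻¹ v) = v := by
          rw [← LinearEquiv.mul_apply, mul_inv_cancel]; rfl
        have := hA (A⁻¹ v) (σ.symm i)
        rw [key, Equiv.apply_symm_apply] at this
        rw [this, inv_mul_cancel_left₀ (h _)]
    · exfalso
      push Not at h
      obtain ⟨i, hi⟩ := h
      have := hA (A⁻¹ (EuclideanSpace.single i 1)) i
      rw [← LinearEquiv.mul_apply, mul_inv_cancel, hi] at this
      simp at this

/-- A real matrix that is a reflection of `ℝⁿ`: an involution fixing exactly a hyperplane. -/
def IsRealReflection {n : ℕ} (h : GL (Fin n) ℝ) : Prop :=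
  h * h = 1 ∧ ((h : Matrix (Fin n) (Fin n) ℝ) - 1).rank = 1

/-- The linear group `K` on `ℂⁿ` is, after a change of basis `P`, the complexification of a finite
Coxeter group `H`, that is, of a finite group generated by reflections of `ℝⁿ`. -/
def IsComplexifiedCoxeter {n : ℕ} (K : Subgroup (Lin n)) : Prop :=
  ∃ H : Subgroup (GL (Fin n) ℝ), Finite H ∧
    Subgroup.closure {h : GL (Fin n) ℝ | h ∈ H ∧ IsRealReflection h} = H ∧
    ∃ P : Cn n ≃ₗ[ℂ] (Fin n → ℂ), ∀ A : Lin n, A ∈ K ↔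
      ∃ h ∈ H, ∀ v : Cn n,
        P (A v) = ((h : Matrix (Fin n) (Fin n) ℝ).map Complex.ofReal).mulVec (P v)

/-! ### The groups `G ⋉ Λ` -/

/-- The lattice `Λ` is stable under the linear group `K`. -/
def IsInvariant {n : ℕ} (K : Subgroup (Lin n)) (Λ : Submodule ℤ (Cn n)) : Prop :=
  ∀ A ∈ K, ∀ v ∈ Λ, A v ∈ Λ

/-- The subgroup of the affine group generated by `K` and by the translations along `Λ`. When `Λ`
is `K`-invariant this is the semidirect product `K ⋉ Λ`, see `mem_semidirect_iff`. -/
def semidirect {n : ℕ} (K : Subgroup (Lin n)) (Λ : Submodule ℤ (Cn n)) : Subgroup (Aff n) :=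
  Subgroup.closure
    ({g | ∃ A ∈ K, ∀ v, g v = A v} ∪ {g | ∃ b ∈ Λ, ∀ v, g v = v + b})

/-- If `Λ` is `K`-invariant, the elements of `K ⋉ Λ` are the maps `v ↦ A v + b`, `A ∈ K`, `b ∈ Λ`. -/
theorem mem_semidirect_iff {n : ℕ} {K : Subgroup (Lin n)} {Λ : Submodule ℤ (Cn n)}
    (hΛ : IsInvariant K Λ) (g : Aff n) :
    g ∈ semidirect K Λ ↔ ∃ A ∈ K, ∃ b ∈ Λ, ∀ v, g v = A v + b := by
  constructor
  · intro hg
    induction hg using Subgroup.closure_induction with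
    | mem x hx =>
      rcases hx with ⟨A, hA, h⟩ | ⟨b, hb, h⟩
      · exact ⟨A, hA, 0, Λ.zero_mem, fun v => by rw [h, add_zero]⟩
      · exact ⟨1, K.one_mem, b, hb, fun v => by rw [h]; rfl⟩
    | one => exact ⟨1, K.one_mem, 0, Λ.zero_mem, fun v => by simp⟩
    | mul x y _ _ hx hy =>
      obtain ⟨A, hA, a, ha, h⟩ := hx
      obtain ⟨B, hB, b, hb, h'⟩ := hy
      refine ⟨A * B, K.mul_mem hA hB, A b + a, Λ.add_mem (hΛ A hA b hb) ha, fun v => ?_⟩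
      rw [AffineEquiv.mul_def, AffineEquiv.trans_apply, h', h, map_add, LinearEquiv.mul_apply,
        add_assoc]
    | inv x _ hx =>
      obtain ⟨A, hA, a, ha, h⟩ := hx
      refine ⟨A⁻¹, K.inv_mem hA, -(A⁻¹ a), Λ.neg_mem (hΛ _ (K.inv_mem hA) a ha), fun v => ?_⟩
      have key : ∀ w, A (A⁻¹ w) = w := fun w => by
        rw [← LinearEquiv.mul_apply, mul_inv_cancel]; rfl
      have hx : ∀ w, x (x⁻¹ w) = w := fun w => x.apply_symm_apply w
      apply x.injective
      rw [hx, h, map_add, map_neg, key, key, neg_add_cancel_right]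
  · rintro ⟨A, hA, b, hb, h⟩
    have h1 : A.toAffineEquiv ∈ semidirect K Λ :=
      Subgroup.subset_closure (Or.inl ⟨A, hA, fun _ => rfl⟩)
    have h2 : AffineEquiv.constVAdd ℂ (Cn n) b ∈ semidirect K Λ :=
      Subgroup.subset_closure (Or.inr ⟨b, hb, fun v => by simp [add_comm]⟩)
    have : g = AffineEquiv.constVAdd ℂ (Cn n) b * A.toAffineEquiv := by
      ext1 v
      rw [h, AffineEquiv.mul_def, AffineEquiv.trans_apply]
      simp [add_comm]
    rw [this]
    exact Subgroup.mul_mem _ h2 h1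

/-! ### The lattices and the groups `[G(r,p,n)]_k` -/

/-- The primitive `r`-th root of unity `e^{2πi/r}`. -/
def ξ (r : ℕ) : ℂ := Complex.exp (2 * Real.pi * Complex.I / r)

/-- The standard basis vector `e_k` of `ℂⁿ`, numbered from `k = 1` to `k = n`. -/
def e (n k : ℕ) : Cn n := WithLp.toLp 2 (fun i : Fin n => if (i : ℕ) + 1 = k then 1 else 0)

/-- The subring `ℤ[x]` of `ℂ` generated by `x`. -/
def adjoinZ (x : ℂ) : Subalgebra ℤ ℂ := Algebra.adjoin ℤ {x}

/-- The sum `∑_{v ∈ S} R v` for a subring `R` of `ℂ` and a set `S` of vectors. -/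
def ringSpan {n : ℕ} (R : Subalgebra ℤ ℂ) (S : Set (Cn n)) : Submodule ℤ (Cn n) :=
  Submodule.span ℤ {w | ∃ a ∈ R, ∃ v ∈ S, w = a • v}

/-- The vectors `c (e_{j-1} - e_j)` for `2 ≤ j ≤ n`. -/
def diffs (n : ℕ) (c : ℂ) : Set (Cn n) :=
  {v | ∃ j : ℕ, 2 ≤ j ∧ j ≤ n ∧ v = c • (e n (j - 1) - e n j)}

/-- `[G(r,1,n)]_1`, with lattice `ℤ[ξ] e_1 + ∑_j ℤ[ξ] (e_{j-1} - e_j)`. -/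
def Gr1n_1 (r n : ℕ) : Subgroup (Aff n) :=
  semidirect (G r 1 n) (ringSpan (adjoinZ (ξ r)) ({e n 1} ∪ diffs n 1))

/-- `[G(r,1,n)]_2`, with lattice `ℤ[ξ] e_1 + ∑_j ℤ[ξ] (1/(1-ξ)) (e_{j-1} - e_j)`. -/
def Gr1n_2 (r n : ℕ) : Subgroup (Aff n) :=
  semidirect (G r 1 n) (ringSpan (adjoinZ (ξ r)) ({e n 1} ∪ diffs n (1 / (1 - ξ r))))

/-- `[G(r,p,n)]_1` for `p ≥ 2`, with lattice `ℤ[ξ] (ξ e_1 - e_2) + ∑_j ℤ[ξ] (e_{j-1} - e_j)`. -/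
def Grpn_1 (r p n : ℕ) : Subgroup (Aff n) :=
  semidirect (G r p n) (ringSpan (adjoinZ (ξ r)) ({ξ r • e n 1 - e n 2} ∪ diffs n 1))

/-- `[G(4,2,n)]_2`, with lattice
`ℤ[ξ] (ξ e_1 - e_2) + ∑_j ℤ[ξ] (e_{j-1} - e_j) + ℤ[ξ] e_n`, `ξ = i`. -/
def G42n_2 (n : ℕ) : Subgroup (Aff n) :=
  semidirect (G 4 2 n)
    (ringSpan (adjoinZ (ξ 4)) ({ξ 4 • e n 1 - e n 2} ∪ diffs n 1 ∪ {e n n}))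

/-- `[G(4,2,2)]_3` (for `r = 4`) and `[G(6,2,2)]_2` (for `r = 6`), where `n = 2`, with lattice
`ℤ[ξ] (ξ e_1 - e_2) + ℤ[ξ] (1+ξ) (e_1 - e_2)`. -/
def Gr22_extra (r n : ℕ) : Subgroup (Aff n) :=
  semidirect (G r 2 n)
    (ringSpan (adjoinZ (ξ r)) {ξ r • e n 1 - e n 2, (1 + ξ r) • (e n 1 - e n 2)})

/-- `[G(6,3,2)]_2`, where `n = 2`, with lattice
`ℤ[2ξ] (ξ e_1 - e_2) + ℤ[2ξ] (1-ξ) (e_1 - e_2)`. -/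
def G632_2 (n : ℕ) : Subgroup (Aff n) :=
  semidirect (G 6 3 n)
    (ringSpan (adjoinZ (2 * ξ 6)) {ξ 6 • e n 1 - e n 2, (1 - ξ 6) • (e n 1 - e n 2)})

/-- Up to equivalence, `W` is one of `[G(r,1,1)]_1` (`r = 3, 4, 6`), `[G(3,1,n)]_1`,
`[G(4,1,n)]_{1,2}`, `[G(6,1,n)]_1`, `[G(4,2,n)]_{1,2}`, `[G(6,2,n)]_1`, `[G(6,3,n)]_1` (`n ≥ 2`),
`[G(4,2,2)]_3`, `[G(6,2,2)]_2`. -/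
def IsOnList {n : ℕ} (W : Subgroup (Aff n)) : Prop :=
  (n = 1 ∧ ∃ r : ℕ, (r = 3 ∨ r = 4 ∨ r = 6) ∧ Equivalent W (Gr1n_1 r n)) ∨
  (2 ≤ n ∧
    (Equivalent W (Gr1n_1 3 n) ∨
     Equivalent W (Gr1n_1 4 n) ∨ Equivalent W (Gr1n_2 4 n) ∨
     Equivalent W (Gr1n_1 6 n) ∨
     Equivalent W (Grpn_1 4 2 n) ∨ Equivalent W (G42n_2 n) ∨
     Equivalent W (Grpn_1 6 2 n) ∨
     Equivalent W (Grpn_1 6 3 n))) ∨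
  (n = 2 ∧ (Equivalent W (Gr22_extra 4 n) ∨ Equivalent W (Gr22_extra 6 n)))

end CrystRefl

end

/-!
Write `R = ℤ[ξ]`, `ω = ξ 3`, `θ = 1 - ω`, and let `Λ` be an invariant lattice.

A reflection in `G(r,p,n) ⋉ Λ` multiplies one coordinate by an `(r/p)`-th root of unity `η ≠ 1`, or
exchanges two coordinates up to an `r`-th root of unity `ζ`, and its translation part is determined
by any point `v` of its mirror: it is `(1 - η) vᵢ eᵢ` or `(vᵢ - ζ vⱼ)(eᵢ - ζ⁻¹ eⱼ)`
(`reflection_translation`). So `v` lies on a mirror exactly if one of these vectors is in `Λ`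
(`onMirror_iff`), and the Steinberg property is a statement about congruences (`steinberg_iff`).
Moreover, if the group is generated by reflections, `Λ` is spanned by its vectors on the coordinate
axes and on the root lines `ℂ (eᵢ - ζ⁻¹ eⱼ)` (`le_span_lineVectors`).

The Steinberg property is invariant under equivalence (`Equivalent.steinberg`), and every group that
has to be considered is equivalent to one whose lattice is `sumLattice`, the vectors over `R` with
coordinate sum in `δ R`, or, in dimension two, `twistLattice`, the vectors over `R` with
`x₁ ≡ f x₀` modulo `δ`.

*The groups on the list have the property* (`IsOnList.steinberg`). Only elements whose linear part
has trivial permutation part and at least two entries `≠ 1` are in question, and also, for the two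
`twistLattice` groups, the exchange of the coordinates. Such an element confines two coordinates of
its fixed points to a fractional ideal `m⁻¹ R`, where `m` is `θ`, `2` or `1 ± i`. The invertible
residue classes modulo `m` are represented by roots of unity, so the point lies on the mirror of a
reflection in one of the coordinates, or `vᵢ - ζ vⱼ` is integral for some `ζ`.

*The excluded groups do not have it.* If `r = p` and `n ≥ 3`, or for `[G(3,1,n)]_2` and
`[G(6,3,2)]_2`, there are explicit points fixed by a nontrivial element that lie on no mirror
(`not_steinberg_rr`, `not_steinberg_sumLattice_three`, `not_steinberg_G632_2`). The coordinates that
play no role are short and of different lengths, so that a difference `vᵢ - ζ vⱼ` is too short to be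
integral.

*There are no other groups* (`classification`, `isOnList_one`). If `r ≠ p`, then `Λ` meets the axes
in a nonzero discrete `R`-module; hence `r ∈ {3, 4, 6}` (`order_of_discrete`), this module is `c R`
(`exists_generator`), and one may take `c = 1`. A root line meets `Λ` in an `R`-module between `R`
and `(1 - ξ)⁻¹ R` when `n ≥ 3` or `p = 1`, where all root lines are conjugate. The cases left are
`G(4,2,2)`, `G(6,2,2)` and `G(6,3,2)`, where a largest intersection with a root line determines `Λ` up to a
diagonal matrix.

The groups with `r ≤ 2`, with `n = 1` and `r / p ≤ 2`, and with `n = 2` and `r = p` are complexified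
Coxeter groups (`isComplexifiedCoxeter_sign`, `isComplexifiedCoxeter_one`,
`isComplexifiedCoxeter_dihedral`).
-/

noncomputable section

namespace CrystRefl

/-! ### Monomial maps and the elements of `G(r,p,n) ⋉ Λ` -/

/-- The monomial transformation whose nonzero entry in row `i` is `d i`, in column `σ i`. -/
def monomial {n : ℕ} (σ : Equiv.Perm (Fin n)) (d : Fin n → ℂ) (hd : ∀ i, d i ≠ 0) : Lin n where
  toFun v := WithLp.toLp 2 fun i => d i * v (σ i)
  invFun v := WithLp.toLp 2 fun i => (d (σ.symm i))⁻¹ * v (σ.symm i)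
  map_add' v w := by ext i; simp [mul_add]
  map_smul' c v := by ext i; simp [mul_left_comm]
  left_inv v := by ext i; simp [hd]
  right_inv v := by ext i; simp [hd]

@[simp]
theorem monomial_apply {n : ℕ} (σ : Equiv.Perm (Fin n)) (d : Fin n → ℂ) (hd : ∀ i, d i ≠ 0)
    (v : Cn n) (i : Fin n) : monomial σ d hd v i = d i * v (σ i) := rfl

theorem ne_zero_of_pow {r : ℕ} (hr : r ≠ 0) {z : ℂ} (h : z ^ r = 1) : z ≠ 0 := by
  rintro rfl
  simp [hr] at h

theorem norm_of_pow {r : ℕ} (hr : r ≠ 0) {z : ℂ} (h : z ^ r = 1) : ‖z‖ = 1 :=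
  Complex.norm_eq_one_of_pow_eq_one h hr

theorem pow_eq_one_of_div {r p : ℕ} (hpr : p ∣ r) {z : ℂ} (h : z ^ (r / p) = 1) : z ^ r = 1 := by
  obtain ⟨k, hk⟩ := Nat.div_dvd_of_dvd hpr
  rw [hk, pow_mul, h, one_pow]

theorem monomial_mem_G {n r p : ℕ} (σ : Equiv.Perm (Fin n)) (d : Fin n → ℂ) (hd : ∀ i, d i ≠ 0)
    (h1 : ∀ i, d i ^ r = 1) (h2 : (∏ i, d i) ^ (r / p) = 1) : monomial σ d hd ∈ G r p n :=
  ⟨σ, d, h1, h2, fun _ _ => rfl⟩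

theorem mem_semidirect_G_iff {n r p : ℕ} {Λ : Submodule ℤ (Cn n)}
    (hΛ : IsInvariant (G r p n) Λ) (g : Aff n) :
    g ∈ semidirect (G r p n) Λ ↔ ∃ (σ : Equiv.Perm (Fin n)) (d : Fin n → ℂ) (b : Cn n),
      (∀ i, d i ^ r = 1) ∧ (∏ i, d i) ^ (r / p) = 1 ∧ b ∈ Λ ∧
        ∀ v i, g v i = d i * v (σ i) + b i := by
  rw [mem_semidirect_iff hΛ]
  constructor
  · rintro ⟨A, ⟨σ, d, h1, h2, h3⟩, b, hb, h⟩
    exact ⟨σ, d, b, h1, h2, hb, fun v i => by rw [h, PiLp.add_apply, h3]⟩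
  · rintro ⟨σ, d, b, h1, h2, hb, h⟩
    by_cases hd : ∀ i, d i ≠ 0
    · refine ⟨monomial σ d hd, monomial_mem_G σ d hd h1 h2, b, hb, fun v => ?_⟩
      ext i
      simp [h]
    · -- a zero entry contradicts the surjectivity of `g`
      exfalso
      push Not at hd
      obtain ⟨i, hi⟩ := hd
      have := h (g.symm (b + EuclideanSpace.single i 1)) i
      rw [AffineEquiv.apply_symm_apply, hi] at this
      simp at this

theorem exists_mem_semidirect {n r p : ℕ} {Λ : Submodule ℤ (Cn n)} (hr : r ≠ 0)
    (hΛ : IsInvariant (G r p n) Λ) (σ : Equiv.Perm (Fin n)) (d : Fin n → ℂ) (b : Cn n)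
    (h1 : ∀ i, d i ^ r = 1) (h2 : (∏ i, d i) ^ (r / p) = 1) (hb : b ∈ Λ) :
    ∃ g ∈ semidirect (G r p n) Λ, ∀ v i, g v i = d i * v (σ i) + b i := by
  have hd : ∀ i, d i ≠ 0 := fun i => ne_zero_of_pow hr (h1 i)
  have h : ∀ v i, ((monomial σ d hd).toAffineEquiv.trans (AffineEquiv.constVAdd ℂ (Cn n) b)) v i
      = d i * v (σ i) + b i := by
    intro v i
    simp [add_comm]
  exact ⟨_, (mem_semidirect_G_iff hΛ _).2 ⟨σ, d, b, h1, h2, hb, h⟩, h⟩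

/-- The coordinates of `A v`, for monomial `A` and a lattice stable under `G(r,p,n)`. -/
theorem IsInvariant.monomial_mem {n r p : ℕ} {Λ : Submodule ℤ (Cn n)} (hr : r ≠ 0)
    (hΛ : IsInvariant (G r p n) Λ) (σ : Equiv.Perm (Fin n)) (d : Fin n → ℂ)
    (h1 : ∀ i, d i ^ r = 1) (h2 : (∏ i, d i) ^ (r / p) = 1) {v w : Cn n} (hv : v ∈ Λ)
    (hw : ∀ i, w i = d i * v (σ i)) : w ∈ Λ := by
  have hd : ∀ i, d i ≠ 0 := fun i => ne_zero_of_pow hr (h1 i)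
  have : w = monomial σ d hd v := by
    ext i
    simp [hw]
  rw [this]
  exact hΛ _ (monomial_mem_G σ d hd h1 h2) v hv

/-- All elements of the group are isometries. -/
def IsIsometric {n : ℕ} (W : Subgroup (Aff n)) : Prop :=
  ∀ g ∈ W, Isometry (fun v : Cn n => g v)

theorem isIsometric_semidirect {r : ℕ} (hr : r ≠ 0) (p n : ℕ) (Λ : Submodule ℤ (Cn n)) :
    IsIsometric (semidirect (G r p n) Λ) := by
  intro g hg
  induction hg using Subgroup.closure_induction with
  | mem x hx =>
    rcases hx with ⟨A, ⟨σ, d, h1, h2, h3⟩, h⟩ | ⟨b, hb, h⟩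
    · refine Isometry.of_dist_eq fun v w => ?_
      rw [h, h, dist_eq_norm, dist_eq_norm, ← map_sub, EuclideanSpace.norm_eq,
        EuclideanSpace.norm_eq, ← Equiv.sum_comp σ (fun i => ‖(v - w) i‖ ^ 2)]
      congr 1
      refine Finset.sum_congr rfl fun i _ => ?_
      rw [h3, norm_mul, norm_of_pow hr (h1 i), one_mul]
    · refine Isometry.of_dist_eq fun v w => ?_
      rw [h, h, dist_add_right]
  | one => exact isometry_id
  | mul x y _ _ hx hy => exact hx.comp hy
  | inv x _ hx => exact hx.right_inv (fun v => x.apply_symm_apply v)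

/-! ### Reflections in `G(r,p,n) ⋉ Λ` and their mirrors -/

/-- The point `v` lies on the mirror of a reflection of `G(r,p,n) ⋉ Λ`. There are two kinds of
reflections: multiplication of one coordinate by `η`, and exchange of the coordinates `i` and `j`
up to `ζ`; the two alternatives say that the translation part that makes the reflection fix `v`
belongs to `Λ`. -/
def OnMirror {n : ℕ} (r p : ℕ) (Λ : Submodule ℤ (Cn n)) (v : Cn n) : Prop :=
  (∃ (i : Fin n) (η : ℂ), η ^ (r / p) = 1 ∧ η ≠ 1 ∧ EuclideanSpace.single i ((1 - η) * v i) ∈ Λ) ∨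
  (∃ (i j : Fin n) (ζ : ℂ), i ≠ j ∧ ζ ^ r = 1 ∧
    EuclideanSpace.single i (v i - ζ * v j) -
      EuclideanSpace.single j (ζ⁻¹ * (v i - ζ * v j)) ∈ Λ)

theorem finrank_ker_add_one {n : ℕ} (f : Cn n →ₗ[ℂ] ℂ) (hf : f ≠ 0) :
    Module.finrank ℂ (LinearMap.ker f) + 1 = n := by
  have := Module.Dual.finrank_ker_add_one_of_ne_zero (K := ℂ) (f := f) hf
  simpa using this

theorem isReflectionAbout_mk' {n : ℕ} {g : Aff n} {f : Cn n →ₗ[ℂ] ℂ} (hf : f ≠ 0) (v : Cn n)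
    (hfix : ∀ w, f w = f v → g w = w) (hne : g ≠ 1) (hg : Isometry (fun v : Cn n => g v)) :
    IsReflectionAbout g (AffineSubspace.mk' v (LinearMap.ker f)) := by
  refine ⟨hne, hg, ⟨⟨v, AffineSubspace.self_mem_mk' _ _⟩, ?_⟩, fun w hw => ?_⟩
  · rw [AffineSubspace.direction_mk']
    exact finrank_ker_add_one f hf
  · apply hfix
    rw [AffineSubspace.mem_mk', LinearMap.mem_ker, vsub_eq_sub, map_sub, sub_eq_zero] at hw
    exact hw

/-- The `i`-th coordinate as a linear form. -/
def coord {n : ℕ} (i : Fin n) : Cn n →ₗ[ℂ] ℂ where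
  toFun v := v i
  map_add' _ _ := rfl
  map_smul' _ _ := rfl

@[simp]
theorem coord_apply {n : ℕ} (i : Fin n) (v : Cn n) : coord i v = v i := rfl

/-- The two kinds of elements in `OnMirror` are indeed reflections in `G(r,p,n) ⋉ Λ`. -/
theorem OnMirror.exists_mem {n r p : ℕ} {Λ : Submodule ℤ (Cn n)} (hr : r ≠ 0) (hpr : p ∣ r)
    (hΛ : IsInvariant (G r p n) Λ) {v : Cn n} (h : OnMirror r p Λ v) :
    ∃ H ∈ reflectingHyperplanes (semidirect (G r p n) Λ), v ∈ H := by
  rcases h with ⟨i, η, hη, hη1, hb⟩ | ⟨i, j, ζ, hij, hζ, hb⟩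
  · have hprod : ∏ k, Function.update (fun _ : Fin n => (1 : ℂ)) i η k = η := by
      rw [Finset.prod_update_of_mem (Finset.mem_univ i)]
      simp
    obtain ⟨g, hg, h⟩ := exists_mem_semidirect hr hΛ 1 (Function.update (fun _ => 1) i η) _
      (fun k => by
        rcases eq_or_ne k i with rfl | hk
        · simpa using pow_eq_one_of_div hpr hη
        · simp [hk]) (by rw [hprod, hη]) hb
    refine ⟨_, ⟨g, hg, isReflectionAbout_mk' (f := coord i) ?_ v (fun w hw => ?_) ?_
      (isIsometric_semidirect hr p n Λ g hg)⟩, AffineSubspace.self_mem_mk' _ _⟩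
    · intro h0
      have := LinearMap.congr_fun h0 (EuclideanSpace.single i 1)
      simp at this
    · simp only [coord_apply] at hw
      ext k
      rw [h]
      rcases eq_or_ne k i with rfl | hk
      · simp [← hw]
        ring
      · simp [hk]
    · rintro rfl
      have h0 := h (EuclideanSpace.single i 1) i
      have h1 := h 0 i
      simp at h0 h1
      rcases h1 with h1 | h1
      · exact hη1 (sub_eq_zero.1 h1).symm
      · rw [h1] at h0
        simp at h0
        exact hη1 h0.symm
  · have hζ0 := ne_zero_of_pow hr hζ
    have hprod : ∏ k, Function.update (Function.update (fun _ : Fin n => (1 : ℂ)) j ζ⁻¹) i ζ k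
        = 1 := by
      rw [Finset.prod_update_of_mem (Finset.mem_univ i),
        Finset.prod_update_of_mem (by simp [hij.symm])]
      simp [hζ0]
    obtain ⟨g, hg, h⟩ := exists_mem_semidirect hr hΛ (Equiv.swap i j)
      (Function.update (Function.update (fun _ : Fin n => (1 : ℂ)) j ζ⁻¹) i ζ) _
      (fun k => by
        rcases eq_or_ne k i with rfl | hk
        · simpa using hζ
        · rcases eq_or_ne k j with rfl | hk'
          · simp [hk, hζ]
          · simp [hk, hk']) (by rw [hprod, one_pow]) hb
    refine ⟨_, ⟨g, hg, isReflectionAbout_mk' (f := coord i - ζ • coord j) ?_ v (fun w hw => ?_) ?_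
      (isIsometric_semidirect hr p n Λ g hg)⟩, AffineSubspace.self_mem_mk' _ _⟩
    · intro h0
      have := LinearMap.congr_fun h0 (EuclideanSpace.single i 1)
      simp [hij.symm] at this
    · simp only [coord_apply, LinearMap.sub_apply, LinearMap.smul_apply, smul_eq_mul] at hw
      ext k
      rw [h]
      rcases eq_or_ne k i with rfl | hk
      · simp [← hw, hij]
      · rcases eq_or_ne k j with rfl | hk'
        · simp [hk, ← hw]
          field_simp
          ring
        · simp [hk, hk', Equiv.swap_apply_of_ne_of_ne hk hk']
    · rintro rfl
      have h0 := h (EuclideanSpace.single i 1) i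
      have h1 := h 0 i
      simp [hij, hij.symm] at h0 h1
      exact one_ne_zero (h0.trans h1.symm)

/-- A reflection of `G(r,p,n) ⋉ Λ` is of one of the two kinds of `OnMirror`, and its translation
part is determined by any point of its mirror. -/
theorem reflection_translation {n r p : ℕ} {H : AffineSubspace ℂ (Cn n)} {g : Aff n}
    (hg : IsReflectionAbout g H) {σ : Equiv.Perm (Fin n)} {d : Fin n → ℂ} {b : Cn n}
    (h1 : ∀ i, d i ^ r = 1) (h2 : (∏ i, d i) ^ (r / p) = 1)
    (h : ∀ v i, g v i = d i * v (σ i) + b i) :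
    (∃ (i : Fin n) (η : ℂ), η ^ (r / p) = 1 ∧ η ≠ 1 ∧
      ∀ v ∈ H, b = EuclideanSpace.single i ((1 - η) * v i)) ∨
    (∃ (i j : Fin n) (ζ : ℂ), i ≠ j ∧ ζ ^ r = 1 ∧
      ∀ v ∈ H, b = EuclideanSpace.single i (v i - ζ * v j) -
        EuclideanSpace.single j (ζ⁻¹ * (v i - ζ * v j))) := by
  obtain ⟨hne, -, ⟨⟨v0, hv0⟩, hdim⟩, hfix⟩ := hg
  have hv0' : v0 ∈ H := hv0
  have hdir : ∀ w ∈ H.direction, ∀ i, w i = d i * w (σ i) := by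
    intro w hw i
    have e1 := h (w + v0) i
    rw [hfix (w + v0) (AffineSubspace.vadd_mem_of_mem_direction hw hv0)] at e1
    have e2 := h v0 i
    rw [hfix v0 hv0'] at e2
    simp only [PiLp.add_apply] at e1
    linear_combination e1 - e2
  have hb : ∀ v ∈ H, ∀ i, b i = v i - d i * v (σ i) := by
    intro v hv i
    have e1 := h v i
    rw [hfix v hv] at e1
    linear_combination -e1
  -- A linear form that vanishes on the direction of `H` has it as its kernel, so that the linear
  -- part of `g` is the identity on this kernel.
  have hker : ∀ f : Cn n →ₗ[ℂ] ℂ, f ≠ 0 → (∀ w ∈ H.direction, f w = 0) →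
      ∀ w, f w = 0 → ∀ i, w i = d i * w (σ i) := by
    intro f hf hle w hw
    have hle' : H.direction ≤ LinearMap.ker f := fun w hw => hle w hw
    have := Submodule.eq_of_le_of_finrank_eq hle' (by
      have := finrank_ker_add_one f hf
      omega)
    apply hdir
    rw [this]
    exact hw
  by_cases hσ : σ = 1
  · subst hσ
    left
    have hex : ∃ i, d i ≠ 1 := by
      by_contra hcon
      push Not at hcon
      apply hne
      ext1 v
      ext i
      rw [h, hb v0 hv0']
      simp [hcon]
    obtain ⟨i, hi⟩ := hex
    have hk := hker (coord i) (by
      intro h0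
      have := LinearMap.congr_fun h0 (EuclideanSpace.single i 1)
      simp at this) (fun w hw => by
        have := hdir w hw i
        simp only [Equiv.Perm.coe_one, id_eq] at this
        have h' : (d i - 1) * w i = 0 := by linear_combination -this
        simpa [sub_eq_zero, hi] using h')
    have hd : ∀ k, k ≠ i → d k = 1 := by
      intro k hki
      have := hk (EuclideanSpace.single k 1) (by simp [hki]) k
      simpa using this.symm
    have hprod : ∏ k, d k = d i := by
      rw [Finset.prod_eq_single i (fun k _ hk => hd k hk) (by simp)]
    refine ⟨i, d i, by rw [← hprod, h2], hi, fun v hv => ?_⟩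
    ext k
    rw [hb v hv]
    rcases eq_or_ne k i with rfl | hki
    · simp
      ring
    · simp [hki, hd k hki]
  · right
    have hex : ∃ i, σ i ≠ i := by
      by_contra hcon
      push Not at hcon
      exact hσ (Equiv.ext hcon)
    obtain ⟨i, hi⟩ := hex
    obtain ⟨j, hj⟩ : ∃ j, σ i = j := ⟨_, rfl⟩
    have hij : i ≠ j := fun h => hi (by rw [hj, h])
    have hk := hker (coord i - d i • coord j) (by
      intro h0
      have := LinearMap.congr_fun h0 (EuclideanSpace.single i 1)
      simp [hij.symm] at this) (fun w hw => by
        have := hdir w hw i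
        rw [hj] at this
        simp [← this])
    have hd : ∀ k, k ≠ i → k ≠ j → σ k = k ∧ d k = 1 := by
      intro k hki hkj
      have := hk (EuclideanSpace.single k 1) (by simp [hki.symm, hkj.symm]) k
      have hσk : σ k = k := by
        by_contra hne
        simp [hne] at this
      exact ⟨hσk, by simpa [hσk] using this.symm⟩
    have hσj : σ j = i := by
      by_contra hne
      have h3 : σ j ≠ j := fun h => hij (σ.injective (hj.trans h.symm))
      have := (hd (σ j) hne h3).1
      exact h3 (σ.injective this)
    have hdj : d j * d i = 1 := by
      have := hk (EuclideanSpace.single i (d i) + EuclideanSpace.single j 1)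
        (by simp [hij, hij.symm]) j
      simp [hσj, hij, hij.symm] at this
      exact this.symm
    have hdi : d i ≠ 0 := right_ne_zero_of_mul_eq_one hdj
    refine ⟨i, j, d i, hij, h1 i, fun v hv => ?_⟩
    ext k
    rw [hb v hv]
    rcases eq_or_ne k i with rfl | hki
    · simp [hj, hij]
    · rcases eq_or_ne k j with rfl | hkj
      · simp [hσj, hki, eq_inv_of_mul_eq_one_left hdj]
        field_simp
        ring
      · simp [hki, hkj, (hd k hki hkj).1, (hd k hki hkj).2]

theorem onMirror_iff {n r p : ℕ} {Λ : Submodule ℤ (Cn n)} (hr : r ≠ 0) (hpr : p ∣ r)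
    (hΛ : IsInvariant (G r p n) Λ) {v : Cn n} :
    OnMirror r p Λ v ↔ ∃ H ∈ reflectingHyperplanes (semidirect (G r p n) Λ), v ∈ H := by
  refine ⟨OnMirror.exists_mem hr hpr hΛ, ?_⟩
  rintro ⟨H, ⟨g, hgW, hg⟩, hv⟩
  obtain ⟨σ, d, b, h1, h2, hbΛ, h⟩ := (mem_semidirect_G_iff hΛ g).1 hgW
  rcases reflection_translation hg h1 h2 h with ⟨i, η, hη, hη1, hb⟩ | ⟨i, j, ζ, hij, hζ, hb⟩
  · exact Or.inl ⟨i, η, hη, hη1, hb v hv ▸ hbΛ⟩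
  · exact Or.inr ⟨i, j, ζ, hij, hζ, hb v hv ▸ hbΛ⟩

/-- The Steinberg property says that every point fixed by a nontrivial element lies on a mirror. -/
theorem steinberg_iff {n r p : ℕ} {Λ : Submodule ℤ (Cn n)} (hr : r ≠ 0) (hpr : p ∣ r)
    (hΛ : IsInvariant (G r p n) Λ) :
    SteinbergProperty (semidirect (G r p n) Λ) ↔
      ∀ (σ : Equiv.Perm (Fin n)) (d : Fin n → ℂ) (v b : Cn n), (∀ i, d i ^ r = 1) →
        (∏ i, d i) ^ (r / p) = 1 → b ∈ Λ → (∀ i, v i = d i * v (σ i) + b i) →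
        (σ ≠ 1 ∨ ∃ i, d i ≠ 1) → OnMirror r p Λ v := by
  constructor
  · intro hS σ d v b h1 h2 hb hv hne
    obtain ⟨g, hg, h⟩ := exists_mem_semidirect hr hΛ σ d b h1 h2 hb
    rw [onMirror_iff hr hpr hΛ]
    have hmem : v ∈ {v : Cn n | ¬ IsRegularPoint (semidirect (G r p n) Λ) v} := by
      intro hreg
      have hg1 : g = 1 := hreg g hg (by
        ext i
        rw [h, ← hv])
      subst hg1
      have hlin : ∀ w : Cn n, ∀ i, w i = d i * w (σ i) := by
        intro w i
        have e1 := h w i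
        have e2 := h 0 i
        simp at e1 e2
        rw [← e2, add_zero] at e1
        exact e1
      rcases hne with hσ | ⟨i, hi⟩
      · apply hσ
        ext1 k
        have := hlin (EuclideanSpace.single k 1) k
        by_contra hk
        simp at hk
        simp [hk] at this
      · have := hlin (WithLp.toLp 2 fun _ => 1) i
        simp at this
        exact hi this.symm
    rw [hS] at hmem
    simpa using hmem
  · intro hall
    ext v
    simp only [Set.mem_ofPred_eq, Set.mem_iUnion, SetLike.mem_coe, exists_prop]
    rw [← onMirror_iff hr hpr hΛ]
    constructor
    · intro hv
      unfold IsRegularPoint at hv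
      push Not at hv
      obtain ⟨g, hgW, hgv, hg1⟩ := hv
      obtain ⟨σ, d, b, h1, h2, hbΛ, h⟩ := (mem_semidirect_G_iff hΛ g).1 hgW
      refine hall σ d v b h1 h2 hbΛ (fun i => by rw [← h, hgv]) ?_
      by_contra hcon
      push Not at hcon
      obtain ⟨rfl, hd⟩ := hcon
      apply hg1
      ext1 w
      ext i
      have := h v i
      rw [hgv] at this
      simp [hd] at this
      rw [h]
      simp [hd, this]
    · intro hv hreg
      obtain ⟨H, ⟨g, hgW, hg⟩, hvH⟩ := (onMirror_iff hr hpr hΛ).1 hv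
      exact hg.1 (hreg g hgW (hg.2.2.2 v hvH))

/-! ### Lattices of groups generated by reflections -/

/-- The vectors of `Λ` on a coordinate axis or on a root line `ℂ (e_i - ζ⁻¹ e_j)`. -/
def lineVectors {n : ℕ} (r : ℕ) (Λ : Submodule ℤ (Cn n)) : Set (Cn n) :=
  {b | b ∈ Λ ∧ ((∃ (i : Fin n) (c : ℂ), b = EuclideanSpace.single i c) ∨
    ∃ (i j : Fin n) (ζ c : ℂ), i ≠ j ∧ ζ ^ r = 1 ∧
      b = EuclideanSpace.single i c - EuclideanSpace.single j (ζ⁻¹ * c))}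

theorem isInvariant_span {n r p : ℕ} {S : Set (Cn n)}
    (hS : ∀ A ∈ G r p n, ∀ v ∈ S, A v ∈ S) : IsInvariant (G r p n) (Submodule.span ℤ S) := by
  intro A hA v hv
  induction hv using Submodule.span_induction with
  | mem x hx => exact Submodule.subset_span (hS A hA x hx)
  | zero => simp
  | add x y _ _ hx hy =>
    rw [map_add]
    exact Submodule.add_mem _ hx hy
  | smul a x _ hx =>
    rw [map_zsmul]
    exact Submodule.smul_mem _ a hx

theorem lineVectors_invariant {n r p : ℕ} {Λ : Submodule ℤ (Cn n)} (hr : r ≠ 0)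
    (hΛ : IsInvariant (G r p n) Λ) :
    ∀ A ∈ G r p n, ∀ v ∈ lineVectors r Λ, A v ∈ lineVectors r Λ := by
  rintro A hA v ⟨hvΛ, hv⟩
  refine ⟨hΛ A hA v hvΛ, ?_⟩
  obtain ⟨σ, d, h1, h2, h⟩ := hA
  rcases hv with ⟨i, c, rfl⟩ | ⟨i, j, ζ, c, hij, hζ, rfl⟩
  · refine Or.inl ⟨σ.symm i, d (σ.symm i) * c, ?_⟩
    ext k
    rw [h]
    rcases eq_or_ne k (σ.symm i) with rfl | hk
    · simp
    · have : σ k ≠ i := fun h => hk (by rw [← h, Equiv.symm_apply_apply])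
      simp [hk, this]
  · have hd : ∀ i, d i ≠ 0 := fun i => ne_zero_of_pow hr (h1 i)
    have hζ0 := ne_zero_of_pow hr hζ
    refine Or.inr ⟨σ.symm i, σ.symm j, ζ * d (σ.symm i) * (d (σ.symm j))⁻¹, d (σ.symm i) * c,
      fun h => hij (σ.symm.injective h), by simp [mul_pow, hζ, h1], ?_⟩
    ext k
    rw [h]
    rcases eq_or_ne k (σ.symm i) with rfl | hk
    · have : σ.symm i ≠ σ.symm j := fun h => hij (σ.symm.injective h)
      simp [this, hij]
    · have hki : σ k ≠ i := fun h => hk (by rw [← h, Equiv.symm_apply_apply])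
      rcases eq_or_ne k (σ.symm j) with rfl | hk'
      · have : σ.symm j ≠ σ.symm i := fun h => hij (σ.symm.injective h).symm
        have h0 := hd (σ.symm i)
        have h0' := hd (σ.symm j)
        simp [this, hij.symm]
        field_simp
      · have hkj : σ k ≠ j := fun h => hk' (by rw [← h, Equiv.symm_apply_apply])
        simp [hk, hk', hki, hkj]

/-- If `G(r,p,n) ⋉ Λ` is generated by reflections, then `Λ` is generated by its intersections with
the coordinate axes and the root lines: the reflections already lie in the subgroup `G(r,p,n) ⋉ Λ₀`,
where `Λ₀` is generated by these intersections. -/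
theorem le_span_lineVectors {n r p : ℕ} {Λ : Submodule ℤ (Cn n)} (hr : r ≠ 0)
    (hΛ : IsInvariant (G r p n) Λ)
    (hrefl : IsGeneratedByReflections (semidirect (G r p n) Λ)) :
    Λ ≤ Submodule.span ℤ (lineVectors r Λ) := by
  have hinv := isInvariant_span (lineVectors_invariant hr hΛ)
  have hle : semidirect (G r p n) Λ ≤
      semidirect (G r p n) (Submodule.span ℤ (lineVectors r Λ)) := by
    rw [← hrefl, Subgroup.closure_le]
    rintro g ⟨hgW, H, hg⟩
    obtain ⟨σ, d, b, h1, h2, hbΛ, h⟩ := (mem_semidirect_G_iff hΛ g).1 hgW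
    refine (mem_semidirect_G_iff hinv g).2 ⟨σ, d, b, h1, h2, Submodule.subset_span ⟨hbΛ, ?_⟩, h⟩
    obtain ⟨v, hv⟩ := hg.2.2.1.1
    rcases reflection_translation hg h1 h2 h with ⟨i, η, -, -, hb⟩ | ⟨i, j, ζ, hij, hζ, hb⟩
    · exact Or.inl ⟨i, _, hb v hv⟩
    · exact Or.inr ⟨i, j, ζ, _, hij, hζ, hb v hv⟩
  intro b hb
  obtain ⟨A, -, c, hc, h⟩ := (mem_semidirect_iff hinv _).1
    (hle ((mem_semidirect_iff hΛ (AffineEquiv.constVAdd ℂ (Cn n) b)).2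
      ⟨1, Subgroup.one_mem _, b, hb, fun v => by simp [add_comm]⟩))
  have := h 0
  simp at this
  rw [this]
  exact hc

/-! ### Equivalence of affine groups -/

theorem Equivalent.refl {n : ℕ} (W : Subgroup (Aff n)) : Equivalent W W := by
  refine ⟨1, ?_⟩
  ext g
  simp

theorem Equivalent.symm {n : ℕ} {W W' : Subgroup (Aff n)} (h : Equivalent W W') :
    Equivalent W' W := by
  obtain ⟨a, rfl⟩ := h
  refine ⟨a⁻¹, ?_⟩
  ext g
  simp only [Subgroup.mem_map, MulEquiv.coe_toMonoidHom, MulAut.conj_apply]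
  constructor
  · rintro ⟨_, ⟨x, hx, rfl⟩, rfl⟩
    simpa [mul_assoc] using hx
  · intro hg
    exact ⟨_, ⟨g, hg, rfl⟩, by simp [mul_assoc]⟩

theorem Equivalent.trans {n : ℕ} {W W' W'' : Subgroup (Aff n)} (h : Equivalent W W')
    (h' : Equivalent W' W'') : Equivalent W W'' := by
  obtain ⟨a, rfl⟩ := h
  obtain ⟨b, rfl⟩ := h'
  refine ⟨b * a, ?_⟩
  rw [Subgroup.map_map]
  congr 1

theorem map_conj_semidirect_le {n : ℕ} {K K' : Subgroup (Lin n)} {Λ Λ' : Submodule ℤ (Cn n)}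
    (a : Lin n) (hK : ∀ A ∈ K, a * A * a⁻¹ ∈ K') (hΛ : ∀ v ∈ Λ, a v ∈ Λ') :
    (semidirect K Λ).map (MulAut.conj a.toAffineEquiv).toMonoidHom ≤ semidirect K' Λ' := by
  rw [Subgroup.map_le_iff_le_comap, semidirect, Subgroup.closure_le]
  have ha : ∀ w, a (a⁻¹ w) = w := fun w => by
    rw [← LinearEquiv.mul_apply, mul_inv_cancel]; rfl
  rintro g (⟨A, hA, h⟩ | ⟨b, hb, h⟩)
  · refine Subgroup.subset_closure (Or.inl ⟨_, hK A hA, fun v => ?_⟩)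
    change a (g (a⁻¹ v)) = _
    rw [h]
    rfl
  · refine Subgroup.subset_closure (Or.inr ⟨a b, hΛ b hb, fun v => ?_⟩)
    change a (g (a⁻¹ v)) = _
    rw [h, map_add, ha]

theorem equivalent_of_linear {n : ℕ} {K K' : Subgroup (Lin n)} {Λ Λ' : Submodule ℤ (Cn n)}
    (a : Lin n) (hK : ∀ A ∈ K, a * A * a⁻¹ ∈ K') (hK' : ∀ A ∈ K', a⁻¹ * A * a ∈ K)
    (hΛ : ∀ v, v ∈ Λ ↔ a v ∈ Λ') : Equivalent (semidirect K Λ) (semidirect K' Λ') := by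
  refine ⟨a.toAffineEquiv, le_antisymm (map_conj_semidirect_le a hK fun v => (hΛ v).1) ?_⟩
  intro g hg
  have ha : ∀ w, a (a⁻¹ w) = w := fun w => by
    rw [← LinearEquiv.mul_apply, mul_inv_cancel]; rfl
  have := map_conj_semidirect_le (Λ := Λ') (Λ' := Λ) a⁻¹ (by simpa using hK')
    (fun v hv => (hΛ _).2 (by rwa [ha])) (Subgroup.mem_map_of_mem _ hg)
  refine ⟨_, this, ?_⟩
  ext1 v
  change a (a.symm (g (a (a.symm v)))) = g v
  simp

/-- Homothetic lattices give equivalent groups. -/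
theorem equivalent_of_smul {n : ℕ} (K : Subgroup (Lin n)) {Λ Λ' : Submodule ℤ (Cn n)} {c : ℂ}
    (hc : c ≠ 0) (h : ∀ v, v ∈ Λ ↔ c • v ∈ Λ') :
    Equivalent (semidirect K Λ) (semidirect K Λ') := by
  have hcomm : ∀ A : Lin n, LinearEquiv.smulOfNeZero ℂ (Cn n) c hc * A =
      A * LinearEquiv.smulOfNeZero ℂ (Cn n) c hc := by
    intro A
    ext1 v
    simp [LinearEquiv.mul_apply]
  refine equivalent_of_linear (LinearEquiv.smulOfNeZero ℂ (Cn n) c hc) (fun A hA => ?_)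
    (fun A hA => ?_) h
  · rw [hcomm, mul_inv_cancel_right]
    exact hA
  · rw [mul_assoc, ← hcomm, inv_mul_cancel_left]
    exact hA

theorem diag_mul_mem_G {n r p : ℕ} {k : Fin n → ℂ} (hk0 : ∀ i, k i ≠ 0) (hk : ∀ i, k i ^ r = 1)
    {A B : Lin n} (hA : A ∈ G r p n)
    (hB : ∀ v i, B (WithLp.toLp 2 fun i => k i * v i) i = k i * A v i) : B ∈ G r p n := by
  obtain ⟨σ, d, h1, h2, h⟩ := hA
  refine ⟨σ, fun i => k i * d i * (k (σ i))⁻¹, fun i => by simp [mul_pow, hk, h1], ?_, ?_⟩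
  · rw [Finset.prod_mul_distrib, Finset.prod_mul_distrib, Equiv.prod_comp σ (fun i => (k i)⁻¹),
      Finset.prod_inv_distrib, mul_right_comm, mul_inv_cancel₀, one_mul, h2]
    exact Finset.prod_ne_zero_iff.2 fun i _ => hk0 i
  · intro v i
    have : v = WithLp.toLp 2 fun i => k i * (WithLp.toLp 2 fun i => (k i)⁻¹ * v i : Cn n) i := by
      ext i
      simp [hk0]
    rw [this, hB, h]
    have := hk0 (σ i)
    simp
    field_simp

/-- Diagonal matrices of `r`-th roots of unity normalize `G(r,p,n)`, so lattices that differ by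
such a matrix give equivalent groups. -/
theorem equivalent_of_diag {n r p : ℕ} (hr : r ≠ 0) {Λ Λ' : Submodule ℤ (Cn n)} (k : Fin n → ℂ)
    (hk : ∀ i, k i ^ r = 1)
    (h : ∀ v : Cn n, v ∈ Λ ↔ (WithLp.toLp 2 fun i => k i * v i : Cn n) ∈ Λ') :
    Equivalent (semidirect (G r p n) Λ) (semidirect (G r p n) Λ') := by
  have hk0 : ∀ i, k i ≠ 0 := fun i => ne_zero_of_pow hr (hk i)
  have hinv : ∀ w, (monomial 1 k hk0)⁻¹ (monomial 1 k hk0 w) = w := fun w => by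
    rw [← LinearEquiv.mul_apply, inv_mul_cancel]; rfl
  have hinv' : ∀ w, monomial 1 k hk0 ((monomial 1 k hk0)⁻¹ w) = w := fun w => by
    rw [← LinearEquiv.mul_apply, mul_inv_cancel]; rfl
  have hval : ∀ (w : Cn n) (i : Fin n), (monomial 1 k hk0)⁻¹ w i = (k i)⁻¹ * w i := fun w i => by
    have h1 : (monomial 1 k hk0 ((monomial 1 k hk0)⁻¹ w)) i = w i := by rw [hinv']
    rw [← h1, monomial_apply, inv_mul_cancel_left₀ (hk0 i)]
    rfl
  refine equivalent_of_linear (monomial 1 k hk0) (fun A hA => ?_) (fun A hA => ?_) h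
  · refine diag_mul_mem_G hk0 hk hA fun v i => ?_
    change monomial 1 k hk0 (A ((monomial 1 k hk0)⁻¹ (monomial 1 k hk0 v))) i = _
    rw [hinv]
    rfl
  · refine diag_mul_mem_G (k := fun i => (k i)⁻¹) (fun i => inv_ne_zero (hk0 i))
      (fun i => by rw [inv_pow, hk, inv_one]) hA fun v i => ?_
    have : (WithLp.toLp 2 fun i => (k i)⁻¹ * v i : Cn n) = (monomial 1 k hk0)⁻¹ v := by
      ext i
      rw [hval]
    rw [this]
    change (monomial 1 k hk0)⁻¹ (A (monomial 1 k hk0 ((monomial 1 k hk0)⁻¹ v))) i = _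
    rw [hinv', hval]

/-! ### The Steinberg property is invariant under equivalence -/

theorem steinbergProperty_iff_forall {n : ℕ} (W : Subgroup (Aff n)) :
    SteinbergProperty W ↔
      ∀ v, ¬ IsRegularPoint W v ↔ ∃ H ∈ reflectingHyperplanes W, v ∈ H := by
  simp [SteinbergProperty, Set.ext_iff]

theorem Equivalent.exists_mirror {n : ℕ} {W : Subgroup (Aff n)} (a : Aff n)
    (hW' : IsIsometric (W.map (MulAut.conj a).toMonoidHom)) {v : Cn n}
    (h : ∃ H ∈ reflectingHyperplanes W, v ∈ H) :
    ∃ H ∈ reflectingHyperplanes (W.map (MulAut.conj a).toMonoidHom), a v ∈ H := by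
  obtain ⟨H, ⟨g, hg, hne, -, ⟨hnon, hdim⟩, hfix⟩, hv⟩ := h
  have hmem : a * g * a⁻¹ ∈ W.map (MulAut.conj a).toMonoidHom :=
    Subgroup.mem_map_of_mem (MulAut.conj a).toMonoidHom hg
  refine ⟨H.map a.toAffineMap, ⟨a * g * a⁻¹, hmem, ?_, hW' _ hmem, ⟨?_, ?_⟩, ?_⟩,
    AffineSubspace.mem_map_of_mem _ hv⟩
  · simpa using hne
  · rw [AffineSubspace.coe_map]
    exact hnon.image _
  · rw [AffineSubspace.map_direction]
    exact (congrArg (· + 1) (LinearEquiv.finrank_map_eq a.linear H.direction)).trans hdim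
  · rintro _ ⟨w, hw, rfl⟩
    change a (g (a.symm (a w))) = a w
    rw [AffineEquiv.symm_apply_apply, hfix w hw]

/-- Conjugation by an affine map need not preserve isometries, but in a group of isometries a
nontrivial element is a reflection as soon as it fixes a hyperplane pointwise. -/
theorem Equivalent.steinberg {n : ℕ} {W W' : Subgroup (Aff n)} (h : Equivalent W W')
    (hW : IsIsometric W) (hW' : IsIsometric W') (hS : SteinbergProperty W) :
    SteinbergProperty W' := by
  obtain ⟨b, hb⟩ := h.symm
  obtain ⟨a, rfl⟩ : ∃ a : Aff n, b = a⁻¹ := ⟨b⁻¹, (inv_inv b).symm⟩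
  have ha : W.map (MulAut.conj a).toMonoidHom = W' := by
    rw [← hb, Subgroup.map_map]
    convert Subgroup.map_id W'
    ext1 g
    simp [mul_assoc]
  rw [steinbergProperty_iff_forall] at hS ⊢
  intro v
  have key : IsRegularPoint W' v ↔ IsRegularPoint W (a⁻¹ v) := by
    rw [← ha]
    constructor
    · intro hreg g hg hgv
      have hv' : (a * g * a⁻¹) v = v := by
        change a (g (a⁻¹ v)) = v
        rw [hgv]
        exact a.apply_symm_apply v
      have := hreg (a * g * a⁻¹) (Subgroup.mem_map_of_mem (MulAut.conj a).toMonoidHom hg) hv'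
      simpa using this
    · rintro hreg _ ⟨g, hg, rfl⟩ hgv
      have : g = 1 := by
        refine hreg g hg (a.injective ?_)
        change a (g (a⁻¹ v)) = v at hgv
        rw [hgv]
        exact (a.apply_symm_apply v).symm
      simp [this]
  rw [key, hS]
  constructor
  · intro h
    have := Equivalent.exists_mirror a (ha ▸ hW') h
    rw [ha] at this
    have hv : a (a⁻¹ v) = v := a.apply_symm_apply v
    rwa [hv] at this
  · intro h
    have := Equivalent.exists_mirror a⁻¹ (hb ▸ hW) h
    rwa [hb] at this

/-! ### Eisenstein and Gaussian integers -/

theorem xi_isPrimitiveRoot {r : ℕ} (hr : r ≠ 0) : IsPrimitiveRoot (ξ r) r :=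
  Complex.isPrimitiveRoot_exp r hr

theorem xi_pow {r : ℕ} (hr : r ≠ 0) : ξ r ^ r = 1 := (xi_isPrimitiveRoot hr).pow_eq_one

theorem xi_four : ξ 4 = Complex.I := by
  rw [ξ, show (2 * Real.pi * Complex.I / (4 : ℕ) : ℂ) = Real.pi / 2 * Complex.I by push_cast; ring,
    Complex.exp_pi_div_two_mul_I]

theorem xi_three_sq : ξ 3 ^ 2 = -1 - ξ 3 := by
  have h := xi_pow (r := 3) (by norm_num)
  have h1 : ξ 3 ≠ 1 := (xi_isPrimitiveRoot (r := 3) (by norm_num)).ne_one (by norm_num)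
  have : (ξ 3 - 1) * (ξ 3 ^ 2 + ξ 3 + 1) = 0 := by linear_combination h
  rcases mul_eq_zero.1 this with h2 | h2
  · exact absurd (sub_eq_zero.1 h2) h1
  · linear_combination h2

theorem xi_six_eq : ξ 6 = 1 + ξ 3 := by
  have h : ξ 6 ^ 2 = ξ 3 := by
    rw [ξ, ξ, ← Complex.exp_nat_mul]
    congr 1
    push_cast
    ring
  have h3 : ξ 6 ^ 3 = -1 := by
    have h6 := xi_pow (r := 6) (by norm_num)
    have hne : ξ 6 ^ 3 ≠ 1 :=
      (xi_isPrimitiveRoot (r := 6) (by norm_num)).pow_ne_one_of_pos_of_lt (by norm_num) (by norm_num)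
    have : (ξ 6 ^ 3 - 1) * (ξ 6 ^ 3 + 1) = 0 := by linear_combination h6
    rcases mul_eq_zero.1 this with h2 | h2
    · exact absurd (sub_eq_zero.1 h2) hne
    · linear_combination h2
  have h4 : ξ 3 * (1 + ξ 3 - ξ 6) = 0 := by
    have : ξ 3 * ξ 6 = -1 := by rw [← h, ← h3]; ring
    linear_combination xi_three_sq - this
  rcases mul_eq_zero.1 h4 with h5 | h5
  · rw [ξ] at h5
    exact absurd h5 (Complex.exp_ne_zero _)
  · linear_combination -h5

theorem xi_mem (r : ℕ) : ξ r ∈ adjoinZ (ξ r) := Algebra.subset_adjoin rfl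

theorem int_mem (x : ℂ) (a : ℤ) : (a : ℂ) ∈ adjoinZ x := by
  simp

theorem mem_adjoinZ_iff {x : ℂ} {s t : ℤ} (hx : x ^ 2 = s * x + t) {z : ℂ} :
    z ∈ adjoinZ x ↔ ∃ a b : ℤ, z = a + b * x := by
  constructor
  · intro hz
    induction hz using Algebra.adjoin_induction with
    | mem y hy =>
      obtain rfl : y = x := hy
      exact ⟨0, 1, by simp⟩
    | algebraMap a => exact ⟨a, 0, by simp⟩
    | add y z _ _ hy hz =>
      obtain ⟨a, b, rfl⟩ := hy
      obtain ⟨a', b', rfl⟩ := hz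
      exact ⟨a + a', b + b', by push_cast; ring⟩
    | mul y z _ _ hy hz =>
      obtain ⟨a, b, rfl⟩ := hy
      obtain ⟨a', b', rfl⟩ := hz
      exact ⟨a * a' + b * b' * t, a * b' + a' * b + b * b' * s, by
        push_cast
        linear_combination (b * b' : ℂ) * hx⟩
  · rintro ⟨a, b, rfl⟩
    exact add_mem (int_mem x a) (mul_mem (int_mem x b) (Algebra.subset_adjoin rfl))

theorem mem_eis_iff {z : ℂ} : z ∈ adjoinZ (ξ 3) ↔ ∃ a b : ℤ, z = a + b * ξ 3 :=
  mem_adjoinZ_iff (s := -1) (t := -1) (by rw [xi_three_sq]; push_cast; ring)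

theorem mem_gauss_iff {z : ℂ} : z ∈ adjoinZ (ξ 4) ↔ ∃ a b : ℤ, z = a + b * Complex.I := by
  rw [xi_four]
  exact mem_adjoinZ_iff (s := 0) (t := -1) (by rw [Complex.I_sq]; push_cast; ring)

theorem adjoinZ_six : adjoinZ (ξ 6) = adjoinZ (ξ 3) := by
  ext z
  rw [mem_eis_iff, mem_adjoinZ_iff (s := 1) (t := -1)
    (by rw [xi_six_eq]; push_cast; linear_combination xi_three_sq)]
  constructor
  · rintro ⟨a, b, rfl⟩
    exact ⟨a + b, b, by rw [xi_six_eq]; push_cast; ring⟩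
  · rintro ⟨a, b, rfl⟩
    exact ⟨a - b, b, by rw [xi_six_eq]; push_cast; ring⟩

theorem root_mem {r : ℕ} (hr : r ≠ 0) {z : ℂ} (h : z ^ r = 1) : z ∈ adjoinZ (ξ r) := by
  have : NeZero r := ⟨hr⟩
  obtain ⟨k, -, rfl⟩ := (xi_isPrimitiveRoot hr).eq_pow_of_pow_eq_one h
  exact pow_mem (xi_mem r) k

theorem pow_four_cases {z : ℂ} (h : z ^ 4 = 1) :
    z = 1 ∨ z = -1 ∨ z = Complex.I ∨ z = -Complex.I := by
  have : (z - 1) * ((z + 1) * ((z - Complex.I) * (z + Complex.I))) = 0 := by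
    linear_combination h + (1 - z ^ 2) * Complex.I_sq
  rcases mul_eq_zero.1 this with h | h
  · exact Or.inl (sub_eq_zero.1 h)
  rcases mul_eq_zero.1 h with h | h
  · exact Or.inr (Or.inl (eq_neg_of_add_eq_zero_left h))
  rcases mul_eq_zero.1 h with h | h
  · exact Or.inr (Or.inr (Or.inl (sub_eq_zero.1 h)))
  · exact Or.inr (Or.inr (Or.inr (eq_neg_of_add_eq_zero_left h)))

theorem pow_three_cases {z : ℂ} (h : z ^ 3 = 1) :
    z = 1 ∨ z = ξ 3 ∨ z = ξ 3 ^ 2 := by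
  have h3 := xi_three_sq
  have : (z - 1) * ((z - ξ 3) * (z - ξ 3 ^ 2)) = 0 := by
    rw [h3]
    linear_combination h + (1 - z) * h3
  rcases mul_eq_zero.1 this with h | h
  · exact Or.inl (sub_eq_zero.1 h)
  rcases mul_eq_zero.1 h with h | h
  · exact Or.inr (Or.inl (sub_eq_zero.1 h))
  · exact Or.inr (Or.inr (sub_eq_zero.1 h))

theorem pow_six_cases {z : ℂ} (h : z ^ 6 = 1) :
    z ^ 3 = 1 ∨ (-z) ^ 3 = 1 := by
  have : (z ^ 3 - 1) * ((-z) ^ 3 - 1) = 0 := by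
    linear_combination -h
  rcases mul_eq_zero.1 this with h | h
  · exact Or.inl (sub_eq_zero.1 h)
  · exact Or.inr (sub_eq_zero.1 h)

theorem conj_xi_three : (starRingEnd ℂ) (ξ 3) = -1 - ξ 3 := by
  have h3 : ξ 3 ^ 3 = 1 := xi_pow (by norm_num)
  have hn : ‖ξ 3‖ = 1 := norm_of_pow (r := 3) (by norm_num) h3
  rw [← Complex.inv_eq_conj hn, inv_eq_of_mul_eq_one_right (a := ξ 3) (b := -1 - ξ 3)]
  linear_combination -xi_three_sq

theorem conj_mem_eis {z : ℂ} (h : z ∈ adjoinZ (ξ 3)) : (starRingEnd ℂ) z ∈ adjoinZ (ξ 3) := by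
  rw [mem_eis_iff] at *
  obtain ⟨a, b, rfl⟩ := h
  exact ⟨a - b, -b, by simp [conj_xi_three]; ring⟩

/-- The norm of an Eisenstein or Gaussian integer is an integer. -/
theorem exists_normSq_eq {r : ℕ} (hr : r = 3 ∨ r = 4 ∨ r = 6) {z : ℂ} (hz : z ∈ adjoinZ (ξ r)) :
    ∃ m : ℤ, Complex.normSq z = m := by
  have h3 : ∀ z ∈ adjoinZ (ξ 3), ∃ m : ℤ, Complex.normSq z = m := by
    intro z hz
    obtain ⟨a, b, rfl⟩ := mem_eis_iff.1 hz
    refine ⟨a ^ 2 - a * b + b ^ 2, ?_⟩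
    apply Complex.ofReal_injective
    rw [← Complex.mul_conj]
    simp [conj_xi_three]
    linear_combination (-b ^ 2 : ℂ) * xi_three_sq
  rcases hr with rfl | rfl | rfl
  · exact h3 z hz
  · obtain ⟨a, b, rfl⟩ := mem_gauss_iff.1 hz
    exact ⟨a ^ 2 + b ^ 2, by simp [Complex.normSq_apply]; ring⟩
  · exact h3 z (adjoinZ_six ▸ hz)

/-- A nonzero element of `ℤ[ξ]` has absolute value at least `1`. -/
theorem not_mem_of_norm_lt {r : ℕ} (hr : r = 3 ∨ r = 4 ∨ r = 6) {z : ℂ} (hz : z ≠ 0)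
    (h1 : ‖z‖ < 1) : z ∉ adjoinZ (ξ r) := by
  intro h
  obtain ⟨m, hm⟩ := exists_normSq_eq hr h
  have hpos : (0 : ℝ) < m := hm ▸ Complex.normSq_pos.2 hz
  have hlt : (m : ℝ) < 1 := by
    rw [← hm, Complex.normSq_eq_norm_sq]
    have := norm_nonneg z
    nlinarith
  have h1 : 0 < m := by exact_mod_cast hpos
  have h2 : m < 1 := by exact_mod_cast hlt
  omega

theorem one_sub_xi_three_sq : (1 - ξ 3) ^ 2 = -3 * ξ 3 := by
  linear_combination xi_three_sq

theorem one_sub_xi_three_mul : (1 - ξ 3) * (2 + ξ 3) = 3 := by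
  linear_combination -xi_three_sq

theorem one_sub_xi_three_ne : 1 - ξ 3 ≠ 0 := fun h => by
  have := one_sub_xi_three_mul
  rw [h] at this
  norm_num at this

theorem one_sub_I_ne : 1 - Complex.I ≠ 0 := fun h => by
  have : (1 - Complex.I) * (1 + Complex.I) = 2 := by linear_combination -Complex.I_sq
  rw [h] at this
  norm_num at this

/-! ### Residues modulo `1 - ω`, `2`, `3` in `ℤ[ω]` and modulo `1 - i`, `2` in `ℤ[i]`

A residue class that is not represented by a root of unity is divisible by the prime that divides
the modulus. -/

theorem eis_mod_theta {z : ℂ} (hz : z ∈ adjoinZ (ξ 3)) :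
    (∃ w ∈ adjoinZ (ξ 3), z = (1 - ξ 3) * w) ∨
      ∃ ζ : ℂ, ζ ^ 2 = 1 ∧ ∃ w ∈ adjoinZ (ξ 3), z = ζ + (1 - ξ 3) * w := by
  obtain ⟨a, b, rfl⟩ := mem_eis_iff.1 hz
  obtain ⟨k, hk⟩ : ∃ k : ℤ, a + b = 3 * k ∨ a + b = 3 * k + 1 ∨ a + b = 3 * k - 1 :=
    ⟨(a + b + 1) / 3, by omega⟩
  have hw : (k * (2 + ξ 3) - b : ℂ) ∈ adjoinZ (ξ 3) :=
    mem_eis_iff.2 ⟨2 * k - b, k, by push_cast; ring⟩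
  have hm := one_sub_xi_three_mul
  rcases hk with h | h | h
  · left
    have h' : (a + b : ℂ) = 3 * k := by exact_mod_cast h
    exact ⟨_, hw, by linear_combination h' - (k : ℂ) * hm⟩
  · right
    have h' : (a + b : ℂ) = 3 * k + 1 := by exact_mod_cast h
    exact ⟨1, by norm_num, _, hw, by linear_combination h' - (k : ℂ) * hm⟩
  · right
    have h' : (a + b : ℂ) = 3 * k - 1 := by exact_mod_cast h
    exact ⟨-1, by norm_num, _, hw, by linear_combination h' - (k : ℂ) * hm⟩

theorem eis_mod_two {z : ℂ} (hz : z ∈ adjoinZ (ξ 3)) :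
    (∃ w ∈ adjoinZ (ξ 3), z = 2 * w) ∨
      ∃ ζ : ℂ, ζ ^ 3 = 1 ∧ ∃ w ∈ adjoinZ (ξ 3), z = ζ + 2 * w := by
  obtain ⟨a, b, rfl⟩ := mem_eis_iff.1 hz
  have h3 : ξ 3 ^ 3 = 1 := xi_pow (by norm_num)
  have h2 := xi_three_sq
  rcases Int.even_or_odd' a with ⟨k, hk | hk⟩ <;> rcases Int.even_or_odd' b with ⟨l, hl | hl⟩ <;>
    subst hk hl
  · exact Or.inl ⟨k + l * ξ 3, mem_eis_iff.2 ⟨k, l, rfl⟩, by push_cast; ring⟩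
  · exact Or.inr ⟨ξ 3, h3, k + l * ξ 3, mem_eis_iff.2 ⟨k, l, rfl⟩, by push_cast; ring⟩
  · exact Or.inr ⟨1, by norm_num, k + l * ξ 3, mem_eis_iff.2 ⟨k, l, rfl⟩, by push_cast; ring⟩
  · exact Or.inr ⟨ξ 3 ^ 2, by rw [← pow_mul, mul_comm, pow_mul, h3, one_pow],
      (k + 1 : ℤ) + (l + 1 : ℤ) * ξ 3, mem_eis_iff.2 ⟨k + 1, l + 1, rfl⟩, by
        push_cast; linear_combination -h2⟩

theorem eis_mod_three {z : ℂ} (hz : z ∈ adjoinZ (ξ 3)) :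
    (∃ w ∈ adjoinZ (ξ 3), z = (1 - ξ 3) * w) ∨
      ∃ ζ : ℂ, ζ ^ 6 = 1 ∧ ∃ w ∈ adjoinZ (ξ 3), z = ζ + 3 * w := by
  have hω := xi_three_sq
  have hω3 : ξ 3 ^ 3 = 1 := xi_pow (by norm_num)
  have hm : (1 - ξ 3) ^ 2 = -3 * ξ 3 := one_sub_xi_three_sq
  rcases eis_mod_theta hz with h | ⟨ζ, hζ, w, hw, rfl⟩
  · exact Or.inl h
  right
  have hζ6 : ζ ^ 6 = 1 := by rw [show ζ ^ 6 = (ζ ^ 2) ^ 3 by ring, hζ, one_pow]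
  -- `ζ + θ w` with `w ≡ 0, ± 1` modulo `θ`, and `1 + θ ≡ ω²`, `1 - θ = ω` modulo `3`
  rcases eis_mod_theta hw with ⟨u, hu, rfl⟩ | ⟨ε, hε, u, hu, rfl⟩
  · exact ⟨ζ, hζ6, -ξ 3 * u, mul_mem (neg_mem (xi_mem 3)) hu, by linear_combination u * hm⟩
  have hζε : (ζ - ε) * (ζ + ε) = 0 := by linear_combination hζ - hε
  rcases mul_eq_zero.1 hζε with h | h
  · refine ⟨ζ * ξ 3 ^ 2, by rw [mul_pow, hζ6, show (ξ 3 ^ 2) ^ 6 = (ξ 3 ^ 3) ^ 4 by ring, hω3]; simp,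
      ζ - ξ 3 * u, sub_mem (root_mem (r := 6) (by norm_num) hζ6 |> fun h => adjoinZ_six ▸ h)
        (mul_mem (xi_mem 3) hu), ?_⟩
    linear_combination u * hm - ζ * hω - (1 - ξ 3) * h
  · refine ⟨ζ * ξ 3, by rw [mul_pow, hζ6, show ξ 3 ^ 6 = (ξ 3 ^ 3) ^ 2 by ring, hω3]; simp,
      - ξ 3 * u, mul_mem (neg_mem (xi_mem 3)) hu, ?_⟩
    linear_combination u * hm + (1 - ξ 3) * h

theorem gauss_mod_two {z : ℂ} (hz : z ∈ adjoinZ (ξ 4)) :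
    (∃ w ∈ adjoinZ (ξ 4), z = (1 - Complex.I) * w) ∨
      ∃ ζ : ℂ, (ζ = 1 ∨ ζ = Complex.I) ∧ ∃ w ∈ adjoinZ (ξ 4), z = ζ + 2 * w := by
  obtain ⟨a, b, rfl⟩ := mem_gauss_iff.1 hz
  have h2 := Complex.I_sq
  rcases Int.even_or_odd' a with ⟨k, hk | hk⟩ <;> rcases Int.even_or_odd' b with ⟨l, hl | hl⟩ <;>
    subst hk hl
  · exact Or.inl ⟨(k - l : ℤ) + (k + l : ℤ) * Complex.I, mem_gauss_iff.2 ⟨_, _, rfl⟩, by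
      push_cast; linear_combination (k + l) * h2⟩
  · exact Or.inr ⟨Complex.I, Or.inr rfl, k + l * Complex.I, mem_gauss_iff.2 ⟨k, l, rfl⟩, by
      push_cast; ring⟩
  · exact Or.inr ⟨1, Or.inl rfl, k + l * Complex.I, mem_gauss_iff.2 ⟨k, l, rfl⟩, by
      push_cast; ring⟩
  · exact Or.inl ⟨(k - l : ℤ) + (k + l + 1 : ℤ) * Complex.I, mem_gauss_iff.2 ⟨_, _, rfl⟩, by
      push_cast; linear_combination (k + l + 1) * h2⟩

theorem gauss_mod_pi {z : ℂ} (hz : z ∈ adjoinZ (ξ 4)) :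
    (∃ w ∈ adjoinZ (ξ 4), z = (1 - Complex.I) * w) ∨
      ∃ w ∈ adjoinZ (ξ 4), z = 1 + (1 - Complex.I) * w := by
  have hI : Complex.I ∈ adjoinZ (ξ 4) := xi_four ▸ xi_mem 4
  rcases gauss_mod_two hz with h | ⟨ζ, rfl | rfl, w, hw, rfl⟩
  · exact Or.inl h
  · exact Or.inr ⟨(1 + Complex.I) * w, mul_mem (add_mem (one_mem _) hI) hw, by
      linear_combination w * Complex.I_sq⟩
  · exact Or.inr ⟨-1 + (1 + Complex.I) * w, add_mem (neg_mem (one_mem _))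
      (mul_mem (add_mem (one_mem _) hI) hw), by linear_combination w * Complex.I_sq⟩

/-- If `m x` and `m y` are congruent to roots of unity modulo `m`, some `x - ζ y` is integral. -/
theorem sub_mem_of_unit_residues {R : Subalgebra ℤ ℂ} {m x y ζ₁ ζ₂ w₁ w₂ : ℂ} (hm : m ≠ 0)
    (h₁ : ζ₁ * ζ₂⁻¹ ∈ R) (h₂ : ζ₂ ≠ 0) (hw₁ : w₁ ∈ R) (hw₂ : w₂ ∈ R) (hx : m * x = ζ₁ + m * w₁)
    (hy : m * y = ζ₂ + m * w₂) : x - ζ₁ * ζ₂⁻¹ * y ∈ R := by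
  have : x - ζ₁ * ζ₂⁻¹ * y = w₁ - ζ₁ * ζ₂⁻¹ * w₂ := by
    apply mul_left_cancel₀ hm
    have := mul_inv_cancel₀ h₂
    linear_combination hx - ζ₁ * ζ₂⁻¹ * hy - ζ₁ * this
  rw [this]
  exact sub_mem hw₁ (mul_mem h₁ hw₂)

/-- Two numbers in `(1 - ω)⁻¹ ℤ[ω]`, none of them integral, differ by a sign up to an integral
number. -/
theorem eis_pair_theta {x y : ℂ} (hx : (1 - ξ 3) * x ∈ adjoinZ (ξ 3))
    (hy : (1 - ξ 3) * y ∈ adjoinZ (ξ 3)) :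
    x ∈ adjoinZ (ξ 3) ∨ y ∈ adjoinZ (ξ 3) ∨ ∃ ζ : ℂ, ζ ^ 2 = 1 ∧ x - ζ * y ∈ adjoinZ (ξ 3) := by
  rcases eis_mod_theta hx with ⟨w, hw, h⟩ | ⟨ζ₁, hζ₁, w₁, hw₁, h₁⟩
  · exact Or.inl (mul_left_cancel₀ one_sub_xi_three_ne h ▸ hw)
  rcases eis_mod_theta hy with ⟨w, hw, h⟩ | ⟨ζ₂, hζ₂, w₂, hw₂, h₂⟩
  · exact Or.inr (Or.inl (mul_left_cancel₀ one_sub_xi_three_ne h ▸ hw))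
  have hζ : (ζ₁ * ζ₂⁻¹) ^ 2 = 1 := by rw [mul_pow, inv_pow, hζ₁, hζ₂]; norm_num
  refine Or.inr (Or.inr ⟨_, hζ, sub_mem_of_unit_residues one_sub_xi_three_ne ?_
    (ne_zero_of_pow (by norm_num) hζ₂) hw₁ hw₂ h₁ h₂⟩)
  have : (ζ₁ * ζ₂⁻¹) ^ 6 = 1 := by
    rw [show (ζ₁ * ζ₂⁻¹) ^ 6 = ((ζ₁ * ζ₂⁻¹) ^ 2) ^ 3 by ring, hζ, one_pow]
  exact adjoinZ_six ▸ root_mem (by norm_num) this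

theorem eis_pair_two {x y : ℂ} (hx : 2 * x ∈ adjoinZ (ξ 3)) (hy : 2 * y ∈ adjoinZ (ξ 3)) :
    x ∈ adjoinZ (ξ 3) ∨ y ∈ adjoinZ (ξ 3) ∨ ∃ ζ : ℂ, ζ ^ 3 = 1 ∧ x - ζ * y ∈ adjoinZ (ξ 3) := by
  rcases eis_mod_two hx with ⟨w, hw, h⟩ | ⟨ζ₁, hζ₁, w₁, hw₁, h₁⟩
  · exact Or.inl (mul_left_cancel₀ two_ne_zero h ▸ hw)
  rcases eis_mod_two hy with ⟨w, hw, h⟩ | ⟨ζ₂, hζ₂, w₂, hw₂, h₂⟩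
  · exact Or.inr (Or.inl (mul_left_cancel₀ two_ne_zero h ▸ hw))
  have hζ : (ζ₁ * ζ₂⁻¹) ^ 3 = 1 := by rw [mul_pow, inv_pow, hζ₁, hζ₂]; norm_num
  exact Or.inr (Or.inr ⟨_, hζ, sub_mem_of_unit_residues two_ne_zero (root_mem (by norm_num) hζ)
    (ne_zero_of_pow (by norm_num) hζ₂) hw₁ hw₂ h₁ h₂⟩)

theorem gauss_pair_two {x y : ℂ} (hx : 2 * x ∈ adjoinZ (ξ 4)) (hy : 2 * y ∈ adjoinZ (ξ 4)) :
    (1 + Complex.I) * x ∈ adjoinZ (ξ 4) ∨ (1 + Complex.I) * y ∈ adjoinZ (ξ 4) ∨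
      ∃ ζ : ℂ, ζ ^ 4 = 1 ∧ x - ζ * y ∈ adjoinZ (ξ 4) := by
  have key : ∀ x w : ℂ, w ∈ adjoinZ (ξ 4) → 2 * x = (1 - Complex.I) * w →
      (1 + Complex.I) * x ∈ adjoinZ (ξ 4) := by
    intro x w hw h
    have : (1 + Complex.I) * x = w := by
      apply mul_left_cancel₀ one_sub_I_ne
      linear_combination h - x * Complex.I_sq
    rwa [this]
  have hpow : ∀ ζ : ℂ, ζ = 1 ∨ ζ = Complex.I → ζ ^ 4 = 1 := by
    rintro ζ (rfl | rfl)
    · norm_num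
    · exact Complex.I_pow_four
  rcases gauss_mod_two hx with ⟨w, hw, h⟩ | ⟨ζ₁, hζ₁, w₁, hw₁, h₁⟩
  · exact Or.inl (key x w hw h)
  rcases gauss_mod_two hy with ⟨w, hw, h⟩ | ⟨ζ₂, hζ₂, w₂, hw₂, h₂⟩
  · exact Or.inr (Or.inl (key y w hw h))
  have hζ : (ζ₁ * ζ₂⁻¹) ^ 4 = 1 := by
    rw [mul_pow, inv_pow, hpow _ hζ₁, hpow _ hζ₂]; norm_num
  exact Or.inr (Or.inr ⟨_, hζ, sub_mem_of_unit_residues two_ne_zero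
    (root_mem (by norm_num) hζ) (ne_zero_of_pow (by norm_num) (hpow _ hζ₂)) hw₁ hw₂ h₁ h₂⟩)

/-! ### Discrete modules over `ℤ[ξ]` in the plane -/

/-- Every complex number is at distance at most `√(1/2)` from `ℤ[ξ]`. -/
theorem exists_near {r : ℕ} (hr : r = 3 ∨ r = 4 ∨ r = 6) (z : ℂ) :
    ∃ a ∈ adjoinZ (ξ r), Complex.normSq (z - a) ≤ 1 / 2 := by
  have h3 : ∀ z : ℂ, ∃ a ∈ adjoinZ (ξ 3), Complex.normSq (z - a) ≤ 1 / 2 := by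
    intro z
    have hre : (ξ 3).re = -1 / 2 := by
      have := congrArg Complex.re conj_xi_three
      simp at this
      linarith
    have him : (ξ 3).im ^ 2 = 3 / 4 := by
      have := congrArg Complex.re xi_three_sq
      simp [pow_two, hre] at this
      nlinarith
    have him0 : (ξ 3).im ≠ 0 := by
      intro h
      rw [h] at him
      norm_num at him
    refine ⟨_, mem_eis_iff.2 ⟨round (z.re + round (z.im / (ξ 3).im) / 2 : ℝ),
      round (z.im / (ξ 3).im), rfl⟩, ?_⟩
    have hb := abs_sub_round (z.im / (ξ 3).im)
    have ha := abs_sub_round (z.re + round (z.im / (ξ 3).im) / 2 : ℝ)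
    generalize round (z.re + round (z.im / (ξ 3).im) / 2 : ℝ) = A at *
    generalize round (z.im / (ξ 3).im) = B at *
    have hz : z.im = (z.im / (ξ 3).im) * (ξ 3).im := by field_simp
    generalize z.im / (ξ 3).im = t at *
    rw [Complex.normSq_apply]
    simp [hre, hz]
    have ha' := sq_le_sq' (abs_le.1 ha).1 (abs_le.1 ha).2
    have hb' := sq_le_sq' (abs_le.1 hb).1 (abs_le.1 hb).2
    have e1 : (t * (ξ 3).im - B * (ξ 3).im) * (t * (ξ 3).im - B * (ξ 3).im) =
        (3 / 4) * (t - B) ^ 2 := by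
      rw [← him]
      ring
    rw [e1]
    nlinarith
  rcases hr with rfl | rfl | rfl
  · exact h3 z
  · refine ⟨_, mem_gauss_iff.2 ⟨round z.re, round z.im, rfl⟩, ?_⟩
    have ha := abs_sub_round z.re
    have hb := abs_sub_round z.im
    have ha' := sq_le_sq' (abs_le.1 ha).1 (abs_le.1 ha).2
    have hb' := sq_le_sq' (abs_le.1 hb).1 (abs_le.1 hb).2
    rw [Complex.normSq_apply]
    simp
    nlinarith
  · rw [adjoinZ_six]
    exact h3 z

/-- A nonzero discrete subgroup contains a nonzero element which is, up to the factor `ρ < 1`, as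
short as possible. -/
theorem exists_almost_shortest (N : AddSubgroup ℂ) {ε : ℝ} (hε : 0 < ε)
    (hN : ∀ x ∈ N, ‖x‖ < ε → x = 0) (hne : ∃ x ∈ N, x ≠ 0) {ρ : ℝ} (hρ0 : 0 ≤ ρ) (hρ : ρ < 1) :
    ∃ x ∈ N, x ≠ 0 ∧ ∀ y ∈ N, ‖y‖ ≤ ρ * ‖x‖ → y = 0 := by
  by_contra! hcon
  obtain ⟨x, hx, hx0⟩ := hne
  have hstep : ∀ k : ℕ, ∃ y ∈ N, y ≠ 0 ∧ ‖y‖ ≤ ρ ^ k * ‖x‖ := by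
    intro k
    induction k with
    | zero => exact ⟨x, hx, hx0, by simp⟩
    | succ k ih =>
      obtain ⟨y, hy, hy0, hle⟩ := ih
      obtain ⟨z, hz, hzle, hz0⟩ := hcon y hy hy0
      refine ⟨z, hz, hz0, hzle.trans ?_⟩
      rw [pow_succ', mul_assoc]
      exact mul_le_mul_of_nonneg_left hle hρ0
  obtain ⟨k, hk⟩ := exists_pow_lt_of_lt_one (div_pos hε (norm_pos_iff.2 hx0)) hρ
  obtain ⟨y, hy, hy0, hle⟩ := hstep k
  refine hy0 (hN y hy (hle.trans_lt ?_))
  rwa [lt_div_iff₀ (norm_pos_iff.2 hx0)] at hk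

/-- The crystallographic restriction: multiplication by `ξ - 1` for `r ≥ 7`, and by `ξ² + 1` for
`r = 5`, would shorten all vectors of the discrete group `N`. -/
theorem order_of_discrete {r : ℕ} (hr : 3 ≤ r) (N : AddSubgroup ℂ) {ε : ℝ} (hε : 0 < ε)
    (hN : ∀ x ∈ N, ‖x‖ < ε → x = 0) (hne : ∃ x ∈ N, x ≠ 0) (hξ : ∀ x ∈ N, ξ r * x ∈ N) :
    r = 3 ∨ r = 4 ∨ r = 6 := by
  -- no `z` with `0 < |z| < 1` can map `N` to itself
  have key : ∀ z : ℂ, z ≠ 0 → Complex.normSq z < 1 → (∀ x ∈ N, z * x ∈ N) → False := by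
    intro z hz hz1 hzN
    have h1 : ‖z‖ < 1 := by
      rw [Complex.normSq_eq_norm_sq] at hz1
      exact (sq_lt_one_iff₀ (norm_nonneg _)).1 hz1
    obtain ⟨x, hx, hx0, hmin⟩ := exists_almost_shortest N hε hN hne (norm_nonneg z) h1
    exact mul_ne_zero hz hx0 (hmin _ (hzN x hx) (norm_mul z x).le)
  have hr0 : (r : ℝ) ≠ 0 := by positivity
  have hξeq : ξ r = Complex.exp ((2 * Real.pi / r : ℝ) * Complex.I) := by
    rw [ξ]
    congr 1
    push_cast
    ring
  have hpi := Real.pi_pos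
  have hcos : ∀ t : ℝ, 0 < t → t < Real.pi / 3 → 1 / 2 < Real.cos t ∧ Real.cos t < 1 := by
    intro t h0 h1
    constructor
    · rw [← Real.cos_pi_div_three]
      exact Real.cos_lt_cos_of_nonneg_of_le_pi h0.le (by linarith) h1
    · rw [← Real.cos_zero]
      exact Real.cos_lt_cos_of_nonneg_of_le_pi le_rfl (by linarith) h0
  have hsmall : 3 ≤ r ∧ r ≤ 6 := by
    refine ⟨hr, ?_⟩
    by_contra! h6
    have h7 : (7 : ℝ) ≤ r := by exact_mod_cast h6
    have hc := hcos (2 * Real.pi / r) (by positivity) (by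
      rw [div_lt_div_iff₀ (by positivity) (by norm_num)]
      nlinarith)
    have hsc := Real.sin_sq_add_cos_sq (2 * Real.pi / r)
    have hn : Complex.normSq (ξ r - 1) = 2 - 2 * Real.cos (2 * Real.pi / r) := by
      rw [hξeq, Complex.normSq_apply]
      simp [Complex.exp_ofReal_mul_I_re, Complex.exp_ofReal_mul_I_im, -Complex.ofReal_div,
        -Complex.ofReal_mul]
      nlinarith
    refine key (ξ r - 1) (Complex.normSq_pos.1 (by rw [hn]; linarith)) (by rw [hn]; linarith)
      fun x hx => ?_
    rw [sub_mul, one_mul]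
    exact N.sub_mem (hξ x hx) hx
  have h5 : r ≠ 5 := by
    rintro rfl
    have hc := hcos (Real.pi / 5) (by positivity) (by linarith)
    have h2 : ξ 5 ^ 2 = Complex.exp ((Real.pi - Real.pi / 5 : ℝ) * Complex.I) := by
      rw [hξeq, ← Complex.exp_nat_mul]
      congr 1
      push_cast
      ring
    have hsc := Real.sin_sq_add_cos_sq (Real.pi / 5)
    have hn : Complex.normSq (ξ 5 ^ 2 + 1) = 2 - 2 * Real.cos (Real.pi / 5) := by
      rw [h2, Complex.normSq_apply, Complex.add_re, Complex.add_im, Complex.exp_ofReal_mul_I_re,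
        Complex.exp_ofReal_mul_I_im, Real.cos_pi_sub, Real.sin_pi_sub]
      simp only [Complex.one_re, Complex.one_im]
      nlinarith
    refine key (ξ 5 ^ 2 + 1) (Complex.normSq_pos.1 (by rw [hn]; linarith)) (by rw [hn]; linarith)
      fun x hx => ?_
    rw [add_mul, one_mul, pow_two, mul_assoc]
    exact N.add_mem (hξ _ (hξ x hx)) hx
  omega

theorem mul_mem_of_xi_stable {r : ℕ} {N : AddSubgroup ℂ} (hξ : ∀ x ∈ N, ξ r * x ∈ N)
    {a : ℂ} (ha : a ∈ adjoinZ (ξ r)) : ∀ x ∈ N, a * x ∈ N := by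
  induction ha using Algebra.adjoin_induction with
  | mem y hy =>
    obtain rfl : y = ξ r := hy
    exact hξ
  | algebraMap a =>
    intro x hx
    have := N.zsmul_mem hx a
    simpa using this
  | add y z _ _ hy hz =>
    intro x hx
    rw [add_mul]
    exact N.add_mem (hy x hx) (hz x hx)
  | mul y z _ _ hy hz =>
    intro x hx
    rw [mul_assoc]
    exact hy _ (hz x hx)

/-- `ℤ[ξ]` is Euclidean, so that a nonzero discrete module over it in `ℂ` is free of rank one. -/
theorem exists_generator {r : ℕ} (hr : r = 3 ∨ r = 4 ∨ r = 6) (N : AddSubgroup ℂ) {ε : ℝ}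
    (hε : 0 < ε) (hN : ∀ x ∈ N, ‖x‖ < ε → x = 0) (hne : ∃ x ∈ N, x ≠ 0)
    (hξ : ∀ x ∈ N, ξ r * x ∈ N) :
    ∃ c : ℂ, c ≠ 0 ∧ ∀ x, x * c ∈ N ↔ x ∈ adjoinZ (ξ r) := by
  have hρ : √(1 / 2 : ℝ) < 1 := by
    rw [Real.sqrt_lt' one_pos]
    norm_num
  obtain ⟨c, hc, hc0, hmin⟩ := exists_almost_shortest N hε hN hne (Real.sqrt_nonneg _) hρ
  refine ⟨c, hc0, fun x => ⟨fun hx => ?_, fun hx => mul_mem_of_xi_stable hξ hx c hc⟩⟩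
  obtain ⟨a, ha, hle⟩ := exists_near hr x
  have hmem : (x - a) * c ∈ N := by
    rw [sub_mul]
    exact N.sub_mem hx (mul_mem_of_xi_stable hξ ha c hc)
  have h0 := hmin _ hmem (by
    rw [norm_mul]
    refine mul_le_mul_of_nonneg_right ?_ (norm_nonneg c)
    rw [← Real.sqrt_sq (norm_nonneg (x - a)), ← Complex.normSq_eq_norm_sq]
    exact Real.sqrt_le_sqrt hle)
  rcases mul_eq_zero.1 h0 with h | h
  · rwa [sub_eq_zero.1 h]
  · exact absurd h hc0

/-! ### Lattices defined by a congruence -/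

/-- The multiples of `δ` in `ℤ[ξ]`. -/
def multiples (r : ℕ) (δ : ℂ) : AddSubgroup ℂ where
  carrier := {z | ∃ a ∈ adjoinZ (ξ r), z = δ * a}
  add_mem' := by
    rintro _ _ ⟨a, ha, rfl⟩ ⟨b, hb, rfl⟩
    exact ⟨a + b, add_mem ha hb, by ring⟩
  zero_mem' := ⟨0, zero_mem _, by simp⟩
  neg_mem' := by
    rintro _ ⟨a, ha, rfl⟩
    exact ⟨-a, neg_mem ha, by ring⟩

theorem mem_multiples {r : ℕ} {δ z : ℂ} :
    z ∈ multiples r δ ↔ ∃ a ∈ adjoinZ (ξ r), z = δ * a := Iff.rfl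

theorem mul_mem_multiples {r : ℕ} {δ a z : ℂ} (ha : a ∈ adjoinZ (ξ r)) (hz : z ∈ multiples r δ) :
    a * z ∈ multiples r δ := by
  obtain ⟨b, hb, rfl⟩ := hz
  exact ⟨a * b, mul_mem ha hb, by ring⟩

theorem self_mul_mem_multiples {r : ℕ} {δ a : ℂ} (ha : a ∈ adjoinZ (ξ r)) :
    δ * a ∈ multiples r δ := ⟨a, ha, rfl⟩

theorem mem_of_mem_multiples {r : ℕ} {δ z : ℂ} (hδ : δ ∈ adjoinZ (ξ r)) (hz : z ∈ multiples r δ) :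
    z ∈ adjoinZ (ξ r) := by
  obtain ⟨b, hb, rfl⟩ := hz
  exact mul_mem hδ hb

theorem mem_multiples_one {r : ℕ} {z : ℂ} : z ∈ multiples r 1 ↔ z ∈ adjoinZ (ξ r) := by
  simp [mem_multiples]

/-- All `r`-th roots of unity are congruent to `1` modulo `δ`. -/
def IsUnipotentMod (r : ℕ) (δ : ℂ) : Prop := ∀ ζ : ℂ, ζ ^ r = 1 → ζ - 1 ∈ multiples r δ

theorem isUnipotentMod_one {r : ℕ} (hr : r ≠ 0) : IsUnipotentMod r 1 := fun _ hζ =>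
  mem_multiples_one.2 (sub_mem (root_mem hr hζ) (one_mem _))

theorem isUnipotentMod_one_sub_xi {r : ℕ} (hr : r ≠ 0) : IsUnipotentMod r (1 - ξ r) := by
  intro ζ hζ
  have : NeZero r := ⟨hr⟩
  obtain ⟨k, -, rfl⟩ := (xi_isPrimitiveRoot hr).eq_pow_of_pow_eq_one hζ
  refine ⟨-∑ i ∈ Finset.range k, ξ r ^ i,
    neg_mem (sum_mem fun i _ => pow_mem (xi_mem r) i), ?_⟩
  rw [← geom_sum_mul]
  ring

/-- The lattice of the vectors over `ℤ[ξ]` whose coordinate sum is divisible by `δ`. -/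
def sumLattice (r n : ℕ) (δ : ℂ) : Submodule ℤ (Cn n) where
  carrier := {x | (∀ i, x i ∈ adjoinZ (ξ r)) ∧ ∑ i, x i ∈ multiples r δ}
  add_mem' := by
    rintro x y ⟨hx, hx'⟩ ⟨hy, hy'⟩
    refine ⟨fun i => add_mem (hx i) (hy i), ?_⟩
    simp only [PiLp.add_apply, Finset.sum_add_distrib]
    exact add_mem hx' hy'
  zero_mem' := ⟨fun i => zero_mem _, by simp [zero_mem]⟩
  smul_mem' := by
    rintro m x ⟨hx, hx'⟩
    refine ⟨fun i => zsmul_mem (hx i) m, ?_⟩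
    simp only [PiLp.smul_apply, ← Finset.smul_sum]
    exact zsmul_mem hx' m

theorem mem_sumLattice {r n : ℕ} {δ : ℂ} {x : Cn n} :
    x ∈ sumLattice r n δ ↔ (∀ i, x i ∈ adjoinZ (ξ r)) ∧ ∑ i, x i ∈ multiples r δ := Iff.rfl

theorem mem_sumLattice_one {r n : ℕ} {x : Cn n} :
    x ∈ sumLattice r n 1 ↔ ∀ i, x i ∈ adjoinZ (ξ r) :=
  ⟨fun h => h.1, fun h => ⟨h, mem_multiples_one.2 (sum_mem fun i _ => h i)⟩⟩

theorem sumLattice_isInvariant {r n : ℕ} (hr : r ≠ 0) (p : ℕ) {δ : ℂ}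
    (hδ : IsUnipotentMod r δ) : IsInvariant (G r p n) (sumLattice r n δ) := by
  rintro A ⟨σ, d, h1, -, h⟩ x ⟨hx, hx'⟩
  refine ⟨fun i => h x i ▸ mul_mem (root_mem hr (h1 i)) (hx _), ?_⟩
  have : ∑ i, (A x) i = ∑ i, x (σ i) * (d i - 1) + ∑ i, x i := by
    rw [← Equiv.sum_comp σ (fun i => x i), ← Finset.sum_add_distrib]
    exact Finset.sum_congr rfl fun i _ => by rw [h]; ring
  rw [this]
  exact add_mem (sum_mem fun i _ => mul_mem_multiples (hx _) (hδ _ (h1 i))) hx'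

/-- The lattice in `ℂ²` of the vectors `x` over `ℤ[ξ]` with `x₁ ≡ f x₀` modulo `δ`. -/
def twistLattice (r : ℕ) (δ : ℂ) (f : ℂ →+ ℂ) : Submodule ℤ (Cn 2) where
  carrier := {x | x 0 ∈ adjoinZ (ξ r) ∧ x 1 ∈ adjoinZ (ξ r) ∧ x 1 - f (x 0) ∈ multiples r δ}
  add_mem' := by
    rintro x y ⟨hx, hx', hx''⟩ ⟨hy, hy', hy''⟩
    refine ⟨add_mem hx hy, add_mem hx' hy', ?_⟩
    simp only [PiLp.add_apply, map_add]
    convert add_mem hx'' hy'' using 1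
    ring
  zero_mem' := ⟨zero_mem _, zero_mem _, by simp [zero_mem]⟩
  smul_mem' := by
    rintro m x ⟨hx, hx', hx''⟩
    refine ⟨zsmul_mem hx m, zsmul_mem hx' m, ?_⟩
    simp only [PiLp.smul_apply, map_zsmul, ← smul_sub]
    exact zsmul_mem hx'' m

theorem mem_twistLattice {r : ℕ} {δ : ℂ} {f : ℂ →+ ℂ} {x : Cn 2} :
    x ∈ twistLattice r δ f ↔
      x 0 ∈ adjoinZ (ξ r) ∧ x 1 ∈ adjoinZ (ξ r) ∧ x 1 - f (x 0) ∈ multiples r δ := Iff.rfl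

theorem perm_fin_two (σ : Equiv.Perm (Fin 2)) : σ = 1 ∨ σ = Equiv.swap 0 1 := by
  revert σ
  decide

theorem twistLattice_isInvariant {r p : ℕ} (hr : r ≠ 0) {δ : ℂ} {f : ℂ →+ ℂ}
    (hfδ : ∀ x ∈ multiples r δ, f x ∈ multiples r δ)
    (hf : ∀ c d x : ℂ, c ^ r = 1 → d ^ r = 1 → (c * d) ^ (r / p) = 1 → x ∈ adjoinZ (ξ r) →
      d * f x - f (c * x) ∈ multiples r δ ∧ d * x - f (c * f x) ∈ multiples r δ) :
    IsInvariant (G r p 2) (twistLattice r δ f) := by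
  rintro A ⟨σ, d, h1, h2, h⟩ x ⟨hx0, hx1, hx⟩
  rw [Fin.prod_univ_two] at h2
  have hd := hf (d 0) (d 1) (x 0) (h1 0) (h1 1) h2 hx0
  have hdR : ∀ i, d i ∈ adjoinZ (ξ r) := fun i => root_mem hr (h1 i)
  rw [mem_twistLattice]
  rcases perm_fin_two σ with rfl | rfl
  · refine ⟨h x 0 ▸ mul_mem (hdR 0) hx0, h x 1 ▸ mul_mem (hdR 1) hx1, ?_⟩
    rw [h, h]
    convert add_mem (mul_mem_multiples (hdR 1) hx) hd.1 using 1
    simp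
    ring
  · rw [h, h]
    simp only [Equiv.swap_apply_left, Equiv.swap_apply_right]
    refine ⟨mul_mem (hdR 0) hx1, mul_mem (hdR 1) hx0, ?_⟩
    convert sub_mem hd.2 (hfδ _ (mul_mem_multiples (hdR 0) hx)) using 1
    rw [mul_sub, map_sub]
    ring

/-! ### The Steinberg property for the lattices `sumLattice` -/

/-- A diagonal element with just one entry different from `1` is a reflection. -/
theorem onMirror_of_unique {n r p : ℕ} {Λ : Submodule ℤ (Cn n)} {d : Fin n → ℂ} {v b : Cn n}
    (h2 : (∏ i, d i) ^ (r / p) = 1) (hb : b ∈ Λ) (hv : ∀ i, v i = d i * v i + b i) {i : Fin n}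
    (hi : d i ≠ 1) (hu : ∀ j, j ≠ i → d j = 1) : OnMirror r p Λ v := by
  have hprod : ∏ k, d k = d i := by
    rw [Finset.prod_eq_single i (fun k _ hk => hu k hk) (by simp)]
  refine Or.inl ⟨i, d i, by rw [← hprod, h2], hi, ?_⟩
  convert hb
  ext k
  rcases eq_or_ne k i with rfl | hk
  · simp
    linear_combination hv k
  · have := hv k
    simp [hu k hk] at this
    simp [hk, this]

theorem onMirror_sum_single {n r p : ℕ} {δ : ℂ} (hδ : δ ∈ adjoinZ (ξ r)) {v : Cn n} (i : Fin n)
    {η : ℂ} (hη : η ^ (r / p) = 1) (hη1 : η ≠ 1) (h : (1 - η) * v i ∈ multiples r δ) :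
    OnMirror r p (sumLattice r n δ) v := by
  refine Or.inl ⟨i, η, hη, hη1, fun k => ?_, ?_⟩
  · rcases eq_or_ne k i with rfl | hk
    · simpa using mem_of_mem_multiples hδ h
    · simp [hk]
  · simpa using h

theorem onMirror_sum_pair {n r p : ℕ} (hr : r ≠ 0) {δ : ℂ} (hδ : IsUnipotentMod r δ) {v : Cn n}
    {i j : Fin n} (hij : i ≠ j) {ζ : ℂ} (hζ : ζ ^ r = 1) (h : v i - ζ * v j ∈ adjoinZ (ξ r)) :
    OnMirror r p (sumLattice r n δ) v := by
  have hζ' : ζ⁻¹ ^ r = 1 := by rw [inv_pow, hζ, inv_one]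
  refine Or.inr ⟨i, j, ζ, hij, hζ, fun k => ?_, ?_⟩
  · rcases eq_or_ne k i with rfl | hk
    · simpa [hij] using h
    · rcases eq_or_ne k j with rfl | hk'
      · simpa [hk] using mul_mem (root_mem hr hζ') h
      · simp [hk, hk']
  · simp only [PiLp.sub_apply, Finset.sum_sub_distrib]
    convert mul_mem_multiples (neg_mem h) (hδ _ hζ') using 1
    simp
    ring

/-- Elements with a nontrivial permutation part cause no harm to the Steinberg property of
`G(r,p,n) ⋉ sumLattice`, and among the diagonal ones only those with two entries `≠ 1` have to be
examined. -/
theorem sum_steinberg_of {n r p : ℕ} (hr : r ≠ 0) (hpr : p ∣ r) {δ : ℂ} (hδ : IsUnipotentMod r δ)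
    (h : ∀ (i j : Fin n) (v : Cn n) (c d : ℂ), i ≠ j → c ^ r = 1 → d ^ r = 1 → c ≠ 1 → d ≠ 1 →
      (1 - c) * v i ∈ adjoinZ (ξ r) → (1 - d) * v j ∈ adjoinZ (ξ r) →
      OnMirror r p (sumLattice r n δ) v) :
    SteinbergProperty (semidirect (G r p n) (sumLattice r n δ)) := by
  rw [steinberg_iff hr hpr (sumLattice_isInvariant hr p hδ)]
  intro σ d v b h1 h2 hb hv hne
  by_cases hσ : σ = 1
  · subst hσ
    simp only [Equiv.Perm.coe_one, id_eq] at hv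
    obtain ⟨i, hi⟩ := hne.resolve_left (by simp)
    by_cases hu : ∀ j, j ≠ i → d j = 1
    · exact onMirror_of_unique h2 hb hv hi hu
    · push Not at hu
      obtain ⟨j, hji, hj⟩ := hu
      have hb' : ∀ i, (1 - d i) * v i = b i := fun i => by linear_combination hv i
      exact h i j v (d i) (d j) hji.symm (h1 i) (h1 j) hi hj (hb' i ▸ hb.1 i) (hb' j ▸ hb.1 j)
  · have hex : ∃ i, i ≠ σ i := by
      by_contra! hcon
      exact hσ (Equiv.ext fun i => (hcon i).symm)
    obtain ⟨i, hi⟩ := hex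
    exact onMirror_sum_pair hr hδ hi (h1 i) (by
      have : v i - d i * v (σ i) = b i := by linear_combination hv i
      exact this ▸ hb.1 i)

/-- For `G(r,1,n) ⋉ ℤ[ξ]ⁿ` every nontrivial entry of a diagonal element gives a reflection. -/
theorem steinberg_sum_one {r : ℕ} (hr : r ≠ 0) (n : ℕ) :
    SteinbergProperty (semidirect (G r 1 n) (sumLattice r n 1)) :=
  sum_steinberg_of hr (one_dvd r) (isUnipotentMod_one hr) fun i _ _ c _ _ hc _ hc1 _ h _ =>
    onMirror_sum_single (one_mem _) i (by simpa using hc) hc1 (mem_multiples_one.2 h)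

/-- Over `ℤ[i]`, for both ideals `δ = 1` and `δ = 1 - i`. The coordinates moved by a diagonal
element are in `2⁻¹ ℤ[i]`. If one of them is in `(1 + i)⁻¹ ℤ[i]`, the point is on the mirror of a
reflection of order two in this coordinate; otherwise two of them differ by a root of unity. -/
theorem steinberg_gauss {p : ℕ} (hp : p = 1 ∨ p = 2) (n : ℕ) {δ : ℂ}
    (hδ : δ = 1 ∨ δ = 1 - ξ 4) :
    SteinbergProperty (semidirect (G 4 p n) (sumLattice 4 n δ)) := by
  have hI : Complex.I ∈ adjoinZ (ξ 4) := xi_four ▸ xi_mem 4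
  have hδR : δ ∈ adjoinZ (ξ 4) := by
    rcases hδ with rfl | rfl
    · exact one_mem _
    · exact sub_mem (one_mem _) (xi_mem 4)
  have hδu : IsUnipotentMod 4 δ := by
    rcases hδ with rfl | rfl
    · exact isUnipotentMod_one (by norm_num)
    · exact isUnipotentMod_one_sub_xi (by norm_num)
  -- `δ` divides `1 - i`, so that `(1 + i) x` integral makes `2 x` divisible by `δ`
  have key : ∀ (v : Cn n) (i : Fin n), (1 + Complex.I) * v i ∈ adjoinZ (ξ 4) →
      OnMirror 4 p (sumLattice 4 n δ) v := by
    intro v i h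
    refine onMirror_sum_single hδR i (η := -1) ?_ (by norm_num) ?_
    · rcases hp with rfl | rfl <;> norm_num
    · have : (1 - -1) * v i = (1 - Complex.I) * ((1 + Complex.I) * v i) := by
        linear_combination v i * Complex.I_sq
      rw [this]
      rcases hδ with rfl | rfl
      · exact mem_multiples_one.2 (mul_mem (sub_mem (one_mem _) hI) h)
      · rw [xi_four]
        exact self_mul_mem_multiples h
  have cases : ∀ (v : Cn n) (i : Fin n) (c : ℂ), c ^ 4 = 1 → c ≠ 1 →
      (1 - c) * v i ∈ adjoinZ (ξ 4) →
      (1 + Complex.I) * v i ∈ adjoinZ (ξ 4) ∨ 2 * v i ∈ adjoinZ (ξ 4) := by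
    intro v i c hc hc1 h
    rcases pow_four_cases hc with rfl | rfl | rfl | rfl
    · exact absurd rfl hc1
    · right
      convert h using 1
      ring
    · left
      convert mul_mem hI h using 1
      linear_combination v i * Complex.I_sq
    · left
      convert h using 1
      ring
  refine sum_steinberg_of (by norm_num) (by rcases hp with rfl | rfl <;> norm_num) hδu
    fun i j v c d hij hc hd hc1 hd1 hi hj => ?_
  rcases cases v i c hc hc1 hi with hi | hi
  · exact key v i hi
  rcases cases v j d hd hd1 hj with hj | hj
  · exact key v j hj
  rcases gauss_pair_two hi hj with h | h | ⟨ζ, hζ, h⟩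
  · exact key v i h
  · exact key v j h
  · exact onMirror_sum_pair (by norm_num) hδu hij hζ h

theorem pow_six_of_pow_three {ζ : ℂ} (h : ζ ^ 3 = 1) : ζ ^ 6 = 1 := by
  rw [show ζ ^ 6 = (ζ ^ 3) ^ 2 by ring, h, one_pow]

/-- What `(1 - c) x` integral means for `x`, for the sixth roots of unity `c ≠ 1`. -/
theorem eis_cases {x c : ℂ} (hc : c ^ 6 = 1) (hc1 : c ≠ 1) (h : (1 - c) * x ∈ adjoinZ (ξ 3)) :
    (c ^ 3 = 1 ∧ (1 - ξ 3) * x ∈ adjoinZ (ξ 3)) ∨ (c = -1 ∧ 2 * x ∈ adjoinZ (ξ 3)) ∨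
      x ∈ adjoinZ (ξ 3) := by
  have h3 := xi_three_sq
  have hω := xi_mem 3
  rcases pow_six_cases hc with h' | h'
  · refine Or.inl ⟨h', ?_⟩
    rcases pow_three_cases h' with rfl | rfl | rfl
    · exact absurd rfl hc1
    · exact h
    · convert mul_mem (neg_mem hω) h using 1
      linear_combination x * (1 - ξ 3) * h3
  · right
    rcases pow_three_cases h' with h' | h' | h'
    · have : c = -1 := by linear_combination -h'
      subst this
      refine Or.inl ⟨rfl, ?_⟩
      convert h using 1
      ring
    · have : c = -ξ 3 := by linear_combination -h'
      subst this
      right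
      convert mul_mem (neg_mem hω) h using 1
      linear_combination x * h3
    · have : c = -ξ 3 ^ 2 := by linear_combination -h'
      subst this
      right
      convert mul_mem (add_mem (one_mem _) hω) h using 1
      linear_combination (- x * ξ 3) * h3

/-- Over `ℤ[ω]`, for `G(6,2,n)` and `G(6,3,n)`. The diagonal reflections have order three and two,
respectively, and put the points with a coordinate in `(1 - ω)⁻¹ ℤ[ω]`, respectively `2⁻¹ ℤ[ω]`, on
mirrors. Of the fixed points of diagonal elements only those with two coordinates in `2⁻¹ ℤ[ω]`,
respectively `(1 - ω)⁻¹ ℤ[ω]`, remain. -/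
theorem steinberg_six {p : ℕ} (hp : p = 2 ∨ p = 3) (n : ℕ) :
    SteinbergProperty (semidirect (G 6 p n) (sumLattice 6 n 1)) := by
  have hR := adjoinZ_six
  have hω3 : ξ 3 ^ 3 = 1 := xi_pow (by norm_num)
  have hω1 : ξ 3 ≠ 1 := fun h => one_sub_xi_three_ne (by rw [h, sub_self])
  have hδu : IsUnipotentMod 6 1 := isUnipotentMod_one (by norm_num)
  refine sum_steinberg_of (by norm_num) (by rcases hp with rfl | rfl <;> norm_num) hδu
    fun i j v c d hij hc hd hc1 hd1 hi hj => ?_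
  rw [hR] at hi hj
  have pair : ∀ ζ : ℂ, ζ ^ 6 = 1 → v i - ζ * v j ∈ adjoinZ (ξ 3) →
      OnMirror 6 p (sumLattice 6 n 1) v := fun ζ hζ h =>
    onMirror_sum_pair (by norm_num) hδu hij hζ (hR ▸ h)
  rcases hp with rfl | rfl
  · have key : ∀ i, (1 - ξ 3) * v i ∈ adjoinZ (ξ 3) → OnMirror 6 2 (sumLattice 6 n 1) v :=
      fun i h => onMirror_sum_single (one_mem _) i (by norm_num [hω3]) hω1
        (mem_multiples_one.2 (hR ▸ h))
    have key' : ∀ i, v i ∈ adjoinZ (ξ 3) → OnMirror 6 2 (sumLattice 6 n 1) v := fun i h =>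
      key i (mul_mem (sub_mem (one_mem _) (xi_mem 3)) h)
    rcases eis_cases hc hc1 hi with ⟨-, h⟩ | ⟨-, hi⟩ | h
    · exact key i h
    · rcases eis_cases hd hd1 hj with ⟨-, h⟩ | ⟨-, hj⟩ | h
      · exact key j h
      · rcases eis_pair_two hi hj with h | h | ⟨ζ, hζ, h⟩
        · exact key' i h
        · exact key' j h
        · exact pair ζ (pow_six_of_pow_three hζ) h
      · exact key' j h
    · exact key' i h
  · have key : ∀ i, 2 * v i ∈ adjoinZ (ξ 3) → OnMirror 6 3 (sumLattice 6 n 1) v :=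
      fun i h => onMirror_sum_single (one_mem _) i (η := -1) (by norm_num) (by norm_num)
        (mem_multiples_one.2 (by rw [hR]; convert h using 1; ring))
    have key' : ∀ i, v i ∈ adjoinZ (ξ 3) → OnMirror 6 3 (sumLattice 6 n 1) v := fun i h =>
      key i (by rw [two_mul]; exact add_mem h h)
    rcases eis_cases hc hc1 hi with ⟨-, hi⟩ | ⟨-, h⟩ | h
    · rcases eis_cases hd hd1 hj with ⟨-, hj⟩ | ⟨-, h⟩ | h
      · rcases eis_pair_theta hi hj with h | h | ⟨ζ, hζ, h⟩
        · exact key' i h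
        · exact key' j h
        · exact pair ζ (by rw [show ζ ^ 6 = (ζ ^ 2) ^ 3 by ring, hζ, one_pow]) h
      · exact key j h
      · exact key' j h
    · exact key i h
    · exact key' i h

/-! ### The Steinberg property for the two exceptional lattices in `ℂ²` -/

theorem onMirror_twist_single {r p : ℕ} {δ κ : ℂ} (hδ : δ ∈ adjoinZ (ξ r))
    (hκ : κ ∈ adjoinZ (ξ r)) {v : Cn 2} (i : Fin 2)
    {η : ℂ} (hη : η ^ (r / p) = 1) (hη1 : η ≠ 1) (h : (1 - η) * v i ∈ multiples r δ) :
    OnMirror r p (twistLattice r δ (AddMonoidHom.mulLeft κ)) v := by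
  refine Or.inl ⟨i, η, hη, hη1, ?_⟩
  rw [mem_twistLattice]
  fin_cases i
  · simp only [Fin.zero_eta, Fin.isValue] at h ⊢
    refine ⟨by simpa using mem_of_mem_multiples hδ h, by simp, ?_⟩
    simpa using neg_mem (mul_mem_multiples hκ h)
  · simp only [Fin.mk_one, Fin.isValue] at h ⊢
    refine ⟨by simp, by simpa using mem_of_mem_multiples hδ h, ?_⟩
    simpa using h

theorem onMirror_twist_pair {r p : ℕ} (hr : r ≠ 0) {δ κ ζ : ℂ} (hζ : ζ ^ r = 1) {v : Cn 2}
    (h : v 0 - ζ * v 1 ∈ adjoinZ (ξ r)) (h' : (ζ⁻¹ + κ) * (v 0 - ζ * v 1) ∈ multiples r δ) :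
    OnMirror r p (twistLattice r δ (AddMonoidHom.mulLeft κ)) v := by
  have hζ' : ζ⁻¹ ^ r = 1 := by rw [inv_pow, hζ, inv_one]
  refine Or.inr ⟨0, 1, ζ, by decide, hζ, ?_⟩
  rw [mem_twistLattice]
  refine ⟨by simpa using h, by simpa using mul_mem (root_mem hr hζ') h, ?_⟩
  convert neg_mem h' using 1
  simp
  ring

theorem eq_or_eq_neg_of_sq {c d : ℂ} (hc : c ^ 4 = 1) (h : (c * d) ^ 2 = 1) : d = c ∨ d = -c := by
  apply sq_eq_sq_iff_eq_or_eq_neg.1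
  linear_combination c ^ 2 * h - d ^ 2 * hc

theorem invariant_gauss_twist :
    IsInvariant (G 4 2 2) (twistLattice 4 2 (AddMonoidHom.mulLeft Complex.I)) := by
  have hI : Complex.I ∈ adjoinZ (ξ 4) := xi_four ▸ xi_mem 4
  refine twistLattice_isInvariant (by norm_num) (fun x hx => mul_mem_multiples hI hx) ?_
  intro c d x hc hd hcd hx
  have hcR : c ∈ adjoinZ (ξ 4) := root_mem (by norm_num) hc
  simp only [AddMonoidHom.coe_mulLeft]
  rcases eq_or_eq_neg_of_sq hc hcd with rfl | rfl
  · refine ⟨⟨0, zero_mem _, by ring⟩, ⟨d * x, mul_mem hcR hx, ?_⟩⟩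
    linear_combination (-d * x) * Complex.I_sq
  · refine ⟨⟨-Complex.I * c * x, mul_mem (mul_mem (neg_mem hI) hcR) hx, by ring⟩,
      ⟨0, zero_mem _, ?_⟩⟩
    linear_combination (-c * x) * Complex.I_sq

/-- `G(4,2,2)` with the lattice `{x : x₁ ≡ i x₀ mod 2}`. All elements of `G(4,2,2)` have entries
`d₁ = ± d₀`. -/
theorem steinberg_gauss_twist :
    SteinbergProperty
      (semidirect (G 4 2 2) (twistLattice 4 2 (AddMonoidHom.mulLeft Complex.I))) := by
  have hI : Complex.I ∈ adjoinZ (ξ 4) := xi_four ▸ xi_mem 4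
  have hI2 := Complex.I_sq
  have hIinv : Complex.I⁻¹ = -Complex.I := Complex.inv_I
  have hp : (1 + Complex.I) ∈ adjoinZ (ξ 4) := add_mem (one_mem _) hI
  have h2 : (2 : ℂ) ∈ adjoinZ (ξ 4) := by
    rw [← one_add_one_eq_two]
    exact add_mem (one_mem _) (one_mem _)
  rw [steinberg_iff (by norm_num) (by norm_num) invariant_gauss_twist]
  intro σ d v b h1 hprod hb hv hne
  obtain ⟨hb0, hb1, hbt⟩ := hb
  simp only [AddMonoidHom.coe_mulLeft] at hbt
  rw [Fin.prod_univ_two] at hprod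
  have hd := eq_or_eq_neg_of_sq (h1 0) hprod
  have hdR : ∀ i, d i ∈ adjoinZ (ξ 4) := fun i => root_mem (by norm_num) (h1 i)
  have single : ∀ i, v i ∈ adjoinZ (ξ 4) →
      OnMirror 4 2 (twistLattice 4 2 (AddMonoidHom.mulLeft Complex.I)) v := fun i h =>
    onMirror_twist_single h2 hI i (η := -1) (by norm_num) (by norm_num) ⟨v i, h, by ring⟩
  have pairI : v 0 - Complex.I * v 1 ∈ adjoinZ (ξ 4) →
      OnMirror 4 2 (twistLattice 4 2 (AddMonoidHom.mulLeft Complex.I)) v := fun h =>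
    onMirror_twist_pair (by norm_num) Complex.I_pow_four h ⟨0, zero_mem _, by rw [hIinv]; ring⟩
  have pairI' : v 0 - -Complex.I * v 1 ∈ adjoinZ (ξ 4) →
      OnMirror 4 2 (twistLattice 4 2 (AddMonoidHom.mulLeft Complex.I)) v := fun h =>
    onMirror_twist_pair (by norm_num) (by norm_num [neg_pow]) h
      ⟨_, mul_mem hI h, by rw [inv_neg, hIinv]; ring⟩
  -- points with both coordinates in `(1 + i)⁻¹ ℤ[i]`
  have small : (1 + Complex.I) * v 0 ∈ adjoinZ (ξ 4) → (1 + Complex.I) * v 1 ∈ adjoinZ (ξ 4) →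
      OnMirror 4 2 (twistLattice 4 2 (AddMonoidHom.mulLeft Complex.I)) v := by
    intro ha hb
    have cancel : ∀ x w : ℂ, w ∈ adjoinZ (ξ 4) → (1 + Complex.I) * x = (1 - Complex.I) * w →
        x ∈ adjoinZ (ξ 4) := by
      intro x w hw h
      have : x = -Complex.I * w := by
        apply mul_left_cancel₀ one_sub_I_ne
        linear_combination (-Complex.I) * h + x * hI2
      rw [this]
      exact mul_mem (neg_mem hI) hw
    rcases gauss_mod_pi ha with ⟨w, hw, h⟩ | ⟨w, hw, h⟩
    · exact single 0 (cancel _ _ hw h)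
    rcases gauss_mod_pi hb with ⟨u, hu, h'⟩ | ⟨u, hu, h'⟩
    · exact single 1 (cancel _ _ hu h')
    · refine pairI (cancel _ (1 + w - Complex.I * u)
        (sub_mem (add_mem (one_mem _) hw) (mul_mem hI hu)) ?_)
      linear_combination h - Complex.I * h'
  rcases perm_fin_two σ with rfl | rfl
  · simp only [Equiv.Perm.coe_one, id_eq] at hv
    have e0 : (1 - d 0) * v 0 = b 0 := by linear_combination hv 0
    have e1 : (1 - d 1) * v 1 = b 1 := by linear_combination hv 1
    have hI' : ∀ c x y : ℂ, c = Complex.I ∨ c = -Complex.I → (1 - c) * x = y →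
        y ∈ adjoinZ (ξ 4) → (1 + Complex.I) * x ∈ adjoinZ (ξ 4) := by
      rintro c x y (rfl | rfl) h hy
      · convert mul_mem hI hy using 1
        linear_combination Complex.I * h + x * hI2
      · convert hy using 1
        linear_combination h
    by_cases hd0 : d 0 = 1
    · refine onMirror_of_unique (i := 1) (by rw [Fin.prod_univ_two]; exact hprod)
        (mem_twistLattice.2 ⟨hb0, hb1, hbt⟩) hv ?_ ?_
      · intro hd1
        rcases hne with h | ⟨i, hi⟩
        · exact h rfl
        · fin_cases i
          · exact hi hd0
          · exact hi hd1
      · intro j hj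
        fin_cases j
        · exact hd0
        · exact absurd rfl hj
    · by_cases hd1 : d 1 = 1
      · refine onMirror_of_unique (i := 0) (by rw [Fin.prod_univ_two]; exact hprod)
          (mem_twistLattice.2 ⟨hb0, hb1, hbt⟩) hv hd0 ?_
        intro j hj
        fin_cases j
        · exact absurd rfl hj
        · exact hd1
      · rcases pow_four_cases (h1 0) with h | h | h | h
        · exact absurd h hd0
        · have hd1' : d 1 = -1 := by
            rcases hd with h' | h'
            · rw [h', h]
            · exact absurd (by rw [h', h]; ring) hd1
          rw [h] at e0
          rw [hd1'] at e1
          obtain ⟨a, ha, hab⟩ := hbt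
          refine pairI' ?_
          convert mul_mem hI ha using 1
          apply mul_left_cancel₀ (two_ne_zero (α := ℂ))
          linear_combination e0 + Complex.I * e1 + Complex.I * hab + b 0 * hI2
        · refine small (hI' _ _ _ (Or.inl h) e0 hb0) (hI' (d 1) _ _ ?_ e1 hb1)
          rw [← h]
          exact hd
        · refine small (hI' _ _ _ (Or.inr h) e0 hb0) (hI' (d 1) _ _ ?_ e1 hb1)
          rw [h, neg_neg] at hd
          exact hd.symm
  · have e0 : v 0 - d 0 * v 1 = b 0 := by
      have := hv 0
      simp at this
      linear_combination this
    have e1 : v 1 - d 1 * v 0 = b 1 := by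
      have := hv 1
      simp at this
      linear_combination this
    obtain ⟨a, ha, hab⟩ := hbt
    have real : ∀ s : ℂ, (s = 1 ∨ s = -1) → d 0 = s →
        OnMirror 4 2 (twistLattice 4 2 (AddMonoidHom.mulLeft Complex.I)) v := by
      intro s hs h
      have hs2 : s ^ 2 = 1 := by rcases hs with rfl | rfl <;> norm_num
      have hsinv : s⁻¹ = s := by rcases hs with rfl | rfl <;> norm_num
      rw [h] at e0
      rcases hd with h' | h'
      · -- the element has order two on `ℂ²`, so `b₁ = -s b₀`
        rw [h', h] at e1
        refine onMirror_twist_pair (ζ := s) (by norm_num)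
          (by rw [show s ^ 4 = (s ^ 2) ^ 2 by ring, hs2, one_pow]) (by rw [e0]; exact hb0)
          ⟨-a, neg_mem ha, ?_⟩
        rw [hsinv, e0]
        linear_combination -hab - e1 - s * e0 - v 1 * hs2
      · rw [h', h] at e1
        have hsR : s ∈ adjoinZ (ξ 4) := h ▸ hdR 0
        have f1 : 2 * v 1 = (Complex.I - s) * b 0 + 2 * a := by
          linear_combination e1 + hab - s * e0 - v 1 * hs2
        -- `i ∓ 1` is divisible by `1 - i`
        obtain ⟨t, ht, hts⟩ : ∃ t ∈ adjoinZ (ξ 4), Complex.I - s = (1 - Complex.I) * t := by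
          rcases hs with rfl | rfl
          · exact ⟨-1, neg_mem (one_mem _), by ring⟩
          · exact ⟨Complex.I, hI, by linear_combination hI2⟩
        have f2 : (1 + Complex.I) * v 1 = t * b 0 + (1 + Complex.I) * a := by
          apply mul_left_cancel₀ one_sub_I_ne
          linear_combination f1 + b 0 * hts - (v 1 - a) * hI2
        have f3 : (1 + Complex.I) * v 1 ∈ adjoinZ (ξ 4) := by
          rw [f2]
          exact add_mem (mul_mem ht hb0) (mul_mem hp ha)
        refine small ?_ f3
        have : (1 + Complex.I) * v 0 = s * ((1 + Complex.I) * v 1) + (1 + Complex.I) * b 0 := by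
          linear_combination (1 + Complex.I) * e0
        rw [this]
        exact add_mem (mul_mem hsR f3) (mul_mem hp hb0)
    rcases pow_four_cases (h1 0) with h | h | h | h
    · exact real 1 (Or.inl rfl) h
    · exact real (-1) (Or.inr rfl) h
    · exact pairI (by rw [← h, e0]; exact hb0)
    · exact pairI' (by rw [← h, e0]; exact hb0)

theorem exists_cube_root_ratio {c d : ℂ} (hc : c ^ 6 = 1) (h : (c * d) ^ 3 = 1) :
    ∃ ε : ℂ, ε ^ 3 = 1 ∧ d = c * ε := by
  have hc0 : c ≠ 0 := ne_zero_of_pow (by norm_num) hc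
  refine ⟨d * c⁻¹, ?_, by field_simp⟩
  have : d ^ 3 = c ^ 3 := by linear_combination c ^ 3 * h - d ^ 3 * hc
  rw [mul_pow, this, ← mul_pow, mul_inv_cancel₀ hc0, one_pow]

theorem theta_mem : 1 - ξ 3 ∈ adjoinZ (ξ 6) := by
  rw [adjoinZ_six]
  exact sub_mem (one_mem _) (xi_mem 3)

theorem sub_one_mem_theta {ε : ℂ} (hε : ε ^ 3 = 1) : ε - 1 ∈ multiples 6 (1 - ξ 3) := by
  obtain ⟨a, ha, h⟩ := isUnipotentMod_one_sub_xi (r := 3) (by norm_num) ε hε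
  exact ⟨a, adjoinZ_six ▸ ha, h⟩

theorem invariant_eis_twist :
    IsInvariant (G 6 2 2) (twistLattice 6 (1 - ξ 3) (AddMonoidHom.mulLeft 1)) := by
  refine twistLattice_isInvariant (by norm_num) (fun x hx => by simpa using hx) ?_
  intro c d x hc hd hcd hx
  have hcR : c ∈ adjoinZ (ξ 6) := root_mem (by norm_num) hc
  simp only [AddMonoidHom.coe_mulLeft, one_mul]
  obtain ⟨ε, hε, rfl⟩ := exists_cube_root_ratio hc hcd
  have : c * ε * x - c * x ∈ multiples 6 (1 - ξ 3) := by
    convert mul_mem_multiples (mul_mem hcR hx) (sub_one_mem_theta hε) using 1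
    ring
  exact ⟨this, this⟩

/-- `G(6,2,2)` with the lattice `{x : x₁ ≡ x₀ mod 1 - ω}`. All elements of `G(6,2,2)` have entries
`d₁ = ε d₀` with `ε³ = 1`, and `ε ≡ 1` modulo `1 - ω`. -/
theorem steinberg_eis_twist :
    SteinbergProperty
      (semidirect (G 6 2 2) (twistLattice 6 (1 - ξ 3) (AddMonoidHom.mulLeft 1))) := by
  have hR := adjoinZ_six
  have hω3 : ξ 3 ^ 3 = 1 := xi_pow (by norm_num)
  have hω1 : ξ 3 ≠ 1 := fun h => one_sub_xi_three_ne (by rw [h, sub_self])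
  have hθ := theta_mem
  rw [steinberg_iff (by norm_num) (by norm_num) invariant_eis_twist]
  intro σ d v b h1 hprod hb hv hne
  have hbΛ := hb
  obtain ⟨hb0, hb1, hbt⟩ := hb
  simp only [AddMonoidHom.coe_mulLeft, one_mul] at hbt
  rw [Fin.prod_univ_two] at hprod
  obtain ⟨ε, hε, hd⟩ := exists_cube_root_ratio (h1 0) hprod
  have hdR : ∀ i, d i ∈ adjoinZ (ξ 6) := fun i => root_mem (by norm_num) (h1 i)
  have hεR : ε ∈ adjoinZ (ξ 6) := hR ▸ root_mem (by norm_num) hε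
  have single : ∀ i, v i ∈ adjoinZ (ξ 3) →
      OnMirror 6 2 (twistLattice 6 (1 - ξ 3) (AddMonoidHom.mulLeft 1)) v := fun i h =>
    onMirror_twist_single hθ (one_mem _) i (η := ξ 3) (by norm_num [hω3]) hω1 ⟨v i, hR ▸ h, rfl⟩
  have pair_neg : ∀ ζ : ℂ, ζ ^ 3 = 1 → v 0 - -ζ * v 1 ∈ adjoinZ (ξ 3) →
      OnMirror 6 2 (twistLattice 6 (1 - ξ 3) (AddMonoidHom.mulLeft 1)) v := by
    intro ζ hζ h
    rw [← hR] at h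
    refine onMirror_twist_pair (by norm_num) (by rw [Even.neg_pow ⟨3, rfl⟩]
                                                 exact pow_six_of_pow_three hζ) h ?_
    have : (-ζ)⁻¹ + 1 = -(ζ⁻¹ - 1) := by rw [inv_neg]; ring
    rw [this, mul_comm]
    exact mul_mem_multiples h (neg_mem (sub_one_mem_theta (by rw [inv_pow, hζ, inv_one])))
  have pair_pos : ∀ ζ : ℂ, ζ ^ 3 = 1 → v 0 - ζ * v 1 ∈ multiples 6 (1 - ξ 3) →
      OnMirror 6 2 (twistLattice 6 (1 - ξ 3) (AddMonoidHom.mulLeft 1)) v := by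
    intro ζ hζ h
    have hζ' : ζ⁻¹ ^ 6 = 1 := by rw [inv_pow, pow_six_of_pow_three hζ, inv_one]
    exact onMirror_twist_pair (by norm_num) (pow_six_of_pow_three hζ) (mem_of_mem_multiples hθ h)
      (mul_mem_multiples (add_mem (root_mem (by norm_num) hζ') (one_mem _)) h)
  have unit_sub_three : ∀ ζ : ℂ, ζ ^ 6 = 1 → ∀ w : ℂ, w ∈ adjoinZ (ξ 3) →
      v 0 - ζ * v 1 = (1 - ξ 3) * w →
      OnMirror 6 2 (twistLattice 6 (1 - ξ 3) (AddMonoidHom.mulLeft 1)) v := by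
    intro ζ hζ w hw h
    rcases pow_six_cases hζ with h' | h'
    · exact pair_pos ζ h' ⟨w, hR ▸ hw, h⟩
    · refine pair_neg (-ζ) h' ?_
      rw [neg_neg, h]
      exact mul_mem (sub_mem (one_mem _) (xi_mem 3)) hw
  -- points with coordinates in `(1 - ω)⁻¹ ℤ[ω]`: the numerators are compared modulo `3`
  have small : (1 - ξ 3) * v 0 ∈ adjoinZ (ξ 3) → (1 - ξ 3) * v 1 ∈ adjoinZ (ξ 3) →
      OnMirror 6 2 (twistLattice 6 (1 - ξ 3) (AddMonoidHom.mulLeft 1)) v := by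
    intro h0 h1
    rcases eis_mod_three h0 with ⟨w, hw, h⟩ | ⟨ζ₁, hζ₁, w, hw, h⟩
    · exact single 0 (mul_left_cancel₀ one_sub_xi_three_ne h ▸ hw)
    rcases eis_mod_three h1 with ⟨u, hu, h'⟩ | ⟨ζ₂, hζ₂, u, hu, h'⟩
    · exact single 1 (mul_left_cancel₀ one_sub_xi_three_ne h' ▸ hu)
    have hζ : (ζ₁ * ζ₂⁻¹) ^ 6 = 1 := by rw [mul_pow, inv_pow, hζ₁, hζ₂]; norm_num
    have h2 := mul_inv_cancel₀ (ne_zero_of_pow (r := 6) (by norm_num) hζ₂)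
    have hζR : ζ₁ * ζ₂⁻¹ ∈ adjoinZ (ξ 3) := hR ▸ root_mem (by norm_num) hζ
    refine unit_sub_three _ hζ ((1 + ξ 3) * (w - ζ₁ * ζ₂⁻¹ * u))
      (mul_mem (add_mem (one_mem _) (xi_mem 3)) (sub_mem hw (mul_mem hζR hu))) ?_
    apply mul_left_cancel₀ one_sub_xi_three_ne
    linear_combination h - ζ₁ * ζ₂⁻¹ * h' - ζ₁ * h2 -
      (w - ζ₁ * ζ₂⁻¹ * u) * ((1 + ξ 3) * one_sub_xi_three_sq - 3 * xi_three_sq)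
  rcases perm_fin_two σ with rfl | rfl
  · simp only [Equiv.Perm.coe_one, id_eq] at hv
    have e : ∀ i, (1 - d i) * v i = b i := fun i => by linear_combination hv i
    have hbR : ∀ i, (1 - d i) * v i ∈ adjoinZ (ξ 3) := by
      intro i
      rw [e, ← hR]
      fin_cases i
      · exact hb0
      · exact hb1
    by_cases hd0 : d 0 = 1
    · refine onMirror_of_unique (i := 1) (by rw [Fin.prod_univ_two]; exact hprod) hbΛ hv ?_ ?_
      · intro hd1
        rcases hne with h | ⟨i, hi⟩
        · exact h rfl
        · fin_cases i
          · exact hi hd0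
          · exact hi hd1
      · intro j hj
        fin_cases j
        · exact hd0
        · exact absurd rfl hj
    by_cases hd1 : d 1 = 1
    · refine onMirror_of_unique (i := 0) (by rw [Fin.prod_univ_two]; exact hprod) hbΛ hv hd0 ?_
      intro j hj
      fin_cases j
      · exact absurd rfl hj
      · exact hd1
    have hcube : d 1 ^ 3 = d 0 ^ 3 := by rw [hd, mul_pow, hε, mul_one]
    rcases eis_cases (h1 0) hd0 (hbR 0) with ⟨hc, h⟩ | ⟨hc, h⟩ | h
    · rcases eis_cases (h1 1) hd1 (hbR 1) with ⟨hc', h'⟩ | ⟨hc', h'⟩ | h'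
      · exact small h h'
      · rw [hc, hc'] at hcube
        norm_num at hcube
      · exact single 1 h'
    · rcases eis_cases (h1 1) hd1 (hbR 1) with ⟨hc', h'⟩ | ⟨hc', h'⟩ | h'
      · rw [hc, hc'] at hcube
        norm_num at hcube
      · rcases eis_pair_two h (y := -v 1) (by rw [mul_neg]; exact neg_mem h') with
          h0 | h0 | ⟨ζ, hζ, h0⟩
        · exact single 0 h0
        · exact single 1 (by rw [← neg_neg (v 1)]; exact neg_mem h0)
        · refine pair_neg ζ hζ ?_
          convert h0 using 1
          ring
      · exact single 1 h'
    · exact single 0 h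
  · have e0 : v 0 - d 0 * v 1 = b 0 := by
      have := hv 0
      simp at this
      linear_combination this
    have e1 : v 1 - d 1 * v 0 = b 1 := by
      have := hv 1
      simp at this
      linear_combination this
    rcases pow_six_cases (h1 0) with h | h
    · have hprod3 : (d 0 * d 1) ^ 3 = 1 := hprod
      have f : (1 - d 0 * d 1) * v 1 = d 1 * b 0 + b 1 := by linear_combination e1 + d 1 * e0
      have hd1 : d 1 ^ 3 = 1 := by rw [hd, mul_pow, h, hε, one_mul]
      by_cases hdd : d 0 * d 1 = 1
      · -- here `b₁ = -d₁ b₀ ≡ -b₀`, and also `b₁ ≡ b₀`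
        rw [hdd, sub_self, zero_mul] at f
        refine pair_pos (d 0) h ?_
        rw [e0]
        have t1 := mul_mem_multiples hb0 (sub_one_mem_theta hd1)
        have t2 : (3 : ℂ) * b 0 ∈ multiples 6 (1 - ξ 3) :=
          ⟨(2 + ξ 3) * b 0, mul_mem (by
            rw [hR]
            exact mem_eis_iff.2 ⟨2, 1, by push_cast; ring⟩) hb0, by
              linear_combination (-b 0) * one_sub_xi_three_mul⟩
        convert add_mem (add_mem hbt t1) t2 using 1
        linear_combination f
      · have hdv : (1 - d 0 * d 1) * v 1 ∈ adjoinZ (ξ 3) := by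
          rw [f, ← hR]
          exact add_mem (mul_mem (hdR 1) hb0) hb1
        rcases eis_cases (pow_six_of_pow_three hprod3) hdd hdv with ⟨-, h'⟩ | ⟨h', -⟩ | h'
        · refine small ?_ h'
          have : (1 - ξ 3) * v 0 = d 0 * ((1 - ξ 3) * v 1) + (1 - ξ 3) * b 0 := by
            linear_combination (1 - ξ 3) * e0
          rw [this, ← hR]
          exact add_mem (mul_mem (hdR 0) (hR ▸ h')) (mul_mem hθ hb0)
        · rw [h'] at hprod3
          norm_num at hprod3
        · exact single 1 h'
    · refine pair_neg (-d 0) h ?_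
      rw [neg_neg, e0, ← hR]
      exact hb0

/-! ### The lattices of the named groups -/

theorem smul_mem_ringSpan_of_mem {n : ℕ} {R : Subalgebra ℤ ℂ} {S : Set (Cn n)} {a : ℂ} {v : Cn n}
    (ha : a ∈ R) (hv : v ∈ S) : a • v ∈ ringSpan R S :=
  Submodule.subset_span ⟨a, ha, v, hv, rfl⟩

theorem subset_ringSpan {n : ℕ} {R : Subalgebra ℤ ℂ} {S : Set (Cn n)} {v : Cn n}
    (hv : v ∈ S) : v ∈ ringSpan R S := by
  simpa using smul_mem_ringSpan_of_mem (one_mem R) hv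

theorem ringSpan_le {n : ℕ} {R : Subalgebra ℤ ℂ} {S : Set (Cn n)} {T : Submodule ℤ (Cn n)}
    (h : ∀ a ∈ R, ∀ v ∈ S, a • v ∈ T) : ringSpan R S ≤ T := by
  refine Submodule.span_le.2 ?_
  rintro _ ⟨a, ha, v, hv, rfl⟩
  exact h a ha v hv

theorem smul_mem_ringSpan {n : ℕ} {R : Subalgebra ℤ ℂ} {S : Set (Cn n)} {a : ℂ} {v : Cn n}
    (ha : a ∈ R) (hv : v ∈ ringSpan R S) : a • v ∈ ringSpan R S := by
  induction hv using Submodule.span_induction with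
  | mem x hx =>
    obtain ⟨b, hb, w, hw, rfl⟩ := hx
    rw [smul_smul]
    exact smul_mem_ringSpan_of_mem (mul_mem ha hb) hw
  | zero => simp
  | add x y _ _ hx hy =>
    rw [smul_add]
    exact add_mem hx hy
  | smul m x _ hx =>
    rw [smul_comm]
    exact Submodule.smul_mem _ m hx

theorem smul_mem_ringSpan_image {n : ℕ} {R : Subalgebra ℤ ℂ} {S : Set (Cn n)} (c : ℂ) {v : Cn n}
    (hv : v ∈ ringSpan R S) : c • v ∈ ringSpan R ((fun w => c • w) '' S) := by
  induction hv using Submodule.span_induction with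
  | mem x hx =>
    obtain ⟨b, hb, w, hw, rfl⟩ := hx
    rw [smul_comm]
    exact smul_mem_ringSpan_of_mem hb ⟨w, hw, rfl⟩
  | zero => simp
  | add x y _ _ hx hy =>
    rw [smul_add]
    exact add_mem hx hy
  | smul m x _ hx =>
    rw [smul_comm]
    exact Submodule.smul_mem _ m hx

theorem smul_mem_ringSpan_image_iff {n : ℕ} {R : Subalgebra ℤ ℂ} {S : Set (Cn n)} {c : ℂ}
    (hc : c ≠ 0) {v : Cn n} :
    v ∈ ringSpan R S ↔ c • v ∈ ringSpan R ((fun w => c • w) '' S) := by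
  refine ⟨smul_mem_ringSpan_image c, fun h => ?_⟩
  have := smul_mem_ringSpan_image c⁻¹ h
  rw [Set.image_image] at this
  simpa [smul_smul, hc] using this

theorem e_apply {n : ℕ} (k : ℕ) (i : Fin n) : e n k i = if (i : ℕ) + 1 = k then 1 else 0 := rfl

theorem e_succ {n : ℕ} (i : Fin n) : e n ((i : ℕ) + 1) = EuclideanSpace.single i 1 := by
  ext j
  rw [e_apply]
  rcases eq_or_ne j i with rfl | h
  · simp
  · have : (j : ℕ) ≠ i := fun h' => h (Fin.ext h')
    simp [h, this]

theorem sum_e {n k : ℕ} (h1 : 1 ≤ k) (hk : k ≤ n) : ∑ i, e n k i = 1 := by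
  obtain ⟨i, rfl⟩ : ∃ i : Fin n, k = (i : ℕ) + 1 := ⟨⟨k - 1, by omega⟩, by simp; omega⟩
  rw [e_succ]
  simp

theorem e_mem {n : ℕ} (r k : ℕ) (i : Fin n) : e n k i ∈ adjoinZ (ξ r) := by
  rw [e_apply]
  split_ifs
  · exact one_mem _
  · exact zero_mem _

/-- Telescoping: the span of the differences `e_{j-1} - e_j` contains all `e_1 - e_k`. -/
theorem smul_e_one_sub_mem {n : ℕ} {R : Subalgebra ℤ ℂ} {S : Set (Cn n)} (hS : diffs n 1 ⊆ S)
    {a : ℂ} (ha : a ∈ R) (k : ℕ) (hk : k + 1 ≤ n) :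
    a • (e n 1 - e n (k + 1)) ∈ ringSpan R S := by
  induction k with
  | zero => simp
  | succ k ih =>
    have h1 : e n (k + 1) - e n (k + 1 + 1) ∈ S :=
      hS ⟨k + 1 + 1, by omega, hk, by simp⟩
    have := add_mem (ih (by omega)) (smul_mem_ringSpan_of_mem ha h1)
    rw [← smul_add] at this
    convert this using 2
    abel

theorem eq_sum_e {n : ℕ} (x : Cn n) :
    x = (∑ i, x i) • e n 1 - ∑ i, x i • (e n 1 - e n ((i : ℕ) + 1)) := by
  simp only [smul_sub, Finset.sum_sub_distrib, Finset.sum_smul, sub_sub_cancel]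
  ext j
  simp [e_succ, Pi.single_apply]

theorem smul_mem_sumLattice {r n : ℕ} {δ a : ℂ} {x : Cn n} (ha : a ∈ adjoinZ (ξ r))
    (hx : x ∈ sumLattice r n δ) : a • x ∈ sumLattice r n δ := by
  refine ⟨fun i => mul_mem ha (hx.1 i), ?_⟩
  have := mul_mem_multiples ha hx.2
  rw [Finset.mul_sum] at this
  exact this

theorem ringSpan_eq_sumLattice {r n : ℕ} {δ : ℂ} {S : Set (Cn n)} (h1 : S ⊆ sumLattice r n δ)
    (h2 : diffs n 1 ⊆ S) (h3 : δ • e n 1 ∈ ringSpan (adjoinZ (ξ r)) S) :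
    ringSpan (adjoinZ (ξ r)) S = sumLattice r n δ := by
  refine le_antisymm (ringSpan_le fun a ha v hv => smul_mem_sumLattice ha (h1 hv)) ?_
  rintro x ⟨hx, a, ha, hxa⟩
  rw [eq_sum_e x]
  refine sub_mem ?_ (sum_mem fun i _ => smul_e_one_sub_mem h2 (hx i) i (by omega))
  rw [hxa, mul_comm, mul_smul]
  exact smul_mem_ringSpan ha h3

theorem diffs_subset_sumLattice (r n : ℕ) (δ : ℂ) : diffs n 1 ⊆ sumLattice r n δ := by
  rintro _ ⟨j, h2, hj, rfl⟩
  rw [one_smul]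
  refine ⟨fun i => sub_mem (e_mem r _ i) (e_mem r _ i), ?_⟩
  have : ∑ i, (e n (j - 1) - e n j) i = 0 := by
    simp only [PiLp.sub_apply, Finset.sum_sub_distrib]
    rw [sum_e (by omega) (by omega), sum_e (by omega) hj, sub_self]
  rw [this]
  exact zero_mem _

theorem smul_e_mem_sumLattice {r n k : ℕ} {δ a : ℂ} (hδ : δ ∈ adjoinZ (ξ r)) (h1 : 1 ≤ k)
    (hk : k ≤ n) (ha : a ∈ multiples r δ) : a • e n k ∈ sumLattice r n δ := by
  refine ⟨fun i => mul_mem (mem_of_mem_multiples hδ ha) (e_mem r k i), ?_⟩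
  have : ∑ i, (a • e n k) i = a := by
    simp only [PiLp.smul_apply, ← Finset.smul_sum]
    rw [sum_e h1 hk, smul_eq_mul, mul_one]
  rw [this]
  exact ha

theorem Gr1n_1_eq (r : ℕ) {n : ℕ} (hn : 1 ≤ n) :
    Gr1n_1 r n = semidirect (G r 1 n) (sumLattice r n 1) := by
  rw [Gr1n_1, ringSpan_eq_sumLattice]
  · refine Set.union_subset ?_ (diffs_subset_sumLattice r n 1)
    rintro _ rfl
    rw [← one_smul ℂ (e n 1)]
    exact smul_e_mem_sumLattice (one_mem _) le_rfl hn (mem_multiples_one.2 (one_mem _))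
  · exact Set.subset_union_right
  · rw [one_smul]
    exact subset_ringSpan (Or.inl rfl)

theorem Gr1n_2_equivalent {r n : ℕ} (hξ : 1 - ξ r ≠ 0) (hn : 1 ≤ n) :
    Equivalent (semidirect (G r 1 n) (sumLattice r n (1 - ξ r))) (Gr1n_2 r n) := by
  refine equivalent_of_smul _ (inv_ne_zero hξ) fun v => ?_
  have hδ : 1 - ξ r ∈ adjoinZ (ξ r) := sub_mem (one_mem _) (xi_mem r)
  rw [← ringSpan_eq_sumLattice (S := {(1 - ξ r) • e n 1} ∪ diffs n 1),
    smul_mem_ringSpan_image_iff (inv_ne_zero hξ)]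
  · rw [Set.image_union, Set.image_singleton, smul_smul, inv_mul_cancel₀ hξ, one_smul]
    have : (fun w => (1 - ξ r)⁻¹ • w) '' diffs n 1 = diffs n (1 / (1 - ξ r)) := by
      ext w
      constructor
      · rintro ⟨_, ⟨j, h2, hj, rfl⟩, rfl⟩
        exact ⟨j, h2, hj, by simp⟩
      · rintro ⟨j, h2, hj, rfl⟩
        exact ⟨_, ⟨j, h2, hj, rfl⟩, by simp⟩
    rw [this]
  · refine Set.union_subset ?_ (diffs_subset_sumLattice r n _)
    rintro _ rfl
    exact smul_e_mem_sumLattice hδ le_rfl hn ⟨1, one_mem _, by simp⟩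
  · exact Set.subset_union_right
  · exact subset_ringSpan (Or.inl rfl)

/-- The lattice of `[G(r,p,n)]_1` contains `(1 - ξ) e_1 = (e_1 - e_2) - (ξ e_1 - e_2)`. -/
theorem one_sub_xi_smul_mem {r n : ℕ} (hn : 2 ≤ n) {S : Set (Cn n)}
    (hS : {ξ r • e n 1 - e n 2} ∪ diffs n 1 ⊆ S) :
    (1 - ξ r) • e n 1 ∈ ringSpan (adjoinZ (ξ r)) S := by
  have h1 : e n 1 - e n 2 ∈ S := hS (Or.inr ⟨2, le_rfl, hn, by simp⟩)
  have h2 : ξ r • e n 1 - e n 2 ∈ S := hS (Or.inl rfl)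
  convert sub_mem (subset_ringSpan h1) (subset_ringSpan h2) using 1
  rw [sub_smul, one_smul]
  abel

theorem xi_smul_sub_mem {r n : ℕ} (hn : 2 ≤ n) :
    ξ r • e n 1 - e n 2 ∈ sumLattice r n (1 - ξ r) := by
  refine ⟨fun i => sub_mem (mul_mem (xi_mem r) (e_mem r 1 i)) (e_mem r 2 i), ?_⟩
  have : ∑ i, (ξ r • e n 1 - e n 2) i = ξ r - 1 := by
    simp only [PiLp.sub_apply, PiLp.smul_apply, Finset.sum_sub_distrib, ← Finset.smul_sum]
    rw [sum_e le_rfl (by omega), sum_e (by omega) hn, smul_eq_mul, mul_one]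
  rw [this]
  exact ⟨-1, neg_mem (one_mem _), by ring⟩

theorem Grpn_1_eq (r p : ℕ) {n : ℕ} (hn : 2 ≤ n) :
    Grpn_1 r p n = semidirect (G r p n) (sumLattice r n (1 - ξ r)) := by
  rw [Grpn_1, ringSpan_eq_sumLattice]
  · refine Set.union_subset ?_ (diffs_subset_sumLattice r n _)
    rintro _ rfl
    exact xi_smul_sub_mem hn
  · exact Set.subset_union_right
  · exact one_sub_xi_smul_mem hn subset_rfl

/-- For `r = 6` the number `1 - ξ` is a unit. -/
theorem sumLattice_six (n : ℕ) : sumLattice 6 n (1 - ξ 6) = sumLattice 6 n 1 := by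
  ext x
  rw [mem_sumLattice_one]
  refine ⟨fun h => h.1, fun h => ⟨h, (1 + ξ 3) * ∑ i, x i, mul_mem ?_ (sum_mem fun i _ => h i), ?_⟩⟩
  · rw [← xi_six_eq]
    exact xi_mem 6
  · rw [xi_six_eq]
    linear_combination (∑ i, x i) * xi_three_sq

theorem G42n_2_eq {n : ℕ} (hn : 2 ≤ n) :
    G42n_2 n = semidirect (G 4 2 n) (sumLattice 4 n 1) := by
  rw [G42n_2, ringSpan_eq_sumLattice]
  · refine Set.union_subset (Set.union_subset ?_ (diffs_subset_sumLattice 4 n 1)) ?_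
    · rintro _ rfl
      exact mem_sumLattice_one.2 (xi_smul_sub_mem hn).1
    · rintro _ rfl
      rw [← one_smul ℂ (e n n)]
      exact smul_e_mem_sumLattice (one_mem _) (by omega) le_rfl (mem_multiples_one.2 (one_mem _))
  · exact fun v hv => Or.inl (Or.inr hv)
  · obtain ⟨m, rfl⟩ : ∃ m, n = m + 1 := ⟨n - 1, by omega⟩
    have h1 := smul_e_one_sub_mem (R := adjoinZ (ξ 4)) (n := m + 1)
      (S := {ξ 4 • e (m + 1) 1 - e (m + 1) 2} ∪ diffs (m + 1) 1 ∪ {e (m + 1) (m + 1)})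
      (fun v hv => Or.inl (Or.inr hv)) (one_mem _) m le_rfl
    have h2 : e (m + 1) (m + 1) ∈ ringSpan (adjoinZ (ξ 4))
      ({ξ 4 • e (m + 1) 1 - e (m + 1) 2} ∪ diffs (m + 1) 1 ∪ {e (m + 1) (m + 1)}) :=
      subset_ringSpan (Or.inr rfl)
    convert add_mem h1 h2 using 1
    simp

theorem smul_mem_twistLattice {r : ℕ} {δ κ a : ℂ} {x : Cn 2} (ha : a ∈ adjoinZ (ξ r))
    (hx : x ∈ twistLattice r δ (AddMonoidHom.mulLeft κ)) :
    a • x ∈ twistLattice r δ (AddMonoidHom.mulLeft κ) := by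
  refine ⟨mul_mem ha hx.1, mul_mem ha hx.2.1, ?_⟩
  convert mul_mem_multiples ha hx.2.2 using 1
  simp
  ring

theorem mem_ringSpan_pair {n : ℕ} {R : Subalgebra ℤ ℂ} {g h x : Cn n} {a b : ℂ} (ha : a ∈ R)
    (hb : b ∈ R) (hx : x = a • g + b • h) : x ∈ ringSpan R {g, h} := by
  rw [hx]
  exact add_mem (smul_mem_ringSpan_of_mem ha (Or.inl rfl))
    (smul_mem_ringSpan_of_mem hb (Or.inr rfl))

theorem Gr22_extra_four_eq : Gr22_extra 4 2 =
    semidirect (G 4 2 2) (twistLattice 4 2 (AddMonoidHom.mulLeft Complex.I)) := by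
  have hI : Complex.I ∈ adjoinZ (ξ 4) := xi_four ▸ xi_mem 4
  have hI2 := Complex.I_sq
  rw [Gr22_extra]
  congr 1
  refine le_antisymm (ringSpan_le fun a ha v hv => smul_mem_twistLattice ha ?_) ?_
  · rcases hv with rfl | rfl
    · refine ⟨by simp [e_apply, xi_mem], by simp [e_apply], ⟨0, zero_mem _, ?_⟩⟩
      simp [e_apply, xi_four]
    · refine ⟨by simp [e_apply, xi_mem, add_mem, one_mem], ?_,
        ⟨-Complex.I, neg_mem hI, ?_⟩⟩
      · simpa [e_apply] using neg_mem (add_mem (one_mem _) (xi_mem 4))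
      · simp [e_apply, xi_four]
        linear_combination -hI2
  · rintro x ⟨hx0, hx1, a, ha, hxa⟩
    refine mem_ringSpan_pair
      (a := -Complex.I * x 0 - a * Complex.I * (1 - Complex.I)) (b := a * Complex.I)
      (sub_mem (mul_mem (neg_mem hI) hx0)
        (mul_mem (mul_mem ha hI) (sub_mem (one_mem _) hI))) (mul_mem ha hI) ?_
    simp only [AddMonoidHom.coe_mulLeft] at hxa
    ext i
    fin_cases i
    · simp [e_apply, xi_four]
      linear_combination (x 0 - a * Complex.I) * hI2
    · simp [e_apply, xi_four]
      linear_combination hxa + 2 * a * hI2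

theorem Gr22_extra_six_eq : Gr22_extra 6 2 =
    semidirect (G 6 2 2) (twistLattice 6 (1 - ξ 3) (AddMonoidHom.mulLeft 1)) := by
  have hω : ξ 3 ∈ adjoinZ (ξ 6) := adjoinZ_six ▸ xi_mem 3
  have h1 : 1 + ξ 3 ∈ adjoinZ (ξ 6) := add_mem (one_mem _) hω
  have h3 := xi_three_sq
  rw [Gr22_extra]
  congr 1
  refine le_antisymm (ringSpan_le fun a ha v hv => smul_mem_twistLattice ha ?_) ?_
  · rcases hv with rfl | rfl
    · refine ⟨by simp [e_apply, xi_mem], by simp [e_apply], ⟨-(1 + ξ 3), neg_mem h1, ?_⟩⟩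
      simp [e_apply, xi_six_eq]
      linear_combination -h3
    · refine ⟨by simp [e_apply, xi_mem, add_mem, one_mem], ?_,
        ⟨-(1 + ξ 3) - (1 + ξ 3), sub_mem (neg_mem h1) h1, ?_⟩⟩
      · simpa [e_apply] using neg_mem (add_mem (one_mem _) (xi_mem 6))
      · simp [e_apply, xi_six_eq]
        linear_combination -2 * h3
  · rintro x ⟨hx0, hx1, a, ha, hxa⟩
    refine mem_ringSpan_pair
      (a := -(1 + ξ 3) * (x 0 + x 1)) (b := (1 + ξ 3) * (x 0 + a))
      (mul_mem (neg_mem h1) (add_mem hx0 hx1)) (mul_mem h1 (add_mem hx0 ha)) ?_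
    simp only [AddMonoidHom.coe_mulLeft] at hxa
    ext i
    fin_cases i
    · simp [e_apply, xi_six_eq]
      linear_combination (x 1 - 2 * a) * h3 + ξ 3 * hxa
    · simp [e_apply, xi_six_eq]
      linear_combination (x 0 + 2 * a) * h3 - ξ 3 * hxa

/-- The map `z ↦ κ z̄`. -/
def conjMul (κ : ℂ) : ℂ →+ ℂ :=
  (AddMonoidHom.mulLeft κ).comp (starRingEnd ℂ : ℂ →+* ℂ).toAddMonoidHom

@[simp]
theorem conjMul_apply (κ z : ℂ) : conjMul κ z = κ * (starRingEnd ℂ) z := rfl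

theorem conjMul_mem {κ z : ℂ} (hκ : κ ∈ adjoinZ (ξ 3)) (hz : z ∈ adjoinZ (ξ 3)) :
    conjMul κ z ∈ adjoinZ (ξ 3) := mul_mem hκ (conj_mem_eis hz)

theorem G632_2_eq : G632_2 2 =
    semidirect (G 6 3 2) (twistLattice 6 2 (conjMul (ξ 3 ^ 2))) := by
  have hR := adjoinZ_six
  have hω : ξ 3 ∈ adjoinZ (ξ 3) := xi_mem 3
  have h3 := xi_three_sq
  have hx6 := xi_six_eq
  have hquad : ∀ {z : ℂ}, z ∈ adjoinZ (2 * ξ 6) ↔ ∃ a b : ℤ, z = a + b * (2 * ξ 6) :=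
    mem_adjoinZ_iff (s := 2) (t := -4) (by rw [hx6]; push_cast; linear_combination 4 * h3)
  rw [G632_2]
  congr 1
  refine le_antisymm (ringSpan_le fun a ha v hv => ?_) ?_
  · -- `ℤ[2ξ] = ℤ + 2ℤ[ω]`, and the lattice contains `2ℤ[ω]²`
    have hdouble : ∀ y : Cn 2, y 0 ∈ adjoinZ (ξ 3) → y 1 ∈ adjoinZ (ξ 3) →
        (2 : ℂ) • y ∈ twistLattice 6 2 (conjMul (ξ 3 ^ 2)) := by
      intro y h0 h1
      rw [mem_twistLattice, hR]
      refine ⟨by simpa [two_mul] using add_mem h0 h0, by simpa [two_mul] using add_mem h1 h1,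
        ⟨y 1 - conjMul (ξ 3 ^ 2) (y 0), hR ▸ sub_mem h1 (conjMul_mem (pow_mem hω 2) h0), ?_⟩⟩
      simp only [PiLp.smul_apply, smul_eq_mul, conjMul_apply, map_mul, map_ofNat]
      ring
    have key : v ∈ twistLattice 6 2 (conjMul (ξ 3 ^ 2)) → a • v ∈
        twistLattice 6 2 (conjMul (ξ 3 ^ 2)) := by
      intro hv
      obtain ⟨s, t, rfl⟩ := hquad.1 ha
      have h0 : v 0 ∈ adjoinZ (ξ 3) := hR ▸ hv.1
      have h1 : v 1 ∈ adjoinZ (ξ 3) := hR ▸ hv.2.1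
      have ht : (t * (1 + ξ 3) : ℂ) ∈ adjoinZ (ξ 3) := mem_eis_iff.2 ⟨t, t, by ring⟩
      have hd := hdouble ((t * (1 + ξ 3) : ℂ) • v) (mul_mem ht h0) (mul_mem ht h1)
      convert add_mem (Submodule.smul_mem _ s hv) hd using 1
      rw [hx6, add_smul, smul_smul, Int.cast_smul_eq_zsmul]
      congr 2
      ring
    refine key ?_
    rw [mem_twistLattice, hR]
    rcases hv with rfl | rfl
    · refine ⟨?_, by simp [e_apply], ⟨0, zero_mem _, ?_⟩⟩
      · simp [e_apply, hx6, add_mem, one_mem, hω]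
      · simp [e_apply, hx6, conj_xi_three, h3]
        linear_combination -h3
    · refine ⟨?_, ?_, ⟨ξ 3, hR ▸ hω, ?_⟩⟩
      · simp [e_apply, hx6, hω]
      · simp [e_apply, hx6, hω]
      · simp [e_apply, hx6, conj_xi_three, h3]
        linear_combination h3
  · rintro x ⟨hx0, hx1, w, hw, hxw⟩
    rw [hR] at hx0 hw
    obtain ⟨a, b, hab⟩ := mem_eis_iff.1 hx0
    obtain ⟨c, d, rfl⟩ := mem_eis_iff.1 hw
    refine mem_ringSpan_pair (a := (a + 2 * (b - a + d) : ℤ) + (-c : ℤ) * (2 * ξ 6))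
      (b := (a - b + 2 * (b - a + d) - 2 * c : ℤ) + (-(b - a + d) : ℤ) * (2 * ξ 6))
      (hquad.2 ⟨_, _, rfl⟩) (hquad.2 ⟨_, _, rfl⟩) ?_
    rw [conjMul_apply, hab] at hxw
    simp only [map_add, map_mul, map_intCast, conj_xi_three] at hxw
    ext i
    fin_cases i
    · simp [e_apply, hx6, hab]
      ring_nf
      simp only [h3]
      ring
    · simp [e_apply, hx6]
      rw [sub_eq_iff_eq_add.1 hxw]
      ring_nf
      simp only [show ξ 3 ^ 3 = 1 from xi_pow (by norm_num), h3]
      ring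

/-! ### Groups without the Steinberg property -/

/-- In the second alternative of `OnMirror` the order of the two coordinates does not matter. -/
theorem OnMirror.cases_lt {n r p : ℕ} (hr : r ≠ 0) {Λ : Submodule ℤ (Cn n)} {v : Cn n}
    (h : OnMirror r p Λ v) :
    (∃ (i : Fin n) (η : ℂ), η ^ (r / p) = 1 ∧ η ≠ 1 ∧ EuclideanSpace.single i ((1 - η) * v i) ∈ Λ) ∨
    (∃ (i j : Fin n) (ζ : ℂ), i < j ∧ ζ ^ r = 1 ∧
      EuclideanSpace.single i (v i - ζ * v j) -
        EuclideanSpace.single j (ζ⁻¹ * (v i - ζ * v j)) ∈ Λ) := by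
  rcases h with h | ⟨i, j, ζ, hij, hζ, h⟩
  · exact Or.inl h
  · right
    rcases hij.lt_or_gt with hlt | hlt
    · exact ⟨i, j, ζ, hlt, hζ, h⟩
    · refine ⟨j, i, ζ⁻¹, hlt, by rw [inv_pow, hζ, inv_one], ?_⟩
      have hζ0 := ne_zero_of_pow hr hζ
      convert h using 1
      ext k
      rcases eq_or_ne k i with rfl | hk
      · simp [hij]
        field_simp
        ring
      · rcases eq_or_ne k j with rfl | hk'
        · simp [hk]
          field_simp
          ring
        · simp [hk, hk']

theorem xi_three_im_ne : (ξ 3).im ≠ 0 := by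
  intro h
  have hc := Complex.conj_eq_iff_im.2 h
  rw [conj_xi_three] at hc
  have h1 : ξ 3 = -1 / 2 := by linear_combination -hc / 2
  have h2 := xi_three_sq
  rw [h1] at h2
  norm_num at h2

theorem eis_inj {a b c d : ℤ} (h : (a + b * ξ 3 : ℂ) = c + d * ξ 3) : a = c ∧ b = d := by
  have him := congrArg Complex.im h
  simp at him
  have hb : b = d := by
    rcases him with h' | h'
    · exact h'
    · exact absurd h' xi_three_im_ne
  subst hb
  have : (a : ℂ) = c := by linear_combination h
  exact ⟨by exact_mod_cast this, rfl⟩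

theorem even_of_half_mem {z : ℂ} (hz : z ∈ adjoinZ (ξ 3)) {a b : ℤ} (h : (a + b * ξ 3 : ℂ) = 2 * z) :
    2 ∣ a ∧ 2 ∣ b := by
  obtain ⟨c, d, rfl⟩ := mem_eis_iff.1 hz
  obtain ⟨h1, h2⟩ := eis_inj (a := a) (b := b) (c := 2 * c) (d := 2 * d) (by
    rw [h]
    push_cast
    ring)
  exact ⟨⟨c, h1⟩, ⟨d, h2⟩⟩

theorem invariant_conj_twist :
    IsInvariant (G 6 3 2) (twistLattice 6 2 (conjMul (ξ 3 ^ 2))) := by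
  have hR := adjoinZ_six
  have hω2 : ξ 3 ^ 2 ∈ adjoinZ (ξ 3) := pow_mem (xi_mem 3) 2
  have hconj2 : (starRingEnd ℂ) (ξ 3 ^ 2) * ξ 3 ^ 2 = 1 := by
    rw [map_pow, conj_xi_three, ← xi_three_sq, ← pow_mul, ← pow_add]
    have : ξ 3 ^ 3 = 1 := xi_pow (by norm_num)
    rw [show 2 * 2 + 2 = 3 * 2 by norm_num, pow_mul, this, one_pow]
  refine twistLattice_isInvariant (by norm_num) ?_ ?_
  · rintro _ ⟨a, ha, rfl⟩
    exact ⟨_, hR ▸ conjMul_mem hω2 (hR ▸ ha), by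
      simp only [conjMul_apply, map_mul, map_ofNat]
      ring⟩
  · intro c d x hc hd hcd hx
    have hcc : c * (starRingEnd ℂ) c = 1 := by
      rw [Complex.mul_conj, Complex.normSq_eq_norm_sq, norm_of_pow (by norm_num) hc]
      norm_num
    have hcR : (starRingEnd ℂ) c ∈ adjoinZ (ξ 6) := by
      rw [hR]
      exact conj_mem_eis (hR ▸ root_mem (by norm_num) hc)
    have hfx : conjMul (ξ 3 ^ 2) x ∈ adjoinZ (ξ 6) := hR ▸ conjMul_mem hω2 (hR ▸ hx)
    have hcd' : (c * d - 1) * (c * d + 1) = 0 := by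
      have : (c * d) ^ 2 = 1 := hcd
      linear_combination this
    have hff : (ξ 3 ^ 2) * (starRingEnd ℂ) (conjMul (ξ 3 ^ 2) x) = x := by
      rw [conjMul_apply, map_mul, Complex.conj_conj]
      linear_combination x * hconj2
    have e1 : conjMul (ξ 3 ^ 2) (c * x) = (starRingEnd ℂ) c * conjMul (ξ 3 ^ 2) x := by
      simp
      ring
    have e2 : conjMul (ξ 3 ^ 2) (c * conjMul (ξ 3 ^ 2) x) = (starRingEnd ℂ) c * x := by
      rw [conjMul_apply, map_mul]
      linear_combination (starRingEnd ℂ) c * hff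
    rw [e1, e2]
    rcases mul_eq_zero.1 hcd' with h | h
    · have : d = (starRingEnd ℂ) c := by
        linear_combination (starRingEnd ℂ) c * h - d * hcc
      rw [this]
      exact ⟨⟨0, zero_mem _, by ring⟩, ⟨0, zero_mem _, by ring⟩⟩
    · have : d = -(starRingEnd ℂ) c := by
        linear_combination (starRingEnd ℂ) c * h - d * hcc
      rw [this]
      exact ⟨⟨_, mul_mem (neg_mem hcR) hfx, by ring⟩, ⟨_, mul_mem (neg_mem hcR) hx, by ring⟩⟩

/-- The point `ω (√-3, 1) / 2` is fixed by an element of order four of `[G(6,3,2)]_2`, but lies on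
no mirror. -/
theorem not_steinberg_G632_2 : ¬ SteinbergProperty (G632_2 2) := by
  have hR := adjoinZ_six
  have h3 := xi_three_sq
  have hc2 : (starRingEnd ℂ) 2 = 2 := map_ofNat _ 2
  rw [G632_2_eq, steinberg_iff (by norm_num) (by norm_num) invariant_conj_twist]
  intro h
  have hv := h (Equiv.swap 0 1) ![1, -1] !₂[(-2 - ξ 3) / 2, ξ 3 / 2] !₂[-1 - ξ 3, -1]
    (by intro i; fin_cases i <;> norm_num) (by norm_num [Fin.prod_univ_two]) (by
      rw [mem_twistLattice, hR]
      refine ⟨mem_eis_iff.2 ⟨-1, -1, by simp; ring⟩, by simp, ⟨-1, neg_mem (one_mem _), ?_⟩⟩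
      simp [conj_xi_three]
      linear_combination (-ξ 3 + 1) * h3) (by
      intro i
      fin_cases i
      · simp
        ring
      · simp
        ring) (Or.inl (by decide))
  rcases hv.cases_lt (by norm_num) with ⟨i, η, hη, hη1, hmem⟩ | ⟨i, j, ζ, hij, hζ, hmem⟩
  · have hη' : η = -1 := by
      have : (η - 1) * (η + 1) = 0 := by
        have : η ^ 2 = 1 := hη
        linear_combination this
      rcases mul_eq_zero.1 this with h' | h'
      · exact absurd (sub_eq_zero.1 h') hη1
      · exact eq_neg_of_add_eq_zero_left h'
    subst hη'
    obtain ⟨-, -, w, hw, hwe⟩ := hmem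
    fin_cases i
    · have := even_of_half_mem (a := -2) (b := -1) (hR ▸ hw) (by
        rw [← hwe]
        simp [conj_xi_three, hc2]
        ring_nf
        simp only [h3, show ξ 3 ^ 3 = 1 from xi_pow (by norm_num)]
        ring)
      omega
    · have := even_of_half_mem (a := 0) (b := 1) (hR ▸ hw) (by
        rw [← hwe]
        simp
        ring)
      omega
  · obtain ⟨rfl, rfl⟩ : i = 0 ∧ j = 1 := by
      fin_cases i <;> fin_cases j <;> simp_all
    obtain ⟨hm0, -, w, hw, hwe⟩ := hmem
    rw [hR] at hm0 hw
    simp at hm0 hwe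
    -- `v₀ - ζ v₁` is integral for `ζ = ± 1` only
    rcases pow_six_cases hζ with h' | h' <;> rcases pow_three_cases h' with h' | h' | h'
    · subst h'
      have := even_of_half_mem (a := 0) (b := 1) hw (by
        rw [← hwe]
        simp [conj_xi_three, hc2]
        ring_nf
        simp only [show ξ 3 ^ 3 = 1 from xi_pow (by norm_num)]
        ring)
      omega
    · subst h'
      have := even_of_half_mem (a := -1) (b := 0) hm0 (by
        push_cast
        linear_combination h3)
      omega
    · subst h'
      have := even_of_half_mem (a := -3) (b := -1) hm0 (by
        push_cast
        linear_combination (ξ 3 - 1) * h3)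
      omega
    · obtain rfl : ζ = -1 := by linear_combination -h'
      have := even_of_half_mem (a := -2) (b := -1) hw (by
        rw [← hwe]
        simp [conj_xi_three, hc2]
        ring_nf
        simp only [h3]
        ring)
      omega
    · obtain rfl : ζ = -ξ 3 := by linear_combination -h'
      have := even_of_half_mem (a := -3) (b := -2) hm0 (by
        push_cast
        linear_combination -h3)
      omega
    · obtain rfl : ζ = -ξ 3 ^ 2 := by linear_combination -h'
      have := even_of_half_mem (a := -1) (b := -1) hm0 (by
        push_cast
        linear_combination (1 - ξ 3) * h3)
      omega

/-- If `x` and `y` are short and of different lengths, `x - ζ y` is too short to be integral. -/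
theorem sub_not_mem_of_short {r : ℕ} (hr : r = 3 ∨ r = 4 ∨ r = 6) {x y ζ : ℂ} (hζ : ζ ^ r = 1)
    (hne : ‖x‖ ≠ ‖y‖) (hlt : ‖x‖ + ‖y‖ < 1) : x - ζ * y ∉ adjoinZ (ξ r) := by
  have hζ1 : ‖ζ‖ = 1 := norm_of_pow (by omega) hζ
  have hn : ‖ζ * y‖ = ‖y‖ := by rw [norm_mul, hζ1, one_mul]
  refine not_mem_of_norm_lt hr (fun h => hne ?_) ((norm_sub_le _ _).trans_lt (by rwa [hn]))
  rw [sub_eq_zero.1 h, hn]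

/-- Distinct small positive numbers, for the coordinates of a point that are to be generic. -/
def tail (k : ℕ) : ℂ := ((1 / (k + 10) : ℝ) : ℂ)

theorem norm_tail (k : ℕ) : ‖tail k‖ = 1 / (k + 10) := by
  rw [tail, Complex.norm_real, Real.norm_of_nonneg (by positivity)]

theorem norm_tail_pos (k : ℕ) : 0 < ‖tail k‖ := by
  rw [norm_tail]
  positivity

theorem norm_tail_le (k : ℕ) : ‖tail k‖ ≤ 1 / 10 := by
  rw [norm_tail]
  apply one_div_le_one_div_of_le (by norm_num)
  have : (0 : ℝ) ≤ k := by positivity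
  linarith

theorem norm_tail_ne {k l : ℕ} (h : k ≠ l) : ‖tail k‖ ≠ ‖tail l‖ := by
  rw [norm_tail, norm_tail]
  intro h'
  rw [div_eq_div_iff (by positivity) (by positivity)] at h'
  apply h
  have : (k : ℝ) = l := by linarith
  exact_mod_cast this

theorem normSq_theta : Complex.normSq (1 - ξ 3) = 3 := by
  apply Complex.ofReal_injective
  rw [← Complex.mul_conj, map_sub, map_one, conj_xi_three]
  push_cast
  linear_combination one_sub_xi_three_mul

theorem norm_theta : ‖1 - ξ 3‖ = √3 := by
  rw [← normSq_theta, Complex.normSq_eq_norm_sq, Real.sqrt_sq (norm_nonneg _)]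

theorem norm_theta_inv_lt : ‖(1 - ξ 3)⁻¹‖ < 3 / 5 := by
  rw [norm_inv, norm_theta, inv_lt_comm₀ (by positivity) (by norm_num)]
  exact Real.lt_sqrt_of_sq_lt (by norm_num)

theorem lt_norm_theta_inv : 1 / 2 < ‖(1 - ξ 3)⁻¹‖ := by
  rw [norm_inv, norm_theta, lt_inv_comm₀ (by norm_num) (by positivity)]
  rw [Real.sqrt_lt' (by norm_num)]
  norm_num

/-- `(1 + ζ) / (1 - ω)` is not integral, as `1 + ζ ≡ 2` modulo `1 - ω`. -/
theorem theta_inv_add_not_mem {ζ : ℂ} (hζ : ζ ^ 3 = 1) :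
    (1 - ξ 3)⁻¹ - ζ * -(1 - ξ 3)⁻¹ ∉ adjoinZ (ξ 3) := by
  intro h
  obtain ⟨a, ha, hae⟩ := isUnipotentMod_one_sub_xi (r := 3) (by norm_num) ζ hζ
  have hθ := mul_inv_cancel₀ one_sub_xi_three_ne
  obtain ⟨m, hm⟩ := exists_normSq_eq (Or.inl rfl) (sub_mem h ha)
  have h2 : (1 - ξ 3) * ((1 - ξ 3)⁻¹ - ζ * -(1 - ξ 3)⁻¹ - a) = 2 := by
    linear_combination (1 + ζ) * hθ + hae
  have h4 := congrArg Complex.normSq h2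
  rw [Complex.normSq_mul, normSq_theta, hm] at h4
  have : Complex.normSq 2 = (4 : ℤ) := by
    rw [Complex.normSq_ofNat]
    norm_num
  rw [this] at h4
  have h5 : 3 * m = 4 := by exact_mod_cast h4
  omega

/-- The point `(1/θ, -1/θ, …)`, `θ = 1 - ω`, is fixed by an element of `[G(3,1,n)]_2` whose linear
part is `diag(ω, ω, 1, …, 1)`, but lies on no mirror. -/
theorem not_steinberg_sumLattice_three {n : ℕ} (hn : 2 ≤ n) :
    ¬ SteinbergProperty (semidirect (G 3 1 n) (sumLattice 3 n (1 - ξ 3))) := by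
  obtain ⟨m, rfl⟩ : ∃ m, n = m + 2 := ⟨n - 2, by omega⟩
  have hω3 : ξ 3 ^ 3 = 1 := xi_pow (by norm_num)
  have hω1 : ξ 3 ≠ 1 := fun h => one_sub_xi_three_ne (by rw [h, sub_self])
  have hθ := mul_inv_cancel₀ one_sub_xi_three_ne
  rw [steinberg_iff (by norm_num) (by norm_num)
    (sumLattice_isInvariant (by norm_num) 1 (isUnipotentMod_one_sub_xi (by norm_num)))]
  intro h
  have hd : ∀ i : Fin (m + 2), (if (i : ℕ) < 2 then ξ 3 else 1) ^ 3 = 1 := by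
    intro i
    split_ifs
    · exact hω3
    · norm_num
  have hv := h 1 (fun i => if (i : ℕ) < 2 then ξ 3 else 1)
    (WithLp.toLp 2 fun i => if (i : ℕ) = 0 then (1 - ξ 3)⁻¹ else
      if (i : ℕ) = 1 then -(1 - ξ 3)⁻¹ else tail i)
    (EuclideanSpace.single 0 1 - EuclideanSpace.single 1 1) hd
    (by rw [← Finset.prod_pow]; exact Finset.prod_eq_one fun i _ => hd i)
    (mem_sumLattice.2 ⟨fun i => by
      simp only [PiLp.sub_apply, PiLp.single_apply]
      refine sub_mem ?_ ?_ <;> split_ifs <;> simp [one_mem], by simp [zero_mem]⟩) (by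
      intro i
      obtain ⟨k, hk⟩ := i
      match k with
      | 0 => simp; linear_combination hθ
      | 1 => simp; linear_combination -hθ
      | k + 2 => simp [Fin.ext_iff])
    (Or.inr ⟨0, by simpa using hω1⟩)
  have hlt := norm_theta_inv_lt
  have hgt := lt_norm_theta_inv
  rcases hv.cases_lt (by norm_num) with ⟨i, η, hη, hη1, hmem⟩ | ⟨i, j, ζ, hij, hζ, hmem⟩
  · obtain ⟨a, ha, hae⟩ := hmem.2
    have hη3 : η ^ 3 = 1 := hη
    simp only [PiLp.single_apply, Finset.sum_ite_eq', Finset.mem_univ, if_true] at hae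
    -- `1 - η` and `θ` have the same length
    have hn : ‖1 - η‖ = ‖1 - ξ 3‖ := by
      rcases pow_three_cases hη3 with rfl | rfl | rfl
      · exact absurd rfl hη1
      · rfl
      · rw [show 1 - ξ 3 ^ 2 = -ξ 3 ^ 2 * (1 - ξ 3) by linear_combination -hω3, norm_mul, norm_neg,
          norm_pow, norm_of_pow (r := 3) (by norm_num) hω3]
        norm_num
    have hna := congrArg norm hae
    rw [norm_mul, norm_mul, hn] at hna
    have hna' := mul_left_cancel₀ (norm_ne_zero_iff.2 one_sub_xi_three_ne) hna
    have : 0 < ‖a‖ ∧ ‖a‖ < 1 := by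
      rw [← hna']
      have t1 := norm_tail_pos i
      have t2 := norm_tail_le i
      split_ifs
      · constructor <;> linarith
      · rw [norm_neg]
        constructor <;> linarith
      · constructor <;> linarith
    exact not_mem_of_norm_lt (Or.inl rfl) (norm_pos_iff.1 this.1) this.2 ha
  · have hz := hmem.1 i
    simp only [PiLp.sub_apply, PiLp.single_apply, if_true, hij.ne, if_false,
      sub_zero] at hz
    have hij' : (i : ℕ) < j := hij
    have ti := norm_tail_le i
    have tj := norm_tail_le j
    have tij := norm_tail_ne hij'.ne
    rw [if_neg (show (j : ℕ) ≠ 0 by omega)] at hz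
    by_cases hi0 : (i : ℕ) = 0
    · rw [if_pos hi0] at hz
      by_cases hj1 : (j : ℕ) = 1
      · rw [if_pos hj1] at hz
        exact theta_inv_add_not_mem hζ hz
      · rw [if_neg hj1] at hz
        exact sub_not_mem_of_short (Or.inl rfl) hζ (by intro h; linarith) (by linarith) hz
    · rw [if_neg hi0, if_neg (show (j : ℕ) ≠ 1 by omega)] at hz
      by_cases hi1 : (i : ℕ) = 1
      · rw [if_pos hi1] at hz
        exact sub_not_mem_of_short (Or.inl rfl) hζ (by rw [norm_neg]; intro h; linarith)
          (by rw [norm_neg]; linarith) hz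
      · rw [if_neg hi1] at hz
        exact sub_not_mem_of_short (Or.inl rfl) hζ tij (by linarith) hz

/-! ### The intersections of an invariant lattice with the root lines -/

/-- The `c` with `c (e_i - ζ⁻¹ e_j) ∈ Λ`. -/
def rootCoeffs {n : ℕ} (Λ : Submodule ℤ (Cn n)) (i j : Fin n) (ζ : ℂ) : AddSubgroup ℂ where
  carrier := {c | EuclideanSpace.single i c - EuclideanSpace.single j (ζ⁻¹ * c) ∈ Λ}
  add_mem' := by
    intro a b ha hb
    change _ ∈ Λ
    convert Λ.add_mem ha hb using 1
    ext k
    simp only [PiLp.sub_apply, PiLp.add_apply, PiLp.single_apply]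
    split_ifs <;> ring
  zero_mem' := by
    change _ ∈ Λ
    convert Λ.zero_mem
    ext k
    simp [PiLp.single_apply]
  neg_mem' := by
    intro a ha
    change _ ∈ Λ
    convert Λ.neg_mem ha using 1
    ext k
    simp only [PiLp.sub_apply, PiLp.neg_apply, PiLp.single_apply]
    split_ifs <;> ring

theorem mem_rootCoeffs {n : ℕ} {Λ : Submodule ℤ (Cn n)} {i j : Fin n} {ζ c : ℂ} :
    c ∈ rootCoeffs Λ i j ζ ↔
      EuclideanSpace.single i c - EuclideanSpace.single j (ζ⁻¹ * c) ∈ Λ := Iff.rfl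

/-- The `c` with `c e_i ∈ Λ`. -/
def axisCoeffs {n : ℕ} (Λ : Submodule ℤ (Cn n)) (i : Fin n) : AddSubgroup ℂ where
  carrier := {c | EuclideanSpace.single i c ∈ Λ}
  add_mem' := by
    intro a b ha hb
    change _ ∈ Λ
    convert Λ.add_mem ha hb using 1
    ext k
    simp only [PiLp.add_apply, PiLp.single_apply]
    split_ifs <;> ring
  zero_mem' := by
    change _ ∈ Λ
    convert Λ.zero_mem
    ext k
    simp [PiLp.single_apply]
  neg_mem' := by
    intro a ha
    change _ ∈ Λ
    convert Λ.neg_mem ha using 1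
    ext k
    simp only [PiLp.neg_apply, PiLp.single_apply]
    split_ifs <;> ring

theorem mem_axisCoeffs {n : ℕ} {Λ : Submodule ℤ (Cn n)} {i : Fin n} {c : ℂ} :
    c ∈ axisCoeffs Λ i ↔ EuclideanSpace.single i c ∈ Λ := Iff.rfl

theorem exists_norm_lt_imp {n : ℕ} (Λ : Submodule ℤ (Cn n)) [DiscreteTopology Λ] :
    ∃ ε : ℝ, 0 < ε ∧ ∀ v ∈ Λ, ‖v‖ < ε → v = 0 := by
  obtain ⟨ε, hε, h⟩ := Metric.isOpen_iff.1 (isOpen_discrete ({0} : Set Λ)) 0 rfl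
  refine ⟨ε, hε, fun v hv hlt => ?_⟩
  have : (⟨v, hv⟩ : Λ) ∈ Metric.ball (0 : Λ) ε := by
    rw [mem_ball_zero_iff]
    exact hlt
  exact congrArg Subtype.val (h this)

theorem axisCoeffs_discrete {n : ℕ} (Λ : Submodule ℤ (Cn n)) [DiscreteTopology Λ] (i : Fin n) :
    ∃ ε : ℝ, 0 < ε ∧ ∀ c ∈ axisCoeffs Λ i, ‖c‖ < ε → c = 0 := by
  obtain ⟨ε, hε, h⟩ := exists_norm_lt_imp Λ
  refine ⟨ε, hε, fun c hc hlt => ?_⟩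
  have := h _ hc (by simpa using hlt)
  simpa using congrArg (fun v : Cn n => v i) this

theorem rootCoeffs_discrete {n : ℕ} (Λ : Submodule ℤ (Cn n)) [DiscreteTopology Λ] {i j : Fin n}
    (hij : i ≠ j) : ∃ ε : ℝ, 0 < ε ∧ ∀ c ∈ rootCoeffs Λ i j 1, ‖c‖ < ε → c = 0 := by
  obtain ⟨ε, hε, h⟩ := exists_norm_lt_imp Λ
  refine ⟨ε / 2, half_pos hε, fun c hc hlt => ?_⟩
  have := h _ hc ((norm_sub_le _ _).trans_lt (by simp; linarith))
  simpa [hij] using congrArg (fun v : Cn n => v i) this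

/-- A lattice of full rank is not contained in the kernel of a nonzero linear form. -/
theorem exists_mem_apply_ne_zero {n : ℕ} (Λ : Submodule ℤ (Cn n)) [DiscreteTopology Λ]
    [IsZLattice ℝ Λ] (f : Cn n →ₗ[ℂ] ℂ) (hf : f ≠ 0) : ∃ v ∈ Λ, f v ≠ 0 := by
  by_contra! hcon
  apply hf
  have hle : Submodule.span ℝ (Λ : Set (Cn n)) ≤ (LinearMap.ker f).restrictScalars ℝ :=
    Submodule.span_le.2 fun v hv => hcon v hv
  rw [IsZLattice.span_top] at hle
  ext1 v
  exact hle (Submodule.mem_top : v ∈ ⊤)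

theorem exists_perm_pair {n : ℕ} {a b i j : Fin n} (hab : a ≠ b) (hij : i ≠ j) :
    ∃ σ : Equiv.Perm (Fin n), σ a = i ∧ σ b = j := by
  have hj : a ≠ Equiv.swap a i j := by
    intro h
    have := congrArg (Equiv.swap a i) h
    rw [Equiv.swap_apply_left, Equiv.swap_apply_self] at this
    exact hij this
  refine ⟨Equiv.swap a i * Equiv.swap b (Equiv.swap a i j), ?_, ?_⟩
  · rw [Equiv.Perm.mul_apply, Equiv.swap_apply_of_ne_of_ne hab hj, Equiv.swap_apply_left]
  · rw [Equiv.Perm.mul_apply, Equiv.swap_apply_left, Equiv.swap_apply_self]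

/-- For `n ≥ 3` or `p = 1` two entries of a diagonal matrix in `G(r,p,n)` can be prescribed. -/
theorem exists_diag {n r p : ℕ} (h : 3 ≤ n ∨ p = 1) {a b : Fin n} (hab : a ≠ b) {α β : ℂ}
    (hr : r ≠ 0) (hα : α ^ r = 1) (hβ : β ^ r = 1) :
    ∃ d : Fin n → ℂ, d a = α ∧ d b = β ∧ (∀ i, d i ^ r = 1) ∧ (∏ i, d i) ^ (r / p) = 1 := by
  have hα0 := ne_zero_of_pow hr hα
  have hβ0 := ne_zero_of_pow hr hβ
  rcases h with h | rfl
  · obtain ⟨t, hta, htb⟩ : ∃ t : Fin n, t ≠ a ∧ t ≠ b := by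
      have : ∃ t, t ∉ ({a, b} : Finset (Fin n)) := by
        by_contra! hcon
        have h1 := Finset.card_le_card (fun x _ => hcon x : (Finset.univ : Finset (Fin n)) ⊆ {a, b})
        have h2 := Finset.card_le_two (a := a) (b := b)
        rw [Finset.card_univ, Fintype.card_fin] at h1
        omega
      obtain ⟨t, ht⟩ := this
      simp only [Finset.mem_insert, Finset.mem_singleton, not_or] at ht
      exact ⟨t, ht⟩
    refine ⟨fun i => if i = a then α else if i = b then β else if i = t then (α * β)⁻¹ else 1,
      by simp, by simp [hab.symm], fun i => ?_, ?_⟩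
    · dsimp only
      split_ifs
      · exact hα
      · exact hβ
      · rw [inv_pow, mul_pow, hα, hβ, one_mul, inv_one]
      · exact one_pow r
    · rw [Finset.prod_eq_mul_prod_sdiff_singleton_of_mem (Finset.mem_univ a),
        Finset.prod_eq_mul_prod_sdiff_singleton_of_mem (i := b) (by simp [hab.symm]),
        Finset.prod_eq_mul_prod_sdiff_singleton_of_mem (i := t) (by simp [hta, htb]),
        Finset.prod_eq_one (fun i hi => ?_)]
      · simp only [if_true, hab.symm, if_false, hta, htb]
        rw [show α * (β * ((α * β)⁻¹ * 1)) = 1 by field_simp, one_pow]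
      · simp only [Finset.mem_sdiff, Finset.mem_singleton, Finset.mem_univ, true_and] at hi
        simp [hi.1.1, hi.1.2, hi.2]
  · refine ⟨fun i => if i = a then α else β, by simp, by simp [hab.symm], ?_, ?_⟩
    · intro i
      dsimp only
      split_ifs
      · exact hα
      · exact hβ
    · rw [Nat.div_one, ← Finset.prod_pow]
      refine Finset.prod_eq_one fun i _ => ?_
      split_ifs
      · exact hα
      · exact hβ

/-- All root lines `ℂ (e_i - ζ⁻¹ e_j)` meet the lattice in the same way, for `n ≥ 3` or `p = 1`. -/
theorem smul_mem_rootCoeffs {n r p : ℕ} (hr : r ≠ 0) {Λ : Submodule ℤ (Cn n)}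
    (hΛ : IsInvariant (G r p n) Λ) (h : 3 ≤ n ∨ p = 1) {a b i j : Fin n} (hab : a ≠ b)
    (hij : i ≠ j) {α ζ ζ' x : ℂ} (hα : α ^ r = 1) (hζ : ζ ^ r = 1) (hζ' : ζ' ^ r = 1)
    (hx : x ∈ rootCoeffs Λ i j ζ) : α * x ∈ rootCoeffs Λ a b ζ' := by
  obtain ⟨σ, hσa, hσb⟩ := exists_perm_pair hab hij
  obtain ⟨d, hda, hdb, h1, h2⟩ := exists_diag (r := r) (p := p) h hab hr hα
    (show (α * ζ * ζ'⁻¹) ^ r = 1 by rw [mul_pow, mul_pow, inv_pow, hα, hζ, hζ']; norm_num)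
  have hζ0 := ne_zero_of_pow hr hζ
  refine hΛ.monomial_mem hr σ d h1 h2 hx fun k => ?_
  rcases eq_or_ne k a with rfl | hk
  · simp [hda, hσa, hab, hij]
  · rcases eq_or_ne k b with rfl | hk'
    · simp [hdb, hσb, hk, hij.symm]
      field_simp
    · have h3 : σ k ≠ i := fun h => hk (σ.injective (h.trans hσa.symm))
      have h4 : σ k ≠ j := fun h => hk' (σ.injective (h.trans hσb.symm))
      simp [hk, hk', h3, h4]

/-- Differences of root vectors lie on the coordinate axes. -/
theorem axis_mem_of_root {n : ℕ} {Λ : Submodule ℤ (Cn n)} {i j : Fin n} {ζ x : ℂ} (hζ0 : ζ ≠ 0)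
    (h1 : x ∈ rootCoeffs Λ i j 1) (h2 : ζ * x ∈ rootCoeffs Λ i j ζ) :
    (1 - ζ) * x ∈ axisCoeffs Λ i := by
  rw [mem_axisCoeffs]
  convert Λ.sub_mem h1 h2 using 1
  ext k
  simp only [PiLp.sub_apply, PiLp.single_apply, inv_mul_cancel_left₀ hζ0]
  split_ifs <;> simp <;> ring

/-! ### The groups with `r = p` -/

/-- A generator of the intersection of `Λ` with one root line generates it on all of them. -/
theorem mul_mem_rootCoeffs_iff {n r p : ℕ} (hr : r ≠ 0) {Λ : Submodule ℤ (Cn n)}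
    (hΛ : IsInvariant (G r p n) Λ) (h : 3 ≤ n ∨ p = 1) {c : ℂ} {i₀ j₀ : Fin n} (h₀ : i₀ ≠ j₀)
    (hc : ∀ x, x * c ∈ rootCoeffs Λ i₀ j₀ 1 ↔ x ∈ adjoinZ (ξ r)) {i j : Fin n} (hij : i ≠ j)
    {ζ : ℂ} (hζ : ζ ^ r = 1) (x : ℂ) : x * c ∈ rootCoeffs Λ i j ζ ↔ x ∈ adjoinZ (ξ r) := by
  rw [← hc]
  constructor
  · intro hx
    simpa using smul_mem_rootCoeffs hr hΛ h h₀ hij (one_pow r) hζ (one_pow r) hx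
  · intro hx
    simpa using smul_mem_rootCoeffs hr hΛ h hij h₀ (one_pow r) (one_pow r) hζ hx

/-- For `r = p` there are no diagonal reflections, so that a point `c v₀` can lie on a mirror only
if some `v₀ᵢ - ζ v₀ⱼ` is integral. -/
theorem not_steinberg_of_point {n r : ℕ} (hr0 : r ≠ 0) {Λ : Submodule ℤ (Cn n)}
    (hΛ : IsInvariant (G r r n) Λ) {c : ℂ}
    (hc : ∀ (i j : Fin n) (ζ : ℂ), i ≠ j → ζ ^ r = 1 →
      ∀ x, x * c ∈ rootCoeffs Λ i j ζ ↔ x ∈ adjoinZ (ξ r))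
    (v₀ d : Fin n → ℂ) (b : Cn n) (hd : ∀ i, d i ^ r = 1) (hprod : ∏ i, d i = 1) (hb : b ∈ Λ)
    (hv : ∀ i, (1 - d i) * (c * v₀ i) = b i) (hne : ∃ i, d i ≠ 1)
    (hgen : ∀ (i j : Fin n) (ζ : ℂ), i < j → ζ ^ r = 1 → v₀ i - ζ * v₀ j ∉ adjoinZ (ξ r)) :
    ¬ SteinbergProperty (semidirect (G r r n) Λ) := by
  rw [steinberg_iff hr0 dvd_rfl hΛ]
  intro h
  have hm := h 1 d (WithLp.toLp 2 fun i => c * v₀ i) b hd (by rw [hprod, one_pow]) hb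
    (fun i => by
      have := hv i
      simp only [Equiv.Perm.coe_one, id_eq]
      linear_combination this) (Or.inr hne)
  rcases hm.cases_lt hr0 with ⟨i, η, hη, hη1, -⟩ | ⟨i, j, ζ, hij, hζ, hmem⟩
  · rw [Nat.div_self (Nat.pos_of_ne_zero hr0), pow_one] at hη
    exact hη1 hη
  · refine hgen i j ζ hij hζ ((hc i j ζ hij.ne hζ _).1 ?_)
    rw [show (v₀ i - ζ * v₀ j) * c = c * v₀ i - ζ * (c * v₀ j) by ring]
    exact hmem

/-- The point `c (0, t, …)` with `2 t ∈ (1 - ξ) ℤ[ξ]` is fixed by an element with linear part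
`diag(-1, -1, 1, …, 1)`. -/
theorem not_steinberg_rr_even {n r : ℕ} (hn : 2 ≤ n) (hr : r = 4 ∨ r = 6)
    {Λ : Submodule ℤ (Cn n)} (hΛ : IsInvariant (G r r n) Λ) {c t : ℂ}
    (hc : ∀ (i j : Fin n) (ζ : ℂ), i ≠ j → ζ ^ r = 1 →
      ∀ x, x * c ∈ rootCoeffs Λ i j ζ ↔ x ∈ adjoinZ (ξ r))
    (ht : 2 * t ∈ multiples r (1 - ξ r)) (ht1 : 1 / 10 < ‖t‖) (ht2 : ‖t‖ < 9 / 10) :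
    ¬ SteinbergProperty (semidirect (G r r n) Λ) := by
  obtain ⟨m, rfl⟩ : ∃ m, n = m + 2 := ⟨n - 2, by omega⟩
  have hr0 : r ≠ 0 := by omega
  have hr' : r = 3 ∨ r = 4 ∨ r = 6 := Or.inr hr
  have hneg : (-1 : ℂ) ^ r = 1 := by rcases hr with rfl | rfl <;> norm_num
  refine not_steinberg_of_point hr0 hΛ hc
    (fun i => if (i : ℕ) = 0 then 0 else if (i : ℕ) = 1 then t else tail i)
    (fun i => if (i : ℕ) < 2 then -1 else 1) (EuclideanSpace.single 1 (2 * t * c)) ?_ ?_ ?_ ?_ ?_ ?_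
  · intro i
    split_ifs
    · exact hneg
    · exact one_pow r
  · simp [Fin.prod_univ_succ]
  · obtain ⟨a, ha, hae⟩ := ht
    have h01 : (1 : Fin (m + 2)) ≠ 0 := by simp
    have h1 := (hc 1 0 1 h01 (one_pow r) a).2 ha
    have h2 := (hc 1 0 (ξ r) h01 (xi_pow hr0) (ξ r * a)).2 (mul_mem (xi_mem r) ha)
    rw [mul_assoc] at h2
    have := axis_mem_of_root (ne_zero_of_pow hr0 (xi_pow hr0)) h1 h2
    rw [hae, mul_assoc]
    exact this
  · intro i
    obtain ⟨k, hk⟩ := i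
    match k with
    | 0 => simp
    | 1 => simp; ring
    | k + 2 => simp [Fin.ext_iff]
  · exact ⟨0, by norm_num⟩
  · intro i j ζ hij hζ
    have hij' : (i : ℕ) < j := hij
    have ti := norm_tail_le i
    have tj := norm_tail_le j
    have tj' := norm_tail_pos j
    have tij := norm_tail_ne hij'.ne
    rw [if_neg (show (j : ℕ) ≠ 0 by omega)]
    by_cases hi0 : (i : ℕ) = 0
    · rw [if_pos hi0]
      by_cases hj1 : (j : ℕ) = 1
      · rw [if_pos hj1]
        refine sub_not_mem_of_short hr' hζ ?_ ?_ <;> rw [norm_zero]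
        · intro h
          linarith
        · linarith
      · rw [if_neg hj1]
        refine sub_not_mem_of_short hr' hζ ?_ ?_ <;> rw [norm_zero]
        · exact tj'.ne
        · linarith
    · rw [if_neg hi0, if_neg (show (j : ℕ) ≠ 1 by omega)]
      by_cases hi1 : (i : ℕ) = 1
      · rw [if_pos hi1]
        exact sub_not_mem_of_short hr' hζ (by intro h; linarith) (by linarith)
      · rw [if_neg hi1]
        exact sub_not_mem_of_short hr' hζ tij (by linarith)

/-- The point `c (0, 1/θ, -1/θ, …)`, `θ = 1 - ω`, is fixed by an element with linear part
`diag(ω, ω, ω, 1, …, 1)`. -/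
theorem not_steinberg_rr_three {n : ℕ} (hn : 3 ≤ n) {Λ : Submodule ℤ (Cn n)}
    (hΛ : IsInvariant (G 3 3 n) Λ) {c : ℂ}
    (hc : ∀ (i j : Fin n) (ζ : ℂ), i ≠ j → ζ ^ 3 = 1 →
      ∀ x, x * c ∈ rootCoeffs Λ i j ζ ↔ x ∈ adjoinZ (ξ 3)) :
    ¬ SteinbergProperty (semidirect (G 3 3 n) Λ) := by
  obtain ⟨m, rfl⟩ : ∃ m, n = m + 3 := ⟨n - 3, by omega⟩
  have hω3 : ξ 3 ^ 3 = 1 := xi_pow (by norm_num)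
  have hω1 : ξ 3 ≠ 1 := fun h => one_sub_xi_three_ne (by rw [h, sub_self])
  have hθ := mul_inv_cancel₀ one_sub_xi_three_ne
  have hlt := norm_theta_inv_lt
  have hgt := lt_norm_theta_inv
  refine not_steinberg_of_point (by norm_num) hΛ hc
    (fun i => if (i : ℕ) = 0 then 0 else if (i : ℕ) = 1 then (1 - ξ 3)⁻¹ else
      if (i : ℕ) = 2 then -(1 - ξ 3)⁻¹ else tail i)
    (fun i => if (i : ℕ) < 3 then ξ 3 else 1)
    (EuclideanSpace.single 1 c - EuclideanSpace.single ⟨2, by omega⟩ c) ?_ ?_ ?_ ?_ ?_ ?_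
  · intro i
    split_ifs
    · exact hω3
    · exact one_pow 3
  · have h3 : ∀ k : ℕ, ¬ k + 1 + 1 + 1 < 3 := fun k => by omega
    simp [Fin.prod_univ_succ, h3]
    linear_combination hω3
  · have h12 : (1 : Fin (m + 3)) ≠ ⟨2, by omega⟩ := by simp [Fin.ext_iff]
    have := (hc 1 ⟨2, by omega⟩ 1 h12 (one_pow 3) 1).2 (one_mem _)
    rw [mem_rootCoeffs] at this
    simpa using this
  · intro i
    obtain ⟨k, hk⟩ := i
    match k with
    | 0 => simp [Fin.ext_iff]
    | 1 => simp [Fin.ext_iff]; linear_combination c * hθ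
    | 2 => simp [Fin.ext_iff]; linear_combination c * hθ
    | k + 3 => simp [Fin.ext_iff]
  · exact ⟨0, by simpa using hω1⟩
  · intro i j ζ hij hζ
    have hij' : (i : ℕ) < j := hij
    have ti := norm_tail_le i
    have tj := norm_tail_le j
    have tj' := norm_tail_pos j
    have tij := norm_tail_ne hij'.ne
    rw [if_neg (show (j : ℕ) ≠ 0 by omega)]
    by_cases hi0 : (i : ℕ) = 0
    · rw [if_pos hi0]
      refine sub_not_mem_of_short (Or.inl rfl) hζ ?_ ?_ <;> rw [norm_zero] <;> split_ifs <;>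
        (try rw [norm_neg]) <;> linarith
    · rw [if_neg hi0, if_neg (show (j : ℕ) ≠ 1 by omega)]
      by_cases hi1 : (i : ℕ) = 1
      · rw [if_pos hi1]
        by_cases hj2 : (j : ℕ) = 2
        · rw [if_pos hj2]
          exact theta_inv_add_not_mem hζ
        · rw [if_neg hj2]
          exact sub_not_mem_of_short (Or.inl rfl) hζ (by intro h; linarith) (by linarith)
      · rw [if_neg hi1, if_neg (show (j : ℕ) ≠ 2 by omega)]
        by_cases hi2 : (i : ℕ) = 2
        · rw [if_pos hi2]
          exact sub_not_mem_of_short (Or.inl rfl) hζ (by rw [norm_neg]; intro h; linarith)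
            (by rw [norm_neg]; linarith)
        · rw [if_neg hi2]
          exact sub_not_mem_of_short (Or.inl rfl) hζ tij (by linarith)

/-- For `n ≥ 3` and `r = p ≥ 3` no group `G(r,r,n) ⋉ Λ` has the Steinberg property. -/
theorem not_steinberg_rr {n r : ℕ} (hr : 3 ≤ r) (hn : 3 ≤ n) (Λ : Submodule ℤ (Cn n))
    [DiscreteTopology Λ] [IsZLattice ℝ Λ] (hΛ : IsInvariant (G r r n) Λ) :
    ¬ SteinbergProperty (semidirect (G r r n) Λ) := by
  obtain ⟨m, rfl⟩ : ∃ m, n = m + 3 := ⟨n - 3, by omega⟩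
  have hr0 : r ≠ 0 := by omega
  have h01 : (0 : Fin (m + 3)) ≠ 1 := by simp
  obtain ⟨ε, hε, hdisc⟩ := rootCoeffs_discrete Λ h01
  have hne : ∃ x ∈ rootCoeffs Λ 0 1 1, x ≠ 0 := by
    obtain ⟨v, hv, hne⟩ := exists_mem_apply_ne_zero Λ (coord 0 - coord 1) (by
      intro h
      have := LinearMap.congr_fun h (EuclideanSpace.single 0 1)
      simp at this)
    refine ⟨v 0 - v 1, ?_, hne⟩
    -- the reflection exchanging the first two coordinates moves `v` along the root line
    have hsw : (WithLp.toLp 2 fun i => v (Equiv.swap 0 1 i) : Cn (m + 3)) ∈ Λ :=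
      hΛ.monomial_mem hr0 (Equiv.swap 0 1) (fun _ => 1) (by simp) (by simp) hv (by simp)
    rw [mem_rootCoeffs]
    convert sub_mem hv hsw using 1
    ext k
    rcases eq_or_ne k 0 with rfl | hk
    · simp [h01]
    · rcases eq_or_ne k 1 with rfl | hk'
      · simp
      · simp [hk, hk', Equiv.swap_apply_of_ne_of_ne hk hk']
  have hξ : ∀ x ∈ rootCoeffs Λ 0 1 1, ξ r * x ∈ rootCoeffs Λ 0 1 1 := fun x hx =>
    smul_mem_rootCoeffs hr0 hΛ (Or.inl hn) h01 h01 (xi_pow hr0) (one_pow r) (one_pow r) hx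
  have hr' := order_of_discrete hr _ hε hdisc hne hξ
  obtain ⟨c, -, hc⟩ := exists_generator hr' _ hε hdisc hne hξ
  have hc' := fun (i j : Fin (m + 3)) (ζ : ℂ) (hij : i ≠ j) (hζ : ζ ^ r = 1) =>
    mul_mem_rootCoeffs_iff hr0 hΛ (Or.inl hn) h01 hc hij hζ
  rcases hr' with rfl | rfl | rfl
  · exact not_steinberg_rr_three hn hΛ hc'
  · have hn2 : ‖(1 - Complex.I) / 2‖ = √2 / 2 := by
      have : Complex.normSq (1 - Complex.I) = 2 := by
        rw [Complex.normSq_apply]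
        norm_num
      rw [norm_div, ← Real.sqrt_sq (norm_nonneg (1 - Complex.I)), ← Complex.normSq_eq_norm_sq, this]
      norm_num
    refine not_steinberg_rr_even (by omega) (Or.inl rfl) hΛ hc' (t := (1 - Complex.I) / 2)
      ⟨1, one_mem _, by rw [xi_four]; ring⟩ ?_ ?_
    · rw [hn2]
      have : 1 < √2 := Real.lt_sqrt_of_sq_lt (by norm_num)
      linarith
    · rw [hn2]
      have : √2 < 1.5 := by
        rw [Real.sqrt_lt' (by norm_num)]
        norm_num
      linarith
  · refine not_steinberg_rr_even (by omega) (Or.inr rfl) hΛ hc' (t := 1 / 2)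
      ⟨ξ 6, xi_mem 6, ?_⟩ (by norm_num) (by norm_num)
    rw [xi_six_eq]
    linear_combination xi_three_sq

/-! ### Classification of the lattices for `r ≠ p` -/

/-- A lattice that is generated by its intersections with the axes and root lines and that meets
each axis in `ℤ[ξ]`. -/
structure IsNormalized {n : ℕ} (r p : ℕ) (Λ : Submodule ℤ (Cn n)) : Prop where
  invariant : IsInvariant (G r p n) Λ
  generated : Λ ≤ Submodule.span ℤ (lineVectors r Λ)
  axis : ∀ i c, EuclideanSpace.single i c ∈ Λ ↔ c ∈ adjoinZ (ξ r)

/-- To bound a normalized lattice from above it suffices to look at the root lines. -/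
theorem IsNormalized.le {n r p : ℕ} {Λ T : Submodule ℤ (Cn n)} (h : IsNormalized r p Λ)
    (h1 : ∀ i, ∀ c ∈ adjoinZ (ξ r), EuclideanSpace.single i c ∈ T)
    (h2 : ∀ i j ζ, i ≠ j → ζ ^ r = 1 → ∀ c ∈ rootCoeffs Λ i j ζ,
      EuclideanSpace.single i c - EuclideanSpace.single j (ζ⁻¹ * c) ∈ T) : Λ ≤ T := by
  refine h.generated.trans (Submodule.span_le.2 ?_)
  rintro b ⟨hb, ⟨i, c, rfl⟩ | ⟨i, j, ζ, c, hij, hζ, rfl⟩⟩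
  · exact h1 i c ((h.axis i c).1 hb)
  · exact h2 i j ζ hij hζ c hb

theorem eq_sum_single {n : ℕ} (x : Cn n) : x = ∑ i, EuclideanSpace.single i (x i) := by
  ext j
  simp

theorem IsNormalized.mem_rootCoeffs_of_mem {n r p : ℕ} {Λ : Submodule ℤ (Cn n)} (hr : r ≠ 0)
    (h : IsNormalized r p Λ) {i j : Fin n} {ζ c : ℂ} (hζ : ζ ^ r = 1) (hc : c ∈ adjoinZ (ξ r)) :
    c ∈ rootCoeffs Λ i j ζ :=
  sub_mem ((h.axis i c).2 hc) ((h.axis j _).2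
    (mul_mem (root_mem hr (by rw [inv_pow, hζ, inv_one])) hc))

/-- If the root lines contribute nothing beyond the axes, the lattice is `ℤ[ξ]ⁿ`. -/
theorem IsNormalized.eq_sumLattice_one {n r p : ℕ} {Λ : Submodule ℤ (Cn n)} (hr : r ≠ 0)
    (h : IsNormalized r p Λ)
    (hroot : ∀ i j ζ, i ≠ j → ζ ^ r = 1 → ∀ c ∈ rootCoeffs Λ i j ζ, c ∈ adjoinZ (ξ r)) :
    Λ = sumLattice r n 1 := by
  have hs : ∀ i : Fin n, ∀ c ∈ adjoinZ (ξ r),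
      EuclideanSpace.single i c ∈ sumLattice r n 1 := by
    intro i c hc
    refine mem_sumLattice_one.2 fun k => ?_
    rw [PiLp.single_apply]
    split_ifs
    · exact hc
    · exact zero_mem _
  refine le_antisymm (h.le hs fun i j ζ hij hζ c hc => ?_) fun x hx => ?_
  · have hcR := hroot i j ζ hij hζ c hc
    exact sub_mem (hs i c hcR) (hs j _ (mul_mem (root_mem hr (by rw [inv_pow, hζ, inv_one])) hcR))
  · rw [eq_sum_single x]
    exact sum_mem fun i _ => (h.axis i _).2 (hx.1 i)

/-- If `Λ` meets the root lines in `δ⁻¹ ℤ[ξ]`, then `δ Λ` is `sumLattice r n δ`. -/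
theorem IsNormalized.mem_iff_smul_mem_sumLattice {n r p : ℕ} {Λ : Submodule ℤ (Cn n)} (hn : 1 ≤ n)
    (hr : r ≠ 0) (h : IsNormalized r p Λ) {δ : ℂ} (hδ0 : δ ≠ 0) (hδ : δ ∈ adjoinZ (ξ r))
    (hu : IsUnipotentMod r δ)
    (hroot : ∀ i j ζ, i ≠ j → ζ ^ r = 1 → ∀ c ∈ rootCoeffs Λ i j ζ, δ * c ∈ adjoinZ (ξ r))
    (hinv : ∀ i j, i ≠ j → ∀ a ∈ adjoinZ (ξ r), δ⁻¹ * a ∈ rootCoeffs Λ i j 1) (v : Cn n) :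
    v ∈ Λ ↔ δ • v ∈ sumLattice r n δ := by
  constructor
  · have hle : Λ ≤ (sumLattice r n δ).comap
        ((LinearMap.lsmul ℂ (Cn n) δ).restrictScalars ℤ) := by
      refine h.le (fun i c hc => ?_) fun i j ζ hij hζ c hc => ?_
      · refine mem_sumLattice.2 ⟨fun k => ?_, ⟨c, hc, ?_⟩⟩
        · simp only [LinearMap.restrictScalars_apply, LinearMap.lsmul_apply, PiLp.smul_apply,
            PiLp.single_apply, smul_eq_mul]
          refine mul_mem hδ ?_
          split_ifs
          · exact hc
          · exact zero_mem _
        · simp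
      · have hζ' : ζ⁻¹ ^ r = 1 := by rw [inv_pow, hζ, inv_one]
        have hcR := hroot i j ζ hij hζ c hc
        refine mem_sumLattice.2 ⟨fun k => ?_, ?_⟩
        · simp only [LinearMap.restrictScalars_apply, LinearMap.lsmul_apply, PiLp.smul_apply,
            PiLp.sub_apply, PiLp.single_apply, smul_eq_mul, mul_sub, mul_ite, mul_zero]
          refine sub_mem ?_ ?_ <;> split_ifs
          · exact hcR
          · exact zero_mem _
          · rw [mul_left_comm]
            exact mul_mem (root_mem hr hζ') hcR
          · exact zero_mem _
        · convert mul_mem_multiples (neg_mem hcR) (hu _ hζ') using 1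
          simp [← Finset.mul_sum]
          ring
    exact fun hv => hle hv
  · rintro ⟨h1, a, ha, h2⟩
    obtain ⟨i₀⟩ : Nonempty (Fin n) := ⟨⟨0, hn⟩⟩
    -- the vectors `eᵢ - e_{i₀}` reduce the claim to a multiple of `e_{i₀}`
    have hdec : v = ∑ i, (EuclideanSpace.single i (v i) - EuclideanSpace.single i₀ (v i)) +
        EuclideanSpace.single i₀ (∑ i, v i) := by
      rw [Finset.sum_sub_distrib, ← eq_sum_single]
      have hs : ∑ i, EuclideanSpace.single i₀ (v i) = EuclideanSpace.single i₀ (∑ i, v i) := by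
        ext k
        by_cases hk : k = i₀ <;> simp [hk]
      rw [hs, sub_add_cancel]
    rw [hdec]
    refine add_mem (sum_mem fun i _ => ?_) ((h.axis i₀ _).2 ?_)
    · rcases eq_or_ne i i₀ with rfl | hi
      · simp
      · have := hinv i i₀ hi _ (h1 i)
        rw [mem_rootCoeffs] at this
        simpa [hδ0] using this
    · have : ∑ i, v i = a := by
        apply mul_left_cancel₀ hδ0
        rw [← h2, Finset.mul_sum]
        rfl
      rwa [this]

/-- Congruence classes modulo `1 - ξ`. -/
theorem mod_one_sub_xi {r : ℕ} (hr : r = 3 ∨ r = 4 ∨ r = 6) {z : ℂ} (hz : z ∈ adjoinZ (ξ r)) :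
    (∃ w ∈ adjoinZ (ξ r), z = (1 - ξ r) * w) ∨
      ∃ ζ ∈ adjoinZ (ξ r), ζ ^ 2 = 1 ∧ ∃ w ∈ adjoinZ (ξ r), z = ζ + (1 - ξ r) * w := by
  rcases hr with rfl | rfl | rfl
  · rcases eis_mod_theta hz with h | ⟨ζ, hζ, h⟩
    · exact Or.inl h
    · have : (ζ - 1) * (ζ + 1) = 0 := by linear_combination hζ
      refine Or.inr ⟨ζ, ?_, hζ, h⟩
      rcases mul_eq_zero.1 this with h' | h'
      · rw [sub_eq_zero.1 h']
        exact one_mem _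
      · rw [eq_neg_of_add_eq_zero_left h']
        exact neg_mem (one_mem _)
  · rcases gauss_mod_pi hz with ⟨w, hw, h⟩ | ⟨w, hw, h⟩
    · exact Or.inl ⟨w, hw, by rw [xi_four, h]⟩
    · exact Or.inr ⟨1, one_mem _, by norm_num, w, hw, by rw [xi_four, h]⟩
  · refine Or.inl ⟨ξ 6 * z, mul_mem (xi_mem 6) hz, ?_⟩
    rw [xi_six_eq]
    linear_combination z * xi_three_sq

theorem one_sub_xi_ne_zero {r : ℕ} (hr : r = 3 ∨ r = 4 ∨ r = 6) : 1 - ξ r ≠ 0 := by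
  intro h
  have h1 : (1 : ℕ) < r := by omega
  exact (xi_isPrimitiveRoot (r := r) (by omega)).ne_one h1 (sub_eq_zero.1 h).symm

/-- A non-integral `c` with `(1 - ξ) c` integral generates `(1 - ξ)⁻¹ ℤ[ξ]` together with `1`. -/
theorem inv_mem_of_not_mem {r : ℕ} (hr : r = 3 ∨ r = 4 ∨ r = 6) {N : AddSubgroup ℂ}
    (hξ : ∀ x ∈ N, ξ r * x ∈ N) (hR : ∀ x ∈ adjoinZ (ξ r), x ∈ N) {c : ℂ} (hc : c ∈ N)
    (hcR : c ∉ adjoinZ (ξ r)) (hδc : (1 - ξ r) * c ∈ adjoinZ (ξ r)) : (1 - ξ r)⁻¹ ∈ N := by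
  have h0 := one_sub_xi_ne_zero hr
  rcases mod_one_sub_xi hr hδc with ⟨w, hw, h⟩ | ⟨ζ, hζR, hζ, w, hw, h⟩
  · exact absurd (mul_left_cancel₀ h0 h ▸ hw) hcR
  · have : (1 - ξ r)⁻¹ = ζ * (c - w) := by
      apply mul_left_cancel₀ h0
      rw [mul_inv_cancel₀ h0]
      linear_combination (-ζ) * h - hζ
    rw [this]
    exact mul_mem_of_xi_stable hξ hζR _ (N.sub_mem hc (hR w hw))

/-- For `n ≥ 3` or `p = 1` there are at most two normalized lattices. -/
theorem IsNormalized.classification_homogeneous {n r p : ℕ} (hr : r = 3 ∨ r = 4 ∨ r = 6)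
    {Λ : Submodule ℤ (Cn n)} (h : IsNormalized r p Λ) (hnp : 3 ≤ n ∨ p = 1) (hn : 2 ≤ n) :
    Λ = sumLattice r n 1 ∨ ∀ v, v ∈ Λ ↔ (1 - ξ r) • v ∈ sumLattice r n (1 - ξ r) := by
  have hr0 : r ≠ 0 := by omega
  have hstab : ∀ i j : Fin n, i ≠ j → ∀ x ∈ rootCoeffs Λ i j 1, ξ r * x ∈ rootCoeffs Λ i j 1 :=
    fun i j hij x hx => smul_mem_rootCoeffs hr0 h.invariant hnp hij hij (xi_pow hr0) (one_pow r)
      (one_pow r) hx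
  have hδ : ∀ i j ζ, i ≠ j → ζ ^ r = 1 → ∀ c ∈ rootCoeffs Λ i j ζ,
      (1 - ξ r) * c ∈ adjoinZ (ξ r) := by
    intro i j ζ hij hζ c hc
    have h1 := smul_mem_rootCoeffs hr0 h.invariant hnp hij hij (one_pow r) hζ (one_pow r) hc
    have h2 := smul_mem_rootCoeffs hr0 h.invariant hnp hij hij (xi_pow hr0) hζ (xi_pow hr0) hc
    rw [one_mul] at h1
    exact (h.axis i _).1 (axis_mem_of_root (ne_zero_of_pow hr0 (xi_pow hr0)) h1 h2)
  by_cases hall : ∀ i j ζ, i ≠ j → ζ ^ r = 1 → ∀ c ∈ rootCoeffs Λ i j ζ, c ∈ adjoinZ (ξ r)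
  · exact Or.inl (h.eq_sumLattice_one hr0 hall)
  · right
    push Not at hall
    obtain ⟨i₁, j₁, ζ, hij₁, hζ, c, hc, hcR⟩ := hall
    refine h.mem_iff_smul_mem_sumLattice (by omega) hr0 (one_sub_xi_ne_zero hr)
      (sub_mem (one_mem _) (xi_mem r)) (isUnipotentMod_one_sub_xi hr0) hδ fun i j hij a ha => ?_
    have hc' := smul_mem_rootCoeffs hr0 h.invariant hnp hij hij₁ (one_pow r) hζ (one_pow r) hc
    rw [one_mul] at hc'
    rw [mul_comm]
    exact mul_mem_of_xi_stable (hstab i j hij) ha _ (inv_mem_of_not_mem hr (hstab i j hij)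
      (fun x hx => h.mem_rootCoeffs_of_mem hr0 (one_pow r) hx) hc' hcR (hδ i₁ j₁ ζ hij₁ hζ c hc))

/-! ### Dimension two, where the root lines need not form a single orbit -/

theorem IsInvariant.diag_mem {r p : ℕ} (hr : r ≠ 0) {Λ : Submodule ℤ (Cn 2)}
    (hΛ : IsInvariant (G r p 2) Λ) {α β : ℂ} (hα : α ^ r = 1) (hβ : β ^ r = 1)
    (hαβ : (α * β) ^ (r / p) = 1) {v : Cn 2} (hv : v ∈ Λ) : !₂[α * v 0, β * v 1] ∈ Λ := by
  refine hΛ.monomial_mem hr 1 ![α, β] ?_ (by simpa [Fin.prod_univ_two] using hαβ) hv ?_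
  · intro i
    fin_cases i
    · exact hα
    · exact hβ
  · intro i
    fin_cases i <;> simp

theorem IsNormalized.sub_mul_mem {r p : ℕ} (hr : r ≠ 0) (hpr : p ∣ r) {Λ : Submodule ℤ (Cn 2)}
    (h : IsNormalized r p Λ) {η : ℂ} (hη : η ^ (r / p) = 1) {v : Cn 2} (hv : v ∈ Λ) :
    (1 - η) * v 0 ∈ adjoinZ (ξ r) := by
  have := h.invariant.diag_mem hr (α := η) (β := 1) (pow_eq_one_of_div hpr hη) (one_pow r)
    (by simpa using hη) hv
  rw [← h.axis 0]
  convert sub_mem hv this using 1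
  ext k
  fin_cases k
  · simp
    ring
  · simp

/-- A lattice containing the vectors `(x, f x) / m` is determined by `f` and `m`. -/
theorem IsNormalized.mem_iff_twist {r p : ℕ} {Λ : Submodule ℤ (Cn 2)} (h : IsNormalized r p Λ)
    {m : ℂ} (hm0 : m ≠ 0) (hm : m ∈ adjoinZ (ξ r)) (f : ℂ →+ ℂ)
    (hfR : ∀ x ∈ adjoinZ (ξ r), f x ∈ adjoinZ (ξ r))
    (hf : ∀ x ∈ adjoinZ (ξ r), !₂[m⁻¹ * x, m⁻¹ * f x] ∈ Λ)
    (hΛ : ∀ v ∈ Λ, m * v 0 ∈ adjoinZ (ξ r)) (v : Cn 2) :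
    v ∈ Λ ↔ m • v ∈ twistLattice r m f := by
  rw [mem_twistLattice]
  simp only [PiLp.smul_apply, smul_eq_mul]
  constructor
  · intro hv
    have hx := hΛ v hv
    have hsub := sub_mem hv (hf _ hx)
    have hw : v 1 - m⁻¹ * f (m * v 0) ∈ adjoinZ (ξ r) := by
      rw [← h.axis 1]
      convert hsub using 1
      ext k
      fin_cases k
      · simp [hm0]
      · simp
    have he : m * v 1 - f (m * v 0) = m * (v 1 - m⁻¹ * f (m * v 0)) := by
      field_simp
    refine ⟨hx, ?_, ⟨_, hw, he⟩⟩
    rw [sub_eq_iff_eq_add.1 he]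
    exact add_mem (mul_mem hm hw) (hfR _ hx)
  · rintro ⟨h0, -, w, hw, hwe⟩
    convert add_mem (hf _ h0) ((h.axis 1 w).2 hw) using 1
    ext k
    fin_cases k
    · simp [hm0]
    · simp
      apply mul_left_cancel₀ hm0
      rw [mul_add, mul_inv_cancel_left₀ hm0]
      linear_combination hwe

theorem mem_rootCoeffs_swap {n : ℕ} {Λ : Submodule ℤ (Cn n)} {i j : Fin n} {ζ c : ℂ}
    (hζ : ζ ≠ 0) (hc : c ∈ rootCoeffs Λ i j ζ) : -(ζ⁻¹ * c) ∈ rootCoeffs Λ j i ζ⁻¹ := by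
  rw [mem_rootCoeffs] at *
  convert hc using 1
  ext k
  simp only [PiLp.sub_apply, PiLp.single_apply]
  split_ifs <;> field_simp <;> ring

theorem forall_root_of_zero_one {r : ℕ} (hr : r ≠ 0) {Λ : Submodule ℤ (Cn 2)}
    {δ : ℂ} (h : ∀ ζ, ζ ^ r = 1 → ∀ c ∈ rootCoeffs Λ 0 1 ζ, δ * c ∈ adjoinZ (ξ r)) :
    ∀ i j ζ, i ≠ j → ζ ^ r = 1 → ∀ c ∈ rootCoeffs Λ i j ζ, δ * c ∈ adjoinZ (ξ r) := by
  intro i j ζ hij hζ c hc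
  have hζ0 := ne_zero_of_pow hr hζ
  fin_cases i <;> fin_cases j
  · exact absurd rfl hij
  · exact h ζ hζ c hc
  · have := h ζ⁻¹ (by rw [inv_pow, hζ, inv_one]) _ (mem_rootCoeffs_swap hζ0 hc)
    convert mul_mem (neg_mem (root_mem hr hζ)) this using 1
    field_simp
  · exact absurd rfl hij

/-- In dimension two the constant of `twistLattice` can be multiplied by any root of unity. -/
theorem equivalent_twist {r p : ℕ} (hr : r ≠ 0) {δ k : ℂ} (hk : k ^ r = 1) {f f' : ℂ →+ ℂ}
    (hf : ∀ x, f' x = k * f x) :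
    Equivalent (semidirect (G r p 2) (twistLattice r δ f))
      (semidirect (G r p 2) (twistLattice r δ f')) := by
  refine equivalent_of_diag hr ![1, k] (by intro i; fin_cases i <;> simp [hk]) fun v => ?_
  have hk0 := ne_zero_of_pow hr hk
  have hkR := root_mem hr hk
  have hkR' : k⁻¹ ∈ adjoinZ (ξ r) := root_mem hr (by rw [inv_pow, hk, inv_one])
  simp only [mem_twistLattice, Matrix.cons_val_zero, Matrix.cons_val_one, one_mul, hf]
  refine and_congr_right fun _ => and_congr ⟨mul_mem hkR, fun h => ?_⟩ ?_
  · have := mul_mem hkR' h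
    rwa [inv_mul_cancel_left₀ hk0] at this
  · rw [← mul_sub]
    refine ⟨mul_mem_multiples hkR, fun h => ?_⟩
    have := mul_mem_multiples hkR' h
    rwa [inv_mul_cancel_left₀ hk0] at this

theorem root_vector_eq {ζ c : ℂ} : (EuclideanSpace.single 0 c -
    EuclideanSpace.single 1 (ζ⁻¹ * c) : Cn 2) = !₂[c, -(ζ⁻¹ * c)] := by
  ext k
  fin_cases k <;> simp

/-- If scalar matrices of `r`-th roots of unity belong to `G(r,p,2)`, the sets `rootCoeffs` are
`ℤ[ξ]`-modules. -/
theorem IsNormalized.xi_stable {r p : ℕ} (hr : r ≠ 0) {Λ : Submodule ℤ (Cn 2)}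
    (h : IsNormalized r p Λ) (hξ : (ξ r * ξ r) ^ (r / p) = 1) {ζ : ℂ} :
    ∀ x ∈ rootCoeffs Λ 0 1 ζ, ξ r * x ∈ rootCoeffs Λ 0 1 ζ := by
  intro x hx
  rw [mem_rootCoeffs, root_vector_eq] at *
  convert h.invariant.diag_mem hr (xi_pow hr) (xi_pow hr) hξ hx using 2
  simp
  ring

/-- Invariance under `diag(η, 1)` bounds the first coordinates of `Λ` by `(1 - η)⁻¹ ℤ[ξ]`. If this
bound is attained on a root line, then `Λ` is determined, and a diagonal matrix turns the factor
`-ζ⁻¹` that belongs to the root line into `κ`. -/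
theorem IsNormalized.twist_of_inv_mem {r p : ℕ} (hr : r ≠ 0) (hpr : p ∣ r) {Λ : Submodule ℤ (Cn 2)}
    (h : IsNormalized r p Λ) (hξ : (ξ r * ξ r) ^ (r / p) = 1) {ζ η κ : ℂ} (hζ : ζ ^ r = 1)
    (hη : η ^ (r / p) = 1) (hη1 : η ≠ 1) (hinv : (1 - η)⁻¹ ∈ rootCoeffs Λ 0 1 ζ)
    (hκ : (-1 * ζ * κ) ^ r = 1) :
    Equivalent (semidirect (G r p 2) Λ)
      (semidirect (G r p 2) (twistLattice r (1 - η) (AddMonoidHom.mulLeft κ))) := by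
  have hη0 : 1 - η ≠ 0 := sub_ne_zero.2 hη1.symm
  have hηR : 1 - η ∈ adjoinZ (ξ r) :=
    sub_mem (one_mem _) (root_mem hr (pow_eq_one_of_div hpr hη))
  have hζ0 := ne_zero_of_pow hr hζ
  have hζR : ζ⁻¹ ∈ adjoinZ (ξ r) := root_mem hr (by rw [inv_pow, hζ, inv_one])
  refine (equivalent_of_smul _ hη0 (h.mem_iff_twist hη0 hηR (AddMonoidHom.mulLeft (-ζ⁻¹))
    (fun x hx => mul_mem (neg_mem hζR) hx) (fun x hx => ?_)
    (fun v hv => h.sub_mul_mem hr hpr hη hv))).trans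
    (equivalent_twist hr hκ fun x => ?_)
  · have := mul_mem_of_xi_stable (h.xi_stable hr hξ) hx _ hinv
    rw [mem_rootCoeffs, root_vector_eq] at this
    convert this using 2
    simp
    constructor <;> ring
  · simp
    field_simp

/-- The three lattices are told apart by the root lines: these meet `Λ` in `ℤ[i]`, in
`(1 - i)⁻¹ ℤ[i]` for some root line and in nothing larger, or in `2⁻¹ ℤ[i]` for some root line. -/
theorem IsNormalized.classification_42 {Λ : Submodule ℤ (Cn 2)} (h : IsNormalized 4 2 Λ) :
    Equivalent (semidirect (G 4 2 2) Λ) (G42n_2 2) ∨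
      Equivalent (semidirect (G 4 2 2) Λ) (Grpn_1 4 2 2) ∨
      Equivalent (semidirect (G 4 2 2) Λ) (Gr22_extra 4 2) := by
  have hI : Complex.I ∈ adjoinZ (ξ 4) := xi_four ▸ xi_mem 4
  have hI2 := Complex.I_sq
  have hξ : (ξ 4 * ξ 4) ^ (4 / 2) = 1 := by
    rw [xi_four]
    norm_num
  have hstab : ∀ ζ : ℂ, ∀ x ∈ rootCoeffs Λ 0 1 ζ, ξ 4 * x ∈ rootCoeffs Λ 0 1 ζ := fun ζ =>
    h.xi_stable (by norm_num) hξ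
  have hdouble : ∀ ζ : ℂ, ∀ c ∈ rootCoeffs Λ 0 1 ζ, 2 * c ∈ adjoinZ (ξ 4) := by
    intro ζ c hc
    have := h.sub_mul_mem (by norm_num) (by norm_num) (η := -1) (by norm_num) hc
    rw [← one_add_one_eq_two, ← sub_neg_eq_add]
    simpa using this
  by_cases hhalf : ∃ ζ : ℂ, ζ ^ 4 = 1 ∧ (1 - -1)⁻¹ ∈ rootCoeffs Λ 0 1 ζ
  · right; right
    obtain ⟨ζ, hζ, hinv⟩ := hhalf
    rw [Gr22_extra_four_eq]
    have := h.twist_of_inv_mem (by norm_num) (by norm_num) hξ hζ (by norm_num) (by norm_num) hinv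
      (κ := Complex.I) (by rw [mul_pow, mul_pow, hζ]; norm_num)
    norm_num at this
    exact this
  push Not at hhalf
  have hpi : ∀ ζ : ℂ, ζ ^ 4 = 1 → ∀ c ∈ rootCoeffs Λ 0 1 ζ, (1 - ξ 4) * c ∈ adjoinZ (ξ 4) := by
    intro ζ hζ c hc
    rcases gauss_mod_two (hdouble ζ c hc) with ⟨w, hw, hw'⟩ | ⟨u, hu, w, hw, hw'⟩
    · have : (1 - ξ 4) * c = -Complex.I * w := by
        rw [xi_four]
        linear_combination (1 - Complex.I) / 2 * hw' + w / 2 * hI2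
      rw [this]
      exact mul_mem (neg_mem hI) hw
    · exfalso
      apply hhalf ζ hζ
      have huR : u⁻¹ ∈ adjoinZ (ξ 4) := by
        rcases hu with rfl | rfl
        · simp [one_mem]
        · rw [Complex.inv_I]
          exact neg_mem hI
      have hu0 : u ≠ 0 := by
        rcases hu with rfl | rfl
        · exact one_ne_zero
        · exact Complex.I_ne_zero
      convert mul_mem_of_xi_stable (hstab ζ) huR _
        ((rootCoeffs Λ 0 1 ζ).sub_mem hc (h.mem_rootCoeffs_of_mem (by norm_num) hζ hw)) using 1
      field_simp
      linear_combination -hw'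
  by_cases hall : ∀ ζ, ζ ^ 4 = 1 → ∀ c ∈ rootCoeffs Λ 0 1 ζ, c ∈ adjoinZ (ξ 4)
  · left
    rw [G42n_2_eq le_rfl, ← h.eq_sumLattice_one (by norm_num : (4 : ℕ) ≠ 0)]
    · exact Equivalent.refl _
    · have := forall_root_of_zero_one (r := 4) (Λ := Λ) (δ := 1) (by norm_num)
        (by simpa using hall)
      simpa using this
  · right; left
    push Not at hall
    obtain ⟨ζ, hζ, c, hc, hcR⟩ := hall
    have hinv := inv_mem_of_not_mem (Or.inr (Or.inl rfl)) (hstab ζ)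
      (fun x hx => h.mem_rootCoeffs_of_mem (by norm_num) hζ hx) hc hcR (hpi ζ hζ c hc)
    have h0 := one_sub_xi_ne_zero (r := 4) (Or.inr (Or.inl rfl))
    have hζ0 := ne_zero_of_pow (by norm_num) hζ
    -- `e₁ - ζ⁻¹ e₂` and `e₁ - e₂` are congruent modulo `1 - i`
    have hinv1 : (1 - ξ 4)⁻¹ ∈ rootCoeffs Λ 0 1 1 := by
      obtain ⟨a, ha, hae⟩ := isUnipotentMod_one_sub_xi (r := 4) (by norm_num) ζ⁻¹
        (by rw [inv_pow, hζ, inv_one])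
      have := Λ.add_mem (mem_rootCoeffs.1 hinv) ((h.axis 1 a).2 ha)
      rw [mem_rootCoeffs]
      convert this using 1
      ext k
      fin_cases k
      · simp
      · simp
        field_simp
        linear_combination ζ * hae - mul_inv_cancel₀ hζ0
    rw [Grpn_1_eq 4 2 le_rfl]
    refine equivalent_of_smul _ h0 (h.mem_iff_smul_mem_sumLattice (by norm_num) (by norm_num) h0
      (sub_mem (one_mem _) (xi_mem 4)) (isUnipotentMod_one_sub_xi (by norm_num))
      (forall_root_of_zero_one (by norm_num) hpi) fun i j hij a ha => ?_)
    have h01 : (1 - ξ 4)⁻¹ * a ∈ rootCoeffs Λ 0 1 1 := by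
      rw [mul_comm]
      exact mul_mem_of_xi_stable (hstab 1) ha _ hinv1
    fin_cases i <;> fin_cases j
    · exact absurd rfl hij
    · exact h01
    · have := neg_mem (mem_rootCoeffs_swap one_ne_zero h01)
      simpa using this
    · exact absurd rfl hij

/-- Invariance under `diag(ω, 1)` leaves only `ℤ[ω]` and `(1 - ω)⁻¹ ℤ[ω]` for the intersections of
`Λ` with the root lines. -/
theorem IsNormalized.classification_62 {Λ : Submodule ℤ (Cn 2)} (h : IsNormalized 6 2 Λ) :
    Equivalent (semidirect (G 6 2 2) Λ) (Grpn_1 6 2 2) ∨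
      Equivalent (semidirect (G 6 2 2) Λ) (Gr22_extra 6 2) := by
  have hR := adjoinZ_six
  have hω3 : ξ 3 ^ 3 = 1 := xi_pow (by norm_num)
  have hω1 : ξ 3 ≠ 1 := fun h => one_sub_xi_three_ne (by rw [h, sub_self])
  have hξ : (ξ 6 * ξ 6) ^ (6 / 2) = 1 := by
    rw [← pow_two, ← pow_mul]
    exact xi_pow (by norm_num)
  have hη : ξ 3 ^ (6 / 2) = 1 := hω3
  by_cases hall : ∀ ζ, ζ ^ 6 = 1 → ∀ c ∈ rootCoeffs Λ 0 1 ζ, c ∈ adjoinZ (ξ 6)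
  · left
    rw [Grpn_1_eq 6 2 le_rfl, sumLattice_six, ← h.eq_sumLattice_one (by norm_num : (6 : ℕ) ≠ 0)]
    · exact Equivalent.refl _
    · have := forall_root_of_zero_one (r := 6) (Λ := Λ) (δ := 1) (by norm_num)
        (by simpa using hall)
      simpa using this
  · right
    push Not at hall
    obtain ⟨ζ, hζ, c, hc, hcR⟩ := hall
    have hθc : (1 - ξ 3) * c ∈ adjoinZ (ξ 3) := by
      have := h.sub_mul_mem (by norm_num) (by norm_num) hη hc
      rw [hR] at this
      simpa using this
    have hstab3 : ∀ x ∈ rootCoeffs Λ 0 1 ζ, ξ 3 * x ∈ rootCoeffs Λ 0 1 ζ :=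
      mul_mem_of_xi_stable (h.xi_stable (by norm_num) hξ) (hR ▸ xi_mem 3)
    have hinv := inv_mem_of_not_mem (Or.inl rfl) hstab3
      (fun x hx => h.mem_rootCoeffs_of_mem (by norm_num) hζ (hR ▸ hx)) hc (hR ▸ hcR) hθc
    rw [Gr22_extra_six_eq]
    exact h.twist_of_inv_mem (by norm_num) (by norm_num) hξ hζ hη hω1 hinv
      (by rw [mul_pow, mul_pow, hζ]; norm_num)

/-- The group `G(6,3,2)` contains the scalar matrices `±1` only, so that the intersections of `Λ`
with the root lines need not be `ℤ[ω]`-modules. A vector `(u/2)(e₁ - ζ⁻¹ e₂)` in `Λ` is mapped by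
`diag(ω, ω²)` to a different root line, and the two together make `Λ` a twist by `z ↦ κ z̄`. -/
theorem IsNormalized.classification_63 {Λ : Submodule ℤ (Cn 2)} (h : IsNormalized 6 3 Λ) :
    Equivalent (semidirect (G 6 3 2) Λ) (Grpn_1 6 3 2) ∨
      Equivalent (semidirect (G 6 3 2) Λ) (G632_2 2) := by
  have hR := adjoinZ_six
  have h3 := xi_three_sq
  have hω3 : ξ 3 ^ 3 = 1 := xi_pow (by norm_num)
  have hω0 : ξ 3 ≠ 0 := ne_zero_of_pow (by norm_num) hω3
  have hη : (-1 : ℂ) ^ (6 / 3) = 1 := by norm_num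
  by_cases hall : ∀ ζ, ζ ^ 6 = 1 → ∀ c ∈ rootCoeffs Λ 0 1 ζ, c ∈ adjoinZ (ξ 6)
  · left
    rw [Grpn_1_eq 6 3 le_rfl, sumLattice_six, ← h.eq_sumLattice_one (by norm_num : (6 : ℕ) ≠ 0)]
    · exact Equivalent.refl _
    · have := forall_root_of_zero_one (r := 6) (Λ := Λ) (δ := 1) (by norm_num)
        (by simpa using hall)
      simpa using this
  · right
    push Not at hall
    obtain ⟨ζ, hζ, c, hc, hcR⟩ := hall
    have hdouble : ∀ v ∈ Λ, 2 * v 0 ∈ adjoinZ (ξ 6) := by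
      intro v hv
      convert h.sub_mul_mem (by norm_num) (by norm_num) hη hv using 1
      ring
    have h2c : 2 * c ∈ adjoinZ (ξ 3) := by
      have := hdouble _ hc
      rw [hR] at this
      simpa using this
    rcases eis_mod_two h2c with ⟨w, hw, hwe⟩ | ⟨u, hu, w, hw, hwe⟩
    · exact absurd (hR ▸ mul_left_cancel₀ two_ne_zero hwe ▸ hw) hcR
    have hζ0 := ne_zero_of_pow (by norm_num) hζ
    have hu0 : u ≠ 0 := ne_zero_of_pow (by norm_num) hu
    have hu6 := pow_six_of_pow_three hu
    have huR : u ∈ adjoinZ (ξ 3) := root_mem (by norm_num) hu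
    have huR' : u⁻¹ ∈ adjoinZ (ξ 3) := root_mem (by norm_num) (by rw [inv_pow, hu, inv_one])
    have hζR : ζ⁻¹ ∈ adjoinZ (ξ 3) := hR ▸ root_mem (by norm_num) (by rw [inv_pow, hζ, inv_one])
    have hu2 : !₂[2⁻¹ * u, -(ζ⁻¹ * (2⁻¹ * u))] ∈ Λ := by
      have := (rootCoeffs Λ 0 1 ζ).sub_mem hc
        (h.mem_rootCoeffs_of_mem (by norm_num) hζ (hR ▸ hw))
      rw [mem_rootCoeffs, root_vector_eq] at this
      have hcw : c - w = 2⁻¹ * u := by linear_combination hwe / 2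
      rwa [hcw] at this
    have huω := h.invariant.diag_mem (by norm_num) (α := ξ 3) (β := ξ 3 ^ 2)
      (pow_six_of_pow_three hω3) (by rw [← pow_mul, mul_comm, pow_mul, pow_six_of_pow_three hω3]
                                     norm_num)
      (by rw [show ξ 3 * ξ 3 ^ 2 = ξ 3 ^ 3 by ring, hω3, one_pow]) hu2
    have hcu : (starRingEnd ℂ) u = u ^ 2 := by
      rw [← Complex.inv_eq_conj (norm_of_pow (by norm_num) hu), inv_eq_of_mul_eq_one_right]
      linear_combination hu
    have hcω : (starRingEnd ℂ) (ξ 3) = ξ 3 ^ 2 := by rw [conj_xi_three, h3]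
    have hκR : -ζ⁻¹ * u ^ 2 ∈ adjoinZ (ξ 3) := mul_mem (neg_mem hζR) (pow_mem huR 2)
    rw [G632_2_eq]
    refine (equivalent_of_smul _ two_ne_zero (h.mem_iff_twist two_ne_zero ?_
      (conjMul (-ζ⁻¹ * u ^ 2)) (fun x hx => ?_) (fun x hx => ?_) hdouble)).trans
      (equivalent_twist (by norm_num) (k := -ζ * u * ξ 3 ^ 2) ?_ fun x => ?_)
    · rw [← one_add_one_eq_two]
      exact add_mem (one_mem _) (one_mem _)
    · rw [hR] at hx ⊢
      exact conjMul_mem hκR hx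
    · -- `u` and `ω u` form a basis of `ℤ[ω]`
      rw [hR] at hx
      obtain ⟨a, b, hab⟩ := mem_eis_iff.1 (mul_mem huR' hx)
      have hxab : x = a * u + b * (ξ 3 * u) := by
        have : x = u * (u⁻¹ * x) := by rw [mul_inv_cancel_left₀ hu0]
        rw [this, hab]
        ring
      convert add_mem (Λ.smul_mem a hu2) (Λ.smul_mem b huω) using 1
      rw [hxab]
      ext k
      fin_cases k
      · simp
        ring
      · simp [hcu, hcω]
        linear_combination (-(a * ζ⁻¹ * u / 2) - b * ζ⁻¹ * ξ 3 ^ 2 * u / 2) * hu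
    · rw [mul_pow, mul_pow, Even.neg_pow ⟨3, rfl⟩, hζ, hu6, ← pow_mul, mul_comm 2, pow_mul,
        pow_six_of_pow_three hω3]
      norm_num
    · simp only [conjMul_apply]
      have := mul_inv_cancel₀ hζ0
      linear_combination (-(ξ 3 ^ 2 * (starRingEnd ℂ) x * u ^ 3)) * this -
        ξ 3 ^ 2 * (starRingEnd ℂ) x * hu

/-! ### Comparison with the list -/

theorem div_cases {r p : ℕ} (hr : r = 3 ∨ r = 4 ∨ r = 6) (hpr : p ∣ r) (hrp : r ≠ p) :
    p = 1 ∨ (r = 4 ∧ p = 2) ∨ (r = 6 ∧ p = 2) ∨ (r = 6 ∧ p = 3) := by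
  have hp : p ≤ 6 := (Nat.le_of_dvd (by omega) hpr).trans (by omega)
  obtain ⟨k, hk⟩ := hpr
  interval_cases p <;> omega

theorem isOnList_sumLattice_one {n r p : ℕ} (hn : 2 ≤ n) (hr : r = 3 ∨ r = 4 ∨ r = 6)
    (hpr : p ∣ r) (hrp : r ≠ p) : IsOnList (semidirect (G r p n) (sumLattice r n 1)) := by
  refine Or.inr (Or.inl ⟨hn, ?_⟩)
  have h1 : p = 1 → semidirect (G r p n) (sumLattice r n 1) = Gr1n_1 r n := by
    rintro rfl
    exact (Gr1n_1_eq r (by omega)).symm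
  have h6 : r = 6 → semidirect (G r p n) (sumLattice r n 1) = Grpn_1 6 p n := by
    rintro rfl
    rw [← sumLattice_six, Grpn_1_eq 6 p hn]
  have refl : ∀ W W' : Subgroup (Aff n), W = W' → Equivalent W W' := by
    rintro W _ rfl
    exact Equivalent.refl W
  rcases div_cases hr hpr hrp with rfl | ⟨rfl, rfl⟩ | ⟨rfl, rfl⟩ | ⟨rfl, rfl⟩
  · rcases hr with rfl | rfl | rfl
    · exact Or.inl (refl _ _ (h1 rfl))
    · exact Or.inr (Or.inl (refl _ _ (h1 rfl)))
    · exact Or.inr (Or.inr (Or.inr (Or.inl (refl _ _ (h1 rfl)))))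
  · exact Or.inr (Or.inr (Or.inr (Or.inr (Or.inr (Or.inl (refl _ _ (G42n_2_eq hn).symm))))))
  · exact Or.inr (Or.inr (Or.inr (Or.inr (Or.inr (Or.inr (Or.inl (refl _ _ (h6 rfl))))))))
  · exact Or.inr (Or.inr (Or.inr (Or.inr (Or.inr (Or.inr (Or.inr (refl _ _ (h6 rfl))))))))

theorem IsOnList.of_equivalent {n : ℕ} {W W' : Subgroup (Aff n)} (h : Equivalent W W')
    (hW : IsOnList W') : IsOnList W := by
  rcases hW with ⟨hn, r, hr, h1⟩ | ⟨hn, h1⟩ | ⟨hn, h1⟩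
  · exact Or.inl ⟨hn, r, hr, h.trans h1⟩
  · refine Or.inr (Or.inl ⟨hn, ?_⟩)
    rcases h1 with h1 | h1 | h1 | h1 | h1 | h1 | h1 | h1
    · exact Or.inl (h.trans h1)
    · exact Or.inr (Or.inl (h.trans h1))
    · exact Or.inr (Or.inr (Or.inl (h.trans h1)))
    · exact Or.inr (Or.inr (Or.inr (Or.inl (h.trans h1))))
    · exact Or.inr (Or.inr (Or.inr (Or.inr (Or.inl (h.trans h1)))))
    · exact Or.inr (Or.inr (Or.inr (Or.inr (Or.inr (Or.inl (h.trans h1))))))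
    · exact Or.inr (Or.inr (Or.inr (Or.inr (Or.inr (Or.inr (Or.inl (h.trans h1)))))))
    · exact Or.inr (Or.inr (Or.inr (Or.inr (Or.inr (Or.inr (Or.inr (h.trans h1)))))))
  · exact Or.inr (Or.inr ⟨hn, h1.imp h.trans h.trans⟩)

theorem IsNormalized.classification {n r p : ℕ} (hr : r = 3 ∨ r = 4 ∨ r = 6) (hpr : p ∣ r)
    (hrp : r ≠ p) (hn : 2 ≤ n) {Λ : Submodule ℤ (Cn n)} (h : IsNormalized r p Λ) :
    IsOnList (semidirect (G r p n) Λ) ∨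
      (2 ≤ n ∧ Equivalent (semidirect (G r p n) Λ) (Gr1n_2 3 n)) ∨
      (n = 2 ∧ Equivalent (semidirect (G r p n) Λ) (G632_2 n)) := by
  have hG : p = 2 → r = 4 → Equivalent (semidirect (G r p n) Λ) (Grpn_1 4 2 n) →
      IsOnList (semidirect (G r p n) Λ) := fun _ _ he =>
    Or.inr (Or.inl ⟨hn, Or.inr (Or.inr (Or.inr (Or.inr (Or.inl he))))⟩)
  have hlist : p ∣ r → Equivalent (semidirect (G r p n) Λ) (semidirect (G r p n)
      (sumLattice r n 1)) → IsOnList (semidirect (G r p n) Λ) := fun hpr he =>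
    (isOnList_sumLattice_one hn hr hpr hrp).of_equivalent he
  by_cases hnp : 3 ≤ n ∨ p = 1
  · rcases h.classification_homogeneous hr hnp hn with h1 | h1
    · rw [h1]
      exact Or.inl (isOnList_sumLattice_one hn hr hpr hrp)
    · have h2 := equivalent_of_smul (G r p n) (one_sub_xi_ne_zero hr) h1
      by_cases h6 : r = 6
      · subst h6
        rw [sumLattice_six] at h2
        exact Or.inl (hlist hpr h2)
      rcases div_cases hr hpr hrp with rfl | ⟨rfl, rfl⟩ | ⟨rfl, rfl⟩ | ⟨rfl, rfl⟩
      · have he := h2.trans (Gr1n_2_equivalent (one_sub_xi_ne_zero hr) (by omega))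
        rcases hr with rfl | rfl | rfl
        · exact Or.inr (Or.inl ⟨hn, he⟩)
        · exact Or.inl (Or.inr (Or.inl ⟨hn, Or.inr (Or.inr (Or.inl he))⟩))
        · exact absurd rfl h6
      · rw [← Grpn_1_eq 4 2 hn] at h2
        exact Or.inl (hG rfl rfl h2)
      · exact absurd rfl h6
      · exact absurd rfl h6
  · push Not at hnp
    obtain rfl : n = 2 := by omega
    rcases div_cases hr hpr hrp with rfl | ⟨rfl, rfl⟩ | ⟨rfl, rfl⟩ | ⟨rfl, rfl⟩
    · exact absurd rfl hnp.2
    · rcases h.classification_42 with h1 | h1 | h1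
      · exact Or.inl (hlist hpr (by rwa [← G42n_2_eq le_rfl]))
      · exact Or.inl (hG rfl rfl h1)
      · exact Or.inl (Or.inr (Or.inr ⟨rfl, Or.inl h1⟩))
    · rcases h.classification_62 with h1 | h1
      · exact Or.inl (hlist hpr (by rwa [← sumLattice_six, ← Grpn_1_eq 6 2 le_rfl]))
      · exact Or.inl (Or.inr (Or.inr ⟨rfl, Or.inr h1⟩))
    · rcases h.classification_63 with h1 | h1
      · exact Or.inl (hlist hpr (by rwa [← sumLattice_six, ← Grpn_1_eq 6 3 le_rfl]))
      · exact Or.inr (Or.inr ⟨rfl, h1⟩)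

/-- Every group on the list has the Steinberg property. -/
theorem IsOnList.steinberg {n : ℕ} {W : Subgroup (Aff n)} (hW : IsIsometric W) (h : IsOnList W) :
    SteinbergProperty W := by
  have transfer : ∀ (r p : ℕ) (Λ : Submodule ℤ (Cn n)), r ≠ 0 →
      SteinbergProperty (semidirect (G r p n) Λ) → ∀ W', W' = semidirect (G r p n) Λ →
      Equivalent W W' → SteinbergProperty W := by
    rintro r p Λ hr hS _ rfl he
    exact he.symm.steinberg (isIsometric_semidirect hr p n Λ) hW hS
  have h1 : ∀ r, r ≠ 0 → 1 ≤ n → Equivalent W (Gr1n_1 r n) → SteinbergProperty W := fun r hr hn =>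
    transfer r 1 _ hr (steinberg_sum_one hr n) _ (Gr1n_1_eq r hn)
  have h6 : ∀ p, (p = 2 ∨ p = 3) → 2 ≤ n → Equivalent W (Grpn_1 6 p n) → SteinbergProperty W :=
    fun p hp hn => transfer 6 p _ (by norm_num) (steinberg_six hp n) _
      (by rw [Grpn_1_eq 6 p hn, sumLattice_six])
  rcases h with ⟨hn, r, hr, he⟩ | ⟨hn, he⟩ | ⟨rfl, he⟩
  · exact h1 r (by omega) hn.ge he
  · have hn1 : 1 ≤ n := by omega
    rcases he with he | he | he | he | he | he | he | he
    · exact h1 3 (by norm_num) hn1 he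
    · exact h1 4 (by norm_num) hn1 he
    · exact transfer 4 1 _ (by norm_num) (steinberg_gauss (Or.inl rfl) n (Or.inr rfl)) _ rfl
        (he.trans (Gr1n_2_equivalent (one_sub_xi_ne_zero (by norm_num)) hn1).symm)
    · exact h1 6 (by norm_num) hn1 he
    · exact transfer 4 2 _ (by norm_num) (steinberg_gauss (Or.inr rfl) n (Or.inr rfl)) _
        (Grpn_1_eq 4 2 hn) he
    · exact transfer 4 2 _ (by norm_num) (steinberg_gauss (Or.inr rfl) n (Or.inl rfl)) _
        (G42n_2_eq hn) he
    · exact h6 2 (Or.inl rfl) hn he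
    · exact h6 3 (Or.inr rfl) hn he
  · rcases he with he | he
    · exact transfer 4 2 _ (by norm_num) steinberg_gauss_twist _ Gr22_extra_four_eq he
    · exact transfer 6 2 _ (by norm_num) steinberg_eis_twist _ Gr22_extra_six_eq he

/-! ### Normalization of a lattice by a homothety -/

/-- The lattice `c⁻¹ Λ`. -/
def scaled {n : ℕ} (c : ℂ) (Λ : Submodule ℤ (Cn n)) : Submodule ℤ (Cn n) :=
  Λ.comap ((LinearMap.lsmul ℂ (Cn n) c).restrictScalars ℤ)

theorem mem_scaled {n : ℕ} {c : ℂ} {Λ : Submodule ℤ (Cn n)} {v : Cn n} :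
    v ∈ scaled c Λ ↔ c • v ∈ Λ := Iff.rfl

theorem scaled_lines {n r : ℕ} {c : ℂ} (hc : c ≠ 0) {Λ : Submodule ℤ (Cn n)}
    (h : Λ ≤ Submodule.span ℤ (lineVectors r Λ)) :
    scaled c Λ ≤ Submodule.span ℤ (lineVectors r (scaled c Λ)) := by
  have h' : Λ ≤ scaled c⁻¹ (Submodule.span ℤ (lineVectors r (scaled c Λ))) := by
    refine h.trans (Submodule.span_le.2 ?_)
    rintro b ⟨hb, hline⟩
    refine Submodule.subset_span ⟨?_, ?_⟩
    · show c • c⁻¹ • b ∈ Λ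
      rwa [smul_inv_smul₀ hc]
    · rcases hline with ⟨i, a, rfl⟩ | ⟨i, j, ζ, a, hij, hζ, rfl⟩
      · refine Or.inl ⟨i, c⁻¹ * a, ?_⟩
        ext k
        simp
      · refine Or.inr ⟨i, j, ζ, c⁻¹ * a, hij, hζ, ?_⟩
        ext k
        simp [mul_sub, mul_left_comm]
  intro v hv
  have : c⁻¹ • c • v ∈ Submodule.span ℤ (lineVectors r (scaled c Λ)) := h' hv
  rwa [inv_smul_smul₀ hc] at this

theorem single_mem_of_single_mem {n r p : ℕ} (hr : r ≠ 0) {Λ : Submodule ℤ (Cn n)}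
    (hΛ : IsInvariant (G r p n) Λ) (i j : Fin n) (c : ℂ) (h : EuclideanSpace.single i c ∈ Λ) :
    EuclideanSpace.single j c ∈ Λ := by
  refine hΛ.monomial_mem hr (Equiv.swap i j) (fun _ => 1) (by simp) (by simp) h fun k => ?_
  simp only [one_mul, PiLp.single_apply, Equiv.swap_apply_eq_iff, Equiv.swap_apply_left]

/-- The lattice is rescaled by a generator of its intersection with an axis. -/
theorem exists_normalized {n r p : ℕ} (hr : r = 3 ∨ r = 4 ∨ r = 6) {Λ : Submodule ℤ (Cn n)}
    [DiscreteTopology Λ] (hΛ : IsInvariant (G r p n) Λ)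
    (hgen : Λ ≤ Submodule.span ℤ (lineVectors r Λ)) (i : Fin n)
    (hne : ∃ x ∈ axisCoeffs Λ i, x ≠ 0) (hξ : ∀ x ∈ axisCoeffs Λ i, ξ r * x ∈ axisCoeffs Λ i) :
    ∃ Λ' : Submodule ℤ (Cn n), IsNormalized r p Λ' ∧
      Equivalent (semidirect (G r p n) Λ) (semidirect (G r p n) Λ') := by
  obtain ⟨ε, hε, hN⟩ := axisCoeffs_discrete Λ i
  obtain ⟨c, hc, h⟩ := exists_generator hr _ hε hN hne hξ
  refine ⟨scaled c Λ, ⟨fun A hA v hv => ?_, scaled_lines hc hgen, fun j x => ?_⟩, ?_⟩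
  · rw [mem_scaled, ← map_smul]
    exact hΛ A hA _ hv
  · rw [← h, mem_axisCoeffs, mem_scaled]
    have : c • EuclideanSpace.single j x = EuclideanSpace.single j (x * c) := by
      ext k
      simp [mul_comm]
    rw [this]
    exact ⟨single_mem_of_single_mem (by omega) hΛ j i _, single_mem_of_single_mem (by omega) hΛ i j _⟩
  · refine equivalent_of_smul _ (inv_ne_zero hc) fun v => ?_
    rw [mem_scaled, smul_inv_smul₀ hc]

/-- The differences `v - diag(1, …, η, …, 1) v` of vectors of `Λ` lie on the axes. -/
theorem exists_axis_ne_zero {n r p : ℕ} (hr : r ≠ 0) (hpr : p ∣ r) (hrp : r ≠ p)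
    {Λ : Submodule ℤ (Cn n)} [DiscreteTopology Λ] [IsZLattice ℝ Λ]
    (hΛ : IsInvariant (G r p n) Λ) (i : Fin n) : ∃ x ∈ axisCoeffs Λ i, x ≠ 0 := by
  have hi : coord i ≠ 0 := fun h => by
    have := LinearMap.congr_fun h (EuclideanSpace.single i 1)
    simp at this
  obtain ⟨v, hv, hvi⟩ := exists_mem_apply_ne_zero Λ (coord i) hi
  rw [coord_apply] at hvi
  have hp : p ≠ 0 := fun h => hr (by rwa [h, zero_dvd_iff] at hpr)
  obtain ⟨q, rfl⟩ := hpr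
  have hq : p * q / p = q := Nat.mul_div_cancel_left q (Nat.pos_of_ne_zero hp)
  have hq0 : q ≠ 0 := fun h => hr (by rw [h, mul_zero])
  have hq1 : 1 < q := by
    rcases Nat.lt_or_ge 1 q with h | h
    · exact h
    · exact absurd (by rw [show q = 1 by omega, mul_one]) hrp
  have hη := xi_pow hq0
  refine ⟨(1 - ξ q) * v i, ?_, mul_ne_zero (sub_ne_zero.2
    ((xi_isPrimitiveRoot hq0).ne_one hq1).symm) hvi⟩
  rw [mem_axisCoeffs]
  have := hΛ.monomial_mem hr 1 (Function.update 1 i (ξ q)) (w := WithLp.toLp 2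
      fun k => Function.update (1 : Fin n → ℂ) i (ξ q) k * v k) (fun k => ?_) ?_ hv fun k => rfl
  · convert Λ.sub_mem hv this using 1
    ext k
    rcases eq_or_ne k i with rfl | hk
    · simp
      ring
    · simp [hk]
  · rcases eq_or_ne k i with rfl | hk
    · rw [Function.update_self, mul_comm, pow_mul, hη, one_pow]
    · simp [hk]
  · rw [Finset.prod_update_of_mem (Finset.mem_univ i), hq]
    simp [hη]

/-- For `n ≥ 2` one entry of a diagonal matrix in `G(r,p,n)` can be compensated by another one. -/
theorem axis_xi_stable {n r p : ℕ} (hr : r ≠ 0) {Λ : Submodule ℤ (Cn n)}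
    (hΛ : IsInvariant (G r p n) Λ) {i j : Fin n} (hij : i ≠ j) :
    ∀ x ∈ axisCoeffs Λ i, ξ r * x ∈ axisCoeffs Λ i := by
  intro x hx
  rw [mem_axisCoeffs] at *
  have h1 := xi_pow hr
  have h0 := ne_zero_of_pow hr h1
  refine hΛ.monomial_mem hr 1 (Function.update (Function.update 1 j (ξ r)⁻¹) i (ξ r)) (fun k => ?_)
    ?_ hx fun k => ?_
  · rcases eq_or_ne k i with rfl | hk
    · simpa using h1
    · rcases eq_or_ne k j with rfl | hk'
      · simp [hk, h1]
      · simp [hk, hk']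
  · rw [Finset.prod_update_of_mem (Finset.mem_univ i),
      Finset.prod_update_of_mem (by simpa using hij.symm)]
    simp [h0]
  · rcases eq_or_ne k i with rfl | hk
    · simp
    · simp [hk]

/-- For `r ≥ 3`, `r ≠ p` and `n ≥ 2` every group generated by reflections is on the list, or is one
of the two exceptions. -/
theorem classification {n r p : ℕ} (hr : 3 ≤ r) (hpr : p ∣ r) (hrp : r ≠ p) (hn : 2 ≤ n)
    {Λ : Submodule ℤ (Cn n)} [DiscreteTopology Λ] [IsZLattice ℝ Λ]
    (hΛ : IsInvariant (G r p n) Λ)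
    (hrefl : IsGeneratedByReflections (semidirect (G r p n) Λ)) :
    IsOnList (semidirect (G r p n) Λ) ∨
      (2 ≤ n ∧ Equivalent (semidirect (G r p n) Λ) (Gr1n_2 3 n)) ∨
      (n = 2 ∧ Equivalent (semidirect (G r p n) Λ) (G632_2 n)) := by
  have hr0 : r ≠ 0 := by omega
  have hij : (⟨0, by omega⟩ : Fin n) ≠ ⟨1, by omega⟩ := by simp
  have hne := exists_axis_ne_zero hr0 hpr hrp hΛ ⟨0, by omega⟩
  have hξ := axis_xi_stable hr0 hΛ hij
  obtain ⟨ε, hε, hN⟩ := axisCoeffs_discrete Λ ⟨0, by omega⟩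
  have hr' := order_of_discrete hr _ hε hN hne hξ
  obtain ⟨Λ', h, he⟩ := exists_normalized hr' hΛ (le_span_lineVectors hr0 hΛ hrefl) _ hne hξ
  rcases h.classification hr' hpr hrp hn with h1 | ⟨_, h1⟩ | ⟨_, h1⟩
  · exact Or.inl (h1.of_equivalent he)
  · exact Or.inr (Or.inl ⟨hn, he.trans h1⟩)
  · exact Or.inr (Or.inr ⟨by assumption, he.trans h1⟩)

/-! ### Dimension one -/

theorem G_one {r p : ℕ} (hpr : p ∣ r) : G r p 1 = G (r / p) 1 1 := by
  ext A
  constructor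
  · rintro ⟨σ, d, h1, h2, h⟩
    refine ⟨σ, d, fun i => ?_, ?_, h⟩
    · rw [Subsingleton.elim i 0]
      simpa using h2
    · simpa using h2
  · rintro ⟨σ, d, h1, h2, h⟩
    refine ⟨σ, d, fun i => pow_eq_one_of_div hpr (h1 i), ?_, h⟩
    simpa using h2

/-- For `n = 1` the lattices are the homothetic images of `ℤ[ξ]`. -/
theorem isOnList_one {r p : ℕ} (hr : r ≠ 0) (hpr : p ∣ r) (hq : 3 ≤ r / p)
    {Λ : Submodule ℤ (Cn 1)} [DiscreteTopology Λ] [IsZLattice ℝ Λ]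
    (hΛ : IsInvariant (G r p 1) Λ) : IsOnList (semidirect (G r p 1) Λ) := by
  have hrp : r ≠ p := by
    rintro rfl
    rw [Nat.div_self (Nat.pos_of_ne_zero hr)] at hq
    omega
  have hne := exists_axis_ne_zero hr hpr hrp hΛ 0
  rw [G_one hpr] at hΛ ⊢
  set q := r / p
  have hq0 : q ≠ 0 := by omega
  have hξ : ∀ x ∈ axisCoeffs Λ 0, ξ q * x ∈ axisCoeffs Λ 0 := by
    intro x hx
    rw [mem_axisCoeffs] at *
    refine hΛ.monomial_mem hq0 1 (fun _ => ξ q) (fun _ => xi_pow hq0) (by simp [xi_pow hq0]) hx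
      fun k => ?_
    rw [Subsingleton.elim k 0]
    simp
  obtain ⟨ε, hε, hN⟩ := axisCoeffs_discrete Λ 0
  have hq' := order_of_discrete hq _ hε hN hne hξ
  obtain ⟨c, hc, h⟩ := exists_generator hq' _ hε hN hne hξ
  refine Or.inl ⟨rfl, q, hq', ?_⟩
  rw [Gr1n_1_eq q le_rfl]
  refine equivalent_of_smul _ (inv_ne_zero hc) fun v => ?_
  have hv : v = EuclideanSpace.single 0 ((c⁻¹ • v) 0 * c) := by
    ext k
    rw [Subsingleton.elim k 0]
    simp
    field_simp
  rw [mem_sumLattice_one, Fin.forall_fin_one, ← h, mem_axisCoeffs, ← hv]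

/-! ### Complexification of real reflection groups -/

theorem finite_G {r : ℕ} (hr : r ≠ 0) (p n : ℕ) : Finite (G r p n) := by
  have : Finite {z : ℂ // z ^ r = 1} := by
    refine Set.Finite.subset (Polynomial.nthRootsFinset r (1 : ℂ)).finite_toSet fun z hz => ?_
    exact (Polynomial.mem_nthRootsFinset (Nat.pos_of_ne_zero hr) (1 : ℂ)).2 hz
  choose σ d h1 _ h using fun A : G r p n => A.2
  refine Finite.of_injective (β := Equiv.Perm (Fin n) × (Fin n → {z : ℂ // z ^ r = 1}))
    (fun A => (σ A, fun i => ⟨d A i, h1 A i⟩)) fun A B hAB => ?_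
  simp only [Prod.mk.injEq, funext_iff, Subtype.mk.injEq] at hAB
  ext v i
  rw [h A v i, h B v i, hAB.1, hAB.2]

/-- The reflection `w ↦ w - (b ⬝ w) a` of `ℝⁿ`, for `b ⬝ a = 2`. -/
def realReflection {n : ℕ} (a b : Fin n → ℝ) (h : b ⬝ᵥ a = 2) : GL (Fin n) ℝ :=
  have key : (1 - Matrix.vecMulVec a b) * (1 - Matrix.vecMulVec a b) = 1 := by
    rw [mul_sub, mul_one, sub_mul, one_mul, Matrix.vecMulVec_mul_vecMulVec, h, two_smul,
      Matrix.vecMulVec_add]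
    abel
  ⟨1 - Matrix.vecMulVec a b, 1 - Matrix.vecMulVec a b, key, key⟩

theorem isRealReflection_realReflection {n : ℕ} (a b : Fin n → ℝ) (h : b ⬝ᵥ a = 2) :
    IsRealReflection (realReflection a b h) := by
  refine ⟨Units.ext (realReflection a b h).3, ?_⟩
  have h1 : ((realReflection a b h : GL (Fin n) ℝ) : Matrix (Fin n) (Fin n) ℝ) - 1 =
      Matrix.vecMulVec (-a) b := by
    simp [realReflection, Matrix.neg_vecMulVec]
  rw [h1]
  refine le_antisymm (Matrix.rank_vecMulVec_le _ _) (Nat.one_le_iff_ne_zero.2 fun h0 => ?_)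
  rw [Matrix.rank, Submodule.finrank_eq_zero, LinearMap.range_eq_bot] at h0
  have := congrArg Matrix.trace (Matrix.toLin'.map_eq_zero_iff.1 h0)
  rw [Matrix.trace_vecMulVec, neg_dotProduct, dotProduct_comm, h] at this
  norm_num at this

/-- The complexification of a real matrix, transported to `ℂⁿ` by a coordinate system `P`. -/
def complexify {n : ℕ} (P : Cn n ≃ₗ[ℂ] (Fin n → ℂ)) : GL (Fin n) ℝ →* Lin n where
  toFun h :=
    { toFun := fun v => P.symm (((h : Matrix (Fin n) (Fin n) ℝ).map Complex.ofReal).mulVec (P v))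
      invFun := fun v =>
        P.symm ((((h⁻¹ : GL (Fin n) ℝ) : Matrix (Fin n) (Fin n) ℝ).map Complex.ofReal).mulVec (P v))
      map_add' := fun v w => by rw [map_add, Matrix.mulVec_add, map_add]
      map_smul' := fun c v => by rw [map_smul, Matrix.mulVec_smul, map_smul, RingHom.id_apply]
      left_inv := fun v => by
        have := Matrix.map_mul (L := ((h⁻¹ : GL (Fin n) ℝ) : Matrix (Fin n) (Fin n) ℝ))
          (M := (h : Matrix (Fin n) (Fin n) ℝ)) (f := Complex.ofRealHom)
        rw [← Units.val_mul, inv_mul_cancel] at this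
        simp only [Complex.ofRealHom, RingHom.coe_mk, MonoidHom.coe_mk, OneHom.coe_mk] at this
        dsimp only
        rw [LinearEquiv.apply_symm_apply, Matrix.mulVec_mulVec, ← this]
        simp
      right_inv := fun v => by
        have := Matrix.map_mul (M := ((h⁻¹ : GL (Fin n) ℝ) : Matrix (Fin n) (Fin n) ℝ))
          (L := (h : Matrix (Fin n) (Fin n) ℝ)) (f := Complex.ofRealHom)
        rw [← Units.val_mul, mul_inv_cancel] at this
        simp only [Complex.ofRealHom, RingHom.coe_mk, MonoidHom.coe_mk, OneHom.coe_mk] at this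
        dsimp only
        rw [LinearEquiv.apply_symm_apply, Matrix.mulVec_mulVec, ← this]
        simp }
  map_one' := by
    ext v i
    simp
  map_mul' h k := by
    have := Matrix.map_mul (L := (h : Matrix (Fin n) (Fin n) ℝ))
      (M := (k : Matrix (Fin n) (Fin n) ℝ)) (f := Complex.ofRealHom)
    simp only [Complex.ofRealHom, RingHom.coe_mk, MonoidHom.coe_mk, OneHom.coe_mk] at this
    ext v i
    simp [LinearEquiv.mul_apply, this]

theorem apply_complexify {n : ℕ} (P : Cn n ≃ₗ[ℂ] (Fin n → ℂ)) (h : GL (Fin n) ℝ) (v : Cn n) :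
    P (complexify P h v) =
      ((h : Matrix (Fin n) (Fin n) ℝ).map Complex.ofReal).mulVec (P v) :=
  P.apply_symm_apply _

theorem complexify_injective {n : ℕ} (P : Cn n ≃ₗ[ℂ] (Fin n → ℂ)) :
    Function.Injective (complexify P) := by
  intro h k hk
  ext i j
  have := congrArg P (LinearEquiv.congr_fun hk (P.symm (Pi.single j 1)))
  rw [apply_complexify, apply_complexify, LinearEquiv.apply_symm_apply] at this
  simpa using congrFun this i

/-- A finite group generated by elements that act as real reflections in the coordinates `P` is
the complexification of a Coxeter group. -/
theorem isComplexifiedCoxeter_of_generated {n : ℕ} (K : Subgroup (Lin n)) [Finite K]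
    (P : Cn n ≃ₗ[ℂ] (Fin n → ℂ))
    (hgen : ∀ A ∈ K, A ∈ Subgroup.closure {s | s ∈ K ∧ ∃ a b : Fin n → ℝ, b ⬝ᵥ a = 2 ∧
      ∀ v i, P (s v) i = P v i - (∑ j, b j * P v j) * a i}) :
    IsComplexifiedCoxeter K := by
  have hle : K ≤ (Subgroup.closure {h | h ∈ K.comap (complexify P) ∧ IsRealReflection h}).map
      (complexify P) := by
    intro A hA
    refine (Subgroup.closure_le _).2 ?_ (hgen A hA)
    rintro s ⟨hs, a, b, hab, h⟩
    have hsr : complexify P (realReflection a b hab) = s := by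
      apply LinearEquiv.ext
      intro v
      apply P.injective
      rw [apply_complexify]
      ext i
      rw [h]
      simp only [Matrix.mulVec, dotProduct, realReflection, Matrix.map_apply, Matrix.sub_apply,
        Matrix.vecMulVec_apply, Complex.ofReal_sub, Complex.ofReal_mul, sub_mul,
        Finset.sum_sub_distrib, Finset.sum_mul]
      congr 1
      · simp [Matrix.one_apply, apply_ite Complex.ofReal]
      · exact Finset.sum_congr rfl fun j _ => by ring
    refine ⟨_, Subgroup.subset_closure ⟨?_, isRealReflection_realReflection a b hab⟩, hsr⟩
    rw [Subgroup.mem_comap, hsr]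
    exact hs
  refine ⟨K.comap (complexify P), ?_, le_antisymm ?_ fun h hh => ?_, P, fun A => ⟨fun hA => ?_, ?_⟩⟩
  · exact Finite.of_injective
      (fun h : K.comap (complexify P) => (⟨complexify P h, h.2⟩ : K)) fun h k hk =>
        Subtype.ext (complexify_injective P (congrArg Subtype.val hk))
  · exact (Subgroup.closure_le _).2 fun h hh => hh.1
  · obtain ⟨k, hk, hkh⟩ := hle hh
    rwa [← complexify_injective P hkh]
  · obtain ⟨h, -, rfl⟩ := hle hA
    exact ⟨h, hA, apply_complexify P h⟩
  · rintro ⟨h, hh, hA⟩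
    have : A = complexify P h := by
      apply LinearEquiv.ext
      intro v
      apply P.injective
      rw [hA, apply_complexify]
    rw [this]
    exact hh

/-! ### The dihedral groups `G(r,r,2)` -/

/-- The coordinates `(x + y) / 2`, `(x - y) / 2i` of `ℂ²`. -/
def dihedralCoords : Cn 2 ≃ₗ[ℂ] (Fin 2 → ℂ) where
  toFun v := ![(v 0 + v 1) / 2, (v 0 - v 1) / (2 * Complex.I)]
  invFun w := !₂[w 0 + Complex.I * w 1, w 0 - Complex.I * w 1]
  map_add' v w := by
    ext i
    fin_cases i
    · simp
      ring
    · simp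
      ring
  map_smul' c v := by
    ext i
    fin_cases i
    · simp
      ring
    · simp
      ring
  left_inv v := by
    have := Complex.I_ne_zero
    ext i
    fin_cases i
    · simp
      field_simp
      ring
    · simp
      field_simp
      ring
  right_inv w := by
    have := Complex.I_ne_zero
    ext i
    fin_cases i
    · simp
    · simp
      field_simp
      ring

/-- In the coordinates `dihedralCoords` the reflections of `G(r,r,2)` are real. -/
theorem dihedral_reflection {r : ℕ} (hr : r ≠ 0) {d : ℂ} (hd : d ^ r = 1) {s : Lin 2}
    (h0 : ∀ v, s v 0 = d * v 1) (h1 : ∀ v, s v 1 = d⁻¹ * v 0) :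
    ∃ a b : Fin 2 → ℝ, b ⬝ᵥ a = 2 ∧ ∀ v i, dihedralCoords (s v) i =
      dihedralCoords v i - (∑ j, b j * dihedralCoords v j) * a i := by
  have hd0 := ne_zero_of_pow hr hd
  -- a square root of `d` gives the half angle
  obtain ⟨α, β, hαβ, hdz⟩ : ∃ α β : ℝ, α ^ 2 + β ^ 2 = 1 ∧ d = (α + β * Complex.I) ^ 2 := by
    obtain ⟨z, hz⟩ := IsAlgClosed.exists_pow_nat_eq d (n := 2) two_pos
    have hzn : ‖z‖ = 1 := norm_of_pow (r := 2 * r) (by omega) (by rw [pow_mul, hz, hd])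
    refine ⟨z.re, z.im, ?_, by rw [Complex.re_add_im, hz]⟩
    have := Complex.normSq_apply z
    rw [Complex.normSq_eq_norm_sq, hzn] at this
    linarith
  have hzc : (α : ℂ) ^ 2 + (β : ℂ) ^ 2 = 1 := by exact_mod_cast hαβ
  have hI := Complex.I_sq
  have hdz' : d⁻¹ = (α - β * Complex.I) ^ 2 := by
    apply inv_eq_of_mul_eq_one_right
    rw [hdz]
    have : ((α : ℂ) + β * Complex.I) * (α - β * Complex.I) = 1 := by
      linear_combination hzc - (β : ℂ) ^ 2 * hI
    rw [← mul_pow, this, one_pow]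
  have hdiv : ∀ x : ℂ, x / (2 * Complex.I) = -Complex.I * x / 2 := by
    intro x
    have := Complex.I_ne_zero
    field_simp
    linear_combination x * hI
  refine ⟨![β, -α], ![2 * β, -2 * α], ?_, fun v i => ?_⟩
  · simp [dotProduct, Fin.sum_univ_two]
    linarith
  · simp only [dihedralCoords, LinearEquiv.coe_mk, LinearMap.coe_mk, AddHom.coe_mk,
      Fin.sum_univ_two, Matrix.cons_val_zero, Matrix.cons_val_one, hdiv, h0, h1, hdz']
    rw [hdz]
    fin_cases i
    · simp
      linear_combination (v 0 + v 1) / 2 * hzc + (β : ℂ) ^ 2 * (v 0 + v 1) / 2 * hI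
    · simp
      linear_combination -Complex.I * (v 0 - v 1) / 2 * hzc +
        (Complex.I * (v 0 - v 1) / 2 * (β : ℂ) ^ 2 - α * β * (v 0 + v 1)) * hI

theorem isComplexifiedCoxeter_dihedral {r : ℕ} (hr : r ≠ 0) : IsComplexifiedCoxeter (G r r 2) := by
  have := finite_G hr r 2
  refine isComplexifiedCoxeter_of_generated _ dihedralCoords ?_
  rintro A ⟨σ, d, hd, hd', hA⟩
  rw [Nat.div_self (Nat.pos_of_ne_zero hr), pow_one, Fin.prod_univ_two] at hd'
  have h0 := fun i => ne_zero_of_pow hr (hd i)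
  have h1 : d 1 = (d 0)⁻¹ := (inv_eq_of_mul_eq_one_right hd').symm
  have hswap : ∀ {k : ℂ} {s : Lin 2}, s ∈ G r r 2 → k ^ r = 1 → (∀ v, s v 0 = k * v 1) →
      (∀ v, s v 1 = k⁻¹ * v 0) → s ∈ Subgroup.closure {s | s ∈ G r r 2 ∧
        ∃ a b : Fin 2 → ℝ, b ⬝ᵥ a = 2 ∧ ∀ v i, dihedralCoords (s v) i =
          dihedralCoords v i - (∑ j, b j * dihedralCoords v j) * a i} :=
    fun hs hk h h' => Subgroup.subset_closure ⟨hs, dihedral_reflection hr hk h h'⟩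
  rcases perm_fin_two σ with rfl | rfl
  · -- a rotation is a product of two reflections
    have hm : ∀ k : ℂ, k ^ r = 1 → ∀ hk0, monomial (Equiv.swap 0 1) ![k, k⁻¹] hk0 ∈ G r r 2 := by
      intro k hk hk0
      refine monomial_mem_G _ _ _ (fun i => ?_) ?_
      · fin_cases i
        · exact hk
        · simp [hk]
      · simp [Fin.prod_univ_two, ne_zero_of_pow hr hk]
    have hk0 : ∀ k : ℂ, k ≠ 0 → ∀ i, ![k, k⁻¹] i ≠ 0 := by
      intro k hk i
      fin_cases i <;> simp [hk]
    have : A = monomial (Equiv.swap 0 1) ![d 0, (d 0)⁻¹] (hk0 _ (h0 0)) *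
        monomial (Equiv.swap 0 1) ![1, 1⁻¹] (hk0 _ one_ne_zero) := by
      ext v i
      rw [hA, LinearEquiv.mul_apply]
      fin_cases i <;> simp [h1]
    rw [this]
    refine mul_mem (hswap (hm _ (hd 0) _) (hd 0) ?_ ?_) (hswap (hm _ (one_pow r) _) (one_pow r) ?_ ?_)
      <;> intro v <;> simp
  · exact hswap ⟨_, d, hd, by
      rw [Nat.div_self (Nat.pos_of_ne_zero hr), pow_one, Fin.prod_univ_two, hd'], hA⟩ (hd 0)
      (fun v => by simp [hA]) (fun v => by simp [hA, h1])

/-! ### The groups of signed permutations -/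

/-- The identity coordinates of `ℂⁿ`. -/
abbrev stdCoords (n : ℕ) : Cn n ≃ₗ[ℂ] (Fin n → ℂ) := WithLp.linearEquiv 2 ℂ (Fin n → ℂ)

/-- The transformation that exchanges two coordinates and multiplies both by `ε = ±1`. -/
def signedSwap {n : ℕ} (i j : Fin n) (ε : ℝ) (hε : ε ^ 2 = 1) : Lin n :=
  monomial (Equiv.swap i j) (Function.update (Function.update 1 j (ε : ℂ)) i ε) fun k => by
    have : (ε : ℂ) ≠ 0 := by
      rintro h
      rw [Complex.ofReal_eq_zero.1 h] at hε
      norm_num at hε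
    rcases eq_or_ne k i with rfl | hk
    · simpa using this
    · rcases eq_or_ne k j with rfl | hk' <;> simp_all

theorem signedSwap_apply {n : ℕ} (i j : Fin n) (ε : ℝ) (hε : ε ^ 2 = 1) (v : Cn n) (k : Fin n) :
    signedSwap i j ε hε v k = if k = i then ε * v j else if k = j then ε * v i else v k := by
  rw [signedSwap, monomial_apply]
  split_ifs with h h'
  · simp [h]
  · subst h'
    simp [h]
  · simp [h, h', Equiv.swap_apply_of_ne_of_ne h h']

theorem signedSwap_mem {n r p : ℕ} {i j : Fin n} (hij : i ≠ j) (ε : ℝ) (hε : ε ^ 2 = 1)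
    (hεr : (ε : ℂ) ^ r = 1) : signedSwap i j ε hε ∈ G r p n := by
  refine monomial_mem_G _ _ _ (fun k => ?_) ?_
  · rcases eq_or_ne k i with rfl | hk
    · simpa using hεr
    · rcases eq_or_ne k j with rfl | hk' <;> simp_all
  · rw [Finset.prod_update_of_mem (Finset.mem_univ i),
      Finset.prod_update_of_mem (by simpa using hij.symm)]
    have : (ε : ℂ) * ε = 1 := by
      rw [← sq]
      exact_mod_cast hε
    simp [this]

theorem signedSwap_reflection {n : ℕ} {i j : Fin n} (hij : i ≠ j) (ε : ℝ) (hε : ε ^ 2 = 1) :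
    ∃ a b : Fin n → ℝ, b ⬝ᵥ a = 2 ∧ ∀ v k, stdCoords n (signedSwap i j ε hε v) k =
      stdCoords n v k - (∑ l, b l * stdCoords n v l) * a k := by
  have hε' : (ε : ℂ) ^ 2 = 1 := by exact_mod_cast hε
  refine ⟨Pi.single i 1 - Pi.single j ε, Pi.single i 1 - Pi.single j ε, ?_, fun v k => ?_⟩
  · rw [dotProduct_sub, dotProduct_single, dotProduct_single]
    simp [hij, hij.symm]
    linarith
  · have hsum : ∑ l, (((Pi.single i 1 - Pi.single j ε : Fin n → ℝ) l : ℝ) : ℂ) * v l =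
        v i - ε * v j := by
      simp [Pi.single_apply, sub_mul, apply_ite Complex.ofReal, Finset.sum_sub_distrib]
    have h : stdCoords n (signedSwap i j ε hε v) k = signedSwap i j ε hε v k := rfl
    have h' : ∀ l, stdCoords n v l = v l := fun _ => rfl
    simp only [h, h', hsum, signedSwap_apply]
    split_ifs with h1 h2
    · subst h1
      simp [hij]
    · subst h2
      simp [h1]
      linear_combination v k * hε'
    · simp [h1, h2]

theorem isComplexifiedCoxeter_sign {r p n : ℕ} (hr : r = 1 ∨ r = 2) :
    IsComplexifiedCoxeter (G r p n) := by
  have hr0 : r ≠ 0 := by omega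
  have := finite_G hr0 p n
  refine isComplexifiedCoxeter_of_generated _ (stdCoords n) ?_
  set C := Subgroup.closure {s | s ∈ G r p n ∧ ∃ a b : Fin n → ℝ, b ⬝ᵥ a = 2 ∧
      ∀ v i, stdCoords n (s v) i = stdCoords n v i - (∑ j, b j * stdCoords n v j) * a i}
  have hCK : ∀ s ∈ C, s ∈ G r p n := fun s hs =>
    (Subgroup.closure_le (G r p n)).2 (fun _ ht => ht.1) hs
  have hsign : ∀ z : ℂ, z ^ r = 1 → z = 1 ∨ z = -1 := by
    intro z hz
    rcases hr with rfl | rfl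
    · exact Or.inl (by simpa using hz)
    · exact sq_eq_one_iff.1 hz
  have hpair : ∀ i j, i ≠ j → ∀ ε : ℝ, ∀ hε : ε ^ 2 = 1, (ε : ℂ) ^ r = 1 →
      signedSwap i j ε hε ∈ C := fun i j hij ε hε hεr =>
    Subgroup.subset_closure ⟨signedSwap_mem hij ε hε hεr, signedSwap_reflection hij ε hε⟩
  have hperm : ∀ σ : Equiv.Perm (Fin n), monomial σ 1 (fun _ => one_ne_zero) ∈ C := by
    intro σ
    induction σ using Equiv.Perm.swap_induction_on with
    | one =>
      convert C.one_mem
      ext v i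
      simp
    | swap_mul f x y hxy ih =>
      convert mul_mem ih (hpair x y hxy 1 (one_pow 2) (by simp))
      ext v i
      simp [LinearEquiv.mul_apply, signedSwap_apply, Equiv.swap_apply_def]
      split_ifs <;> rfl
  -- two factors `-1` on the diagonal can be cancelled by two reflections
  have hdiag : ∀ m : ℕ, ∀ d : Fin n → ℂ, (Finset.univ.filter fun k => d k ≠ 1).card = m →
      (∀ k, d k ^ r = 1) → ∀ s ∈ G r p n, (∀ v k, s v k = d k * v k) → s ∈ C := by
    intro m
    induction m using Nat.strong_induction_on with
    | _ m ih =>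
      intro d hm hd s hs h
      by_cases h1 : ∃ i, d i ≠ 1
      swap
      · push Not at h1
        convert C.one_mem
        ext v i
        simp [h, h1]
      obtain ⟨i, hi⟩ := h1
      have hdi : d i = -1 := (hsign _ (hd i)).resolve_left hi
      by_cases h2 : ∃ j, i ≠ j ∧ d j ≠ 1
      · obtain ⟨j, hij, hj⟩ := h2
        have hdj : d j = -1 := (hsign _ (hd j)).resolve_left hj
        have hT : signedSwap i j (-1) (by norm_num) * signedSwap i j 1 (one_pow 2) ∈ C := by
          refine mul_mem (hpair i j hij _ _ ?_) (hpair i j hij _ _ (by simp))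
          have := hd i
          rw [hdi] at this
          simpa using this
        rw [← Subgroup.mul_mem_cancel_right C hT]
        refine ih _ ?_ (fun k => if k = i ∨ k = j then 1 else d k) rfl (fun k => ?_) _
          (mul_mem hs (hCK _ hT)) fun v k => ?_
        · rw [← hm]
          refine Finset.card_lt_card ⟨fun k => ?_, fun hle => ?_⟩
          · simp
          · have := hle (show i ∈ _ by simpa using hi)
            simp at this
        · split_ifs
          · exact one_pow r
          · exact hd k
        · rw [LinearEquiv.mul_apply, LinearEquiv.mul_apply, h, signedSwap_apply]
          simp only [signedSwap_apply]
          rcases eq_or_ne k i with rfl | hk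
          · simp [hdi, hij.symm]
          · rcases eq_or_ne k j with rfl | hk'
            · simp [hdj, hk]
            · simp [hk, hk']
      · push Not at h2
        refine Subgroup.subset_closure ⟨hs, Pi.single i 1, Pi.single i 2, by simp, fun v k => ?_⟩
        have hk : stdCoords n (s v) k = s v k := rfl
        have h' : ∀ l, stdCoords n v l = v l := fun _ => rfl
        rw [hk, h]
        simp only [h']
        rcases eq_or_ne i k with rfl | hik
        · simp [Pi.single_apply, apply_ite Complex.ofReal, hdi]
          ring
        · simp [hik, h2 k hik]
  rintro A ⟨σ, d, h1, h2, hA⟩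
  rw [← Subgroup.mul_mem_cancel_right C (hperm σ.symm)]
  refine hdiag _ d rfl h1 _ (mul_mem ⟨σ, d, h1, h2, hA⟩ (hCK _ (hperm _))) fun v k => ?_
  rw [LinearEquiv.mul_apply, hA]
  simp

theorem isComplexifiedCoxeter_one {r p : ℕ} (hr : r ≠ 0) (hpr : p ∣ r) (hq : r / p ≤ 2) :
    IsComplexifiedCoxeter (G r p 1) := by
  rw [G_one hpr]
  have : 0 < r / p := Nat.div_pos (Nat.le_of_dvd (Nat.pos_of_ne_zero hr) hpr)
    (Nat.pos_of_dvd_of_pos hpr (Nat.pos_of_ne_zero hr))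
  generalize r / p = q at *
  exact isComplexifiedCoxeter_sign (by omega)

/-! ### The two equivalences -/

theorem SteinbergProperty.conditions {r p n : ℕ} (hr : 3 ≤ r) (hn : 1 ≤ n) (hpr : p ∣ r)
    {Λ : Submodule ℤ (Cn n)} [DiscreteTopology Λ] [IsZLattice ℝ Λ]
    (hΛ : IsInvariant (G r p n) Λ) (hgenuine : ¬ IsComplexifiedCoxeter (G r p n))
    (hS : SteinbergProperty (semidirect (G r p n) Λ)) :
    r ≠ p ∧ ¬ (2 ≤ n ∧ Equivalent (semidirect (G r p n) Λ) (Gr1n_2 3 n)) ∧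
      ¬ (n = 2 ∧ Equivalent (semidirect (G r p n) Λ) (G632_2 n)) := by
  have hr0 : r ≠ 0 := by omega
  have hW := isIsometric_semidirect hr0 p n Λ
  refine ⟨?_, ?_, ?_⟩
  · rintro rfl
    rcases Nat.lt_or_ge n 3 with h | h
    · obtain rfl | rfl : n = 1 ∨ n = 2 := by omega
      · exact hgenuine (isComplexifiedCoxeter_one hr0 hpr
          (by rw [Nat.div_self (by omega)]; norm_num))
      · exact hgenuine (isComplexifiedCoxeter_dihedral hr0)
    · exact not_steinberg_rr hr h Λ hΛ hS
  · rintro ⟨hn2, he⟩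
    have he' := he.trans (Gr1n_2_equivalent (one_sub_xi_ne_zero (Or.inl rfl)) hn).symm
    exact not_steinberg_sumLattice_three hn2
      (he'.steinberg hW (isIsometric_semidirect (by norm_num) 1 n _) hS)
  · rintro ⟨rfl, he⟩
    exact not_steinberg_G632_2
      (he.steinberg hW (isIsometric_semidirect (by norm_num) 3 2 _) hS)

theorem isOnList_of_conditions {r p n : ℕ} (hr : 3 ≤ r) (hn : 1 ≤ n) (hpr : p ∣ r)
    {Λ : Submodule ℤ (Cn n)} [DiscreteTopology Λ] [IsZLattice ℝ Λ]
    (hΛ : IsInvariant (G r p n) Λ) (hrefl : IsGeneratedByReflections (semidirect (G r p n) Λ))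
    (hgenuine : ¬ IsComplexifiedCoxeter (G r p n)) (hrp : r ≠ p)
    (h3 : ¬ (2 ≤ n ∧ Equivalent (semidirect (G r p n) Λ) (Gr1n_2 3 n)))
    (h6 : ¬ (n = 2 ∧ Equivalent (semidirect (G r p n) Λ) (G632_2 n))) :
    IsOnList (semidirect (G r p n) Λ) := by
  have hr0 : r ≠ 0 := by omega
  rcases Nat.lt_or_ge n 2 with h | h
  · obtain rfl : n = 1 := by omega
    refine isOnList_one hr0 hpr ?_ hΛ
    by_contra hq
    exact hgenuine (isComplexifiedCoxeter_one hr0 hpr (by omega))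
  · exact (classification hr hpr hrp h hΛ hrefl).resolve_right (not_or.2 ⟨h3, h6⟩)

end CrystRefl

end

theorem theorem1p1 (r p n : ℕ) (hr : 1 ≤ r) (hn : 1 ≤ n) (hpr : p ∣ r)
    (Λ : Submodule ℤ (CrystRefl.Cn n)) [DiscreteTopology Λ] [IsZLattice ℝ Λ]
    (hΛ : CrystRefl.IsInvariant (CrystRefl.G r p n) Λ)
    (hrefl : CrystRefl.IsGeneratedByReflections
      (CrystRefl.semidirect (CrystRefl.G r p n) Λ))
    (hgenuine : ¬ CrystRefl.IsComplexifiedCoxeter (CrystRefl.G r p n)) :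
    (CrystRefl.SteinbergProperty (CrystRefl.semidirect (CrystRefl.G r p n) Λ) ↔
      r ≠ p ∧
      ¬ (2 ≤ n ∧ CrystRefl.Equivalent (CrystRefl.semidirect (CrystRefl.G r p n) Λ)
          (CrystRefl.Gr1n_2 3 n)) ∧
      ¬ (n = 2 ∧ CrystRefl.Equivalent (CrystRefl.semidirect (CrystRefl.G r p n) Λ)
          (CrystRefl.G632_2 n))) ∧
    (CrystRefl.SteinbergProperty (CrystRefl.semidirect (CrystRefl.G r p n) Λ) ↔
      CrystRefl.IsOnList (CrystRefl.semidirect (CrystRefl.G r p n) Λ)) := by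
  have hr3 : 3 ≤ r := by
    by_contra h
    exact hgenuine (CrystRefl.isComplexifiedCoxeter_sign (by omega))
  have hlist := CrystRefl.IsOnList.steinberg
    (CrystRefl.isIsometric_semidirect (r := r) (by omega) p n Λ)
  have hcond := CrystRefl.SteinbergProperty.conditions hr3 hn hpr hΛ hgenuine
  have hclass := CrystRefl.isOnList_of_conditions hr3 hn hpr hΛ hrefl hgenuine
  exact ⟨⟨hcond, fun h => hlist (hclass h.1 h.2.1 h.2.2)⟩,
    fun hS => hclass (hcond hS).1 (hcond hS).2.1 (hcond hS).2.2, hlist⟩
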